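/- Let $(M,g)$ be a four-dimensional time-oriented Lorentzian manifold of signature $(-,+,+,+)$ with a time function $T$. Let $\mathcal D\subset M$ be a convex normal neighbourhood: an open set, covered by a chart, in which any two points are joined by exactly one geodesic in $\mathcal D$, depending smoothly on the end points. For $x,x'\in\mathcal D$ let $\Sigma(x,x')$ be half the squared geodesic distance (positive for spacelike and negative for timelike separation), and let $U=\Delta^{1/2}$, with $\Delta(x,x')=-\det(-\nabla_\mu\nabla_{\nu'}\Sigma)/(\sqrt{-g(x)}\sqrt{-g(x')})$ the van Vleck–Morette determinant. Let $V$ be a Hadamard coefficient for $g^{ab}\nabla_a\nabla_b-m^2-\xi R$: a smooth, real, symmetric bi-scalar on $\mathcal D\times\mathcal D$ with $V\sim\sum_n V_n\Sigma^n$ (for every $N$, $V-\sum_{n<N}V_n\Sigma^n=O(\Sigma^N)$ locally on $\mathcal D\times\mathcal D$), where the $V_n$ are smooth and solve the Hadamard recursion relations, with all derivatives acting at $x$: $$2V_0+2\nabla^aV_0\nabla_a\Sigma-2V_0U^{-1}\nabla^aU\nabla_a\Sigma+(\Box-m^2-\xi R)U=0,$$ $$2(n+1)(n+2)V_{n+1}+2(n+1)\nabla^aV_{n+1}\nabla_a\Sigma-2(n+1)V_{n+1}U^{-1}\nabla^aU\nabla_a\Sigma+(\Box-m^2-\xi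 R)V_n=0,\quad n\ge 0.$$ For $\ell>0$ and real functions $S,u,v$ of $(x,x')$ put $$H^\ell[S,u,v](x,x')=\lim_{\epsilon\to0^+}\frac1{8\pi^2}\left(\frac{u}{S_\epsilon}+v\log\frac{S_\epsilon}{\ell^2}\right),\qquad S_\epsilon=S(x,x')+2i\epsilon\,(T(x)-T(x'))+\epsilon^2,$$ with the principal logarithm; where $S>0$ this is $\frac{1}{2(2\pi)^2}\left(\frac uS+v\log\frac S{\ell^2}\right)$. Let $H^\ell=H^\ell[\Sigma,U,V]$, and let $G^+$ be a two-point function of Hadamard form on $\mathcal D$: there is a smooth complex function $W$ on $\mathcal D\times\mathcal D$ with $W=G^+-H^\ell$ wherever $\Sigma\ne0$, and $G^+(x,x')=G^+(x',x)$ at spacelike separation ($\Sigma>0$). A function $B$ is an order-$n$ approximation of $A$ if both are $C^n$ on $\mathcal D\times\mathcal D$ and $\lim_{x'\to x}\nabla_{a_k}\cdots\nabla_{a_1}B(x,x')=\lim_{x'\to x}\nabla_{a_k}\cdots\nabla_{a_1}A(x,x')$ for all $0\le k\le n$ and $x\in\mathcal D$ (derivatives at $x$). Let the real functions $\tilde\Sigma,\tilde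 U,\tilde V$ be approximations of $\Sigma,U,V$ of orders $n_\Sigma\ge6$, $n_U\ge4$, $n_V\ge2$, with $\tilde V$ of class $C^3$, and set $\tilde H^\ell=H^\ell[\tilde\Sigma,\tilde U,\tilde V]$ and $\tilde W=G^+-\tilde H^\ell$. Then for every $x\in\mathcal D$ there are unique coefficients $\overset0w(x)$, $\overset1w_a(x)$ and $\overset2w_{ab}(x)=\overset2w_{ba}(x)$ such that, as $x'\to x$, $$W(x,x')=\overset0w(x)+\overset1w{}^a(x)\nabla_a\Sigma(x,x')+\tfrac1{2!}\overset2w{}^{ab}(x)\nabla_a\Sigma(x,x')\nabla_b\Sigma(x,x')+O(|\nabla\Sigma(x,x')|^3),$$ where $|\cdot|$ is any norm on $T_xM$, and $$\overset0w(x)=[\tilde W](x),\qquad \overset2w_{ab}(x)=[\nabla_a\nabla_b\tilde W](x).$$ Here $[F](x)=L$ means that $F(x,\gamma(s))\to L$ as $s\to0^+$ for every trajectory $\gamma:[0,\infty)\to M$ with $\gamma(0)=x$ that is differentiable at $0$ with non-null tangent vector $\dot\gamma(0)$. -/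

import Mathlib

open Filter Topology Set
open scoped Manifold ContDiff

noncomputable section

namespace Hadamard

/-- The model space of a four-dimensional manifold. -/
abbrev E4 := EuclideanSpace ℝ (Fin 4)

/-! ### Tensor calculus in coordinates

`G : E4 → Matrix (Fin 4) (Fin 4) ℝ` is the matrix of components `g_{μν}` of a metric,
as a function of the coordinates. -/

section Coordinates

variable {F : Type*} [NormedAddCommGroup F] [NormedSpace ℝ F]

/-- The partial derivative `∂_i f`. -/
def pd (i : Fin 4) (f : E4 → F) (u : E4) : F :=
  fderiv ℝ f u (EuclideanSpace.single i 1)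

/-- The Christoffel symbol `Γ^c_{ab}` of the Levi-Civita connection. -/
def christoffel (G : E4 → Matrix (Fin 4) (Fin 4) ℝ) (c a b : Fin 4) (u : E4) : ℝ :=
  (1 / 2) * ∑ d, (G u)⁻¹ c d *
    (pd a (fun y => G y d b) u + pd b (fun y => G y d a) u - pd d (fun y => G y a b) u)

/-- The Riemann tensor `R^r_{smn} = ∂_m Γ^r_{ns} - ∂_n Γ^r_{ms} + Γ^r_{mk} Γ^k_{ns} -
Γ^r_{nk} Γ^k_{ms}`. -/
def riemann (G : E4 → Matrix (Fin 4) (Fin 4) ℝ) (r s m n : Fin 4) (u : E4) : ℝ :=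
  pd m (christoffel G r n s) u - pd n (christoffel G r m s) u
    + ∑ k, (christoffel G r m k u * christoffel G k n s u
        - christoffel G r n k u * christoffel G k m s u)

/-- The scalar curvature `R = g^{sn} R^r_{srn}`. -/
def scalarCurv (G : E4 → Matrix (Fin 4) (Fin 4) ℝ) (u : E4) : ℝ :=
  ∑ s, ∑ n, (G u)⁻¹ s n * ∑ r, riemann G r s r n u

/-- The components `∇_{I 0} ∇_{I 1} ⋯ ∇_{I (k-1)} f` of the `k`-th iterated covariant derivative
of a scalar `f` (so `I 0` is the index of the derivative that is taken last), by the rule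
`∇_i T_{j₁…j_k} = ∂_i T_{j₁…j_k} - ∑_p Γ^c_{i j_p} T_{j₁…c…j_k}`. -/
def iterCov (G : E4 → Matrix (Fin 4) (Fin 4) ℝ) (f : E4 → F) :
    (k : ℕ) → (Fin k → Fin 4) → E4 → F
  | 0, _, u => f u
  | k + 1, I, u =>
      pd (I 0) (iterCov G f k (Fin.tail I)) u
        - ∑ p : Fin k, ∑ c, christoffel G c (I 0) (I p.succ) u •
            iterCov G f k (Function.update (Fin.tail I) p c) u

/-- `c : [0,1] → Ω` is an affinely parametrized geodesic with velocity `c'`. -/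
def IsGeodesic (G : E4 → Matrix (Fin 4) (Fin 4) ℝ) (Ω : Set E4) (c c' : ℝ → E4) : Prop :=
  ∀ t ∈ Icc (0 : ℝ) 1, c t ∈ Ω ∧ HasDerivWithinAt c (c' t) (Icc 0 1) t ∧
    HasDerivWithinAt c'
      (WithLp.toLp 2 fun k => -∑ i, ∑ j, christoffel G k i j (c t) * c' t i * c' t j) (Icc 0 1) t

open Classical in
/-- The initial velocity `exp_u⁻¹ u'` of the geodesic `c : [0,1] → Ω` from `u` to `u'`. -/
def geodVel (G : E4 → Matrix (Fin 4) (Fin 4) ℝ) (Ω : Set E4) (u u' : E4) : E4 :=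
  if h : ∃ p : (ℝ → E4) × (ℝ → E4), IsGeodesic G Ω p.1 p.2 ∧ p.1 0 = u ∧ p.1 1 = u' then
    h.choose.2 0
  else 0

/-- Half the squared geodesic distance `±s²/2`, positive for spacelike and negative for timelike
separation. As `g(c', c')` is constant along the geodesic `c : [0,1] → Ω` from `u` to `u'`, one has
`s = |g(c', c')|^{1/2}`, and `±s²/2 = g(c'(0), c'(0))/2`. -/
def halfSqDist (G : E4 → Matrix (Fin 4) (Fin 4) ℝ) (Ω : Set E4) (u u' : E4) : ℝ :=
  (1 / 2) * ∑ i, ∑ j, G u i j * geodVel G Ω u u' i * geodVel G Ω u u' j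

end Coordinates

/-! ### The Hadamard singular part -/

/-- `lim_{ε → 0⁺} (1/8π²) (U/S_ε + V log(S_ε/ℓ²))` with
`S_ε = S(x,x') + 2iε(T(x) - T(x')) + ε²`, and the principal branch of the logarithm. -/
def hadamardH {X : Type*} (T : X → ℝ) (ℓ : ℝ) (S U V : X → X → ℝ) (x x' : X) : ℂ :=
  limUnder (𝓝[>] (0 : ℝ)) fun ε : ℝ =>
    1 / (8 * (Real.pi : ℂ) ^ 2) *
      ((U x x' : ℂ) / ((S x x' : ℂ) + 2 * Complex.I * ε * ((T x : ℂ) - T x') + (ε : ℂ) ^ 2)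
        + (V x x' : ℂ) * Complex.log
          (((S x x' : ℂ) + 2 * Complex.I * ε * ((T x : ℂ) - T x') + (ε : ℂ) ^ 2) / (ℓ : ℂ) ^ 2))

/-- Where `S > 0`, the prescription `ε → 0⁺` is invisible. -/
theorem hadamardH_of_pos {X : Type*} (T : X → ℝ) {ℓ : ℝ} (hℓ : 0 < ℓ) (S U V : X → X → ℝ) {x x' : X}
    (hS : 0 < S x x') :
    hadamardH T ℓ S U V x x' =
      ((1 / (2 * (2 * Real.pi) ^ 2) *
        (U x x' / S x x' + V x x' * Real.log (S x x' / ℓ ^ 2)) : ℝ) : ℂ) := by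
  apply Tendsto.limUnder_eq
  have hc : Tendsto (fun ε : ℝ => (S x x' : ℂ) + 2 * Complex.I * ε * ((T x : ℂ) - T x')
      + (ε : ℂ) ^ 2) (𝓝[>] (0 : ℝ)) (𝓝 (S x x' : ℂ)) := by
    have : Continuous (fun ε : ℝ => (S x x' : ℂ) + 2 * Complex.I * ε * ((T x : ℂ) - T x')
      + (ε : ℂ) ^ 2) := by fun_prop
    simpa using (this.tendsto 0).mono_left nhdsWithin_le_nhds
  have hS0 : (S x x' : ℂ) ≠ 0 := by exact_mod_cast hS.ne'
  have hq : (0 : ℝ) < S x x' / ℓ ^ 2 := by positivity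
  have hlog : Tendsto (fun ε : ℝ => Complex.log (((S x x' : ℂ)
      + 2 * Complex.I * ε * ((T x : ℂ) - T x') + (ε : ℂ) ^ 2) / (ℓ : ℂ) ^ 2)) (𝓝[>] (0 : ℝ))
      (𝓝 (Complex.log ((S x x' : ℂ) / (ℓ : ℂ) ^ 2))) := by
    refine (hc.div_const _).clog ?_
    have : (S x x' : ℂ) / (ℓ : ℂ) ^ 2 = ((S x x' / ℓ ^ 2 : ℝ) : ℂ) := by push_cast; rfl
    rw [this]
    exact Complex.ofReal_mem_slitPlane.2 hq
  have hmain := ((((tendsto_const_nhds (x := (U x x' : ℂ))).div hc hS0).add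
    ((tendsto_const_nhds (x := (V x x' : ℂ))).mul hlog)).const_mul
      (1 / (8 * (Real.pi : ℂ) ^ 2)))
  have hv : ((1 / (2 * (2 * Real.pi) ^ 2) *
      (U x x' / S x x' + V x x' * Real.log (S x x' / ℓ ^ 2)) : ℝ) : ℂ) =
      1 / (8 * (Real.pi : ℂ) ^ 2) * ((U x x' : ℂ) / (S x x' : ℂ)
        + (V x x' : ℂ) * Complex.log ((S x x' : ℂ) / (ℓ : ℂ) ^ 2)) := by
    push_cast [Complex.ofReal_log hq.le]
    ring
  rw [hv]
  exact hmain

/-! ### Spacetimes -/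

section Spacetime

variable {M : Type*} [TopologicalSpace M] [ChartedSpace E4 M]

/-- The components of a field of bilinear forms in the coordinates given by `φ`. -/
def components (g : ∀ x : M, TangentSpace 𝓘(ℝ, E4) x →ₗ[ℝ] TangentSpace 𝓘(ℝ, E4) x →ₗ[ℝ] ℝ)
    (φ : OpenPartialHomeomorph M E4) (u : E4) : Matrix (Fin 4) (Fin 4) ℝ :=
  Matrix.of fun i j =>
    g (φ.symm u)
      (mfderiv 𝓘(ℝ, E4) 𝓘(ℝ, E4) φ.symm u (EuclideanSpace.single i (1 : ℝ) : E4))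
      (mfderiv 𝓘(ℝ, E4) 𝓘(ℝ, E4) φ.symm u (EuclideanSpace.single j (1 : ℝ) : E4))

variable (M) in
/-- A smooth Lorentzian metric of signature `(-,+,+,+)`. -/
structure LorentzMetric where
  /-- The metric at each point. -/
  val : ∀ x : M, TangentSpace 𝓘(ℝ, E4) x →ₗ[ℝ] TangentSpace 𝓘(ℝ, E4) x →ₗ[ℝ] ℝ
  signature : ∀ x : M, ∃ b : Module.Basis (Fin 4) ℝ (TangentSpace 𝓘(ℝ, E4) x),
    ∀ i j, val x (b i) (b j) = if i = j then (if i = 0 then -1 else 1) else 0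
  smooth : ∀ φ ∈ IsManifold.maximalAtlas 𝓘(ℝ, E4) ∞ M, ∀ i j,
    ContDiffOn ℝ ∞ (fun u => components val φ u i j) φ.target

/-- A time orientation: a continuous timelike vector field, declared to be future-directed. -/
structure TimeOrientation [IsManifold 𝓘(ℝ, E4) ∞ M] (g : LorentzMetric M) where
  /-- The vector field. -/
  field : ∀ x : M, TangentSpace 𝓘(ℝ, E4) x
  timelike : ∀ x, g.val x (field x) (field x) < 0
  cont : Continuous fun x => (⟨x, field x⟩ : TangentBundle 𝓘(ℝ, E4) M)

/-- A nonzero causal vector in the same half of the causal cone as the time orientation. -/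
def IsFutureCausal [IsManifold 𝓘(ℝ, E4) ∞ M] (g : LorentzMetric M) (o : TimeOrientation g) (x : M)
    (v : TangentSpace 𝓘(ℝ, E4) x) : Prop :=
  v ≠ 0 ∧ g.val x v v ≤ 0 ∧ g.val x v (o.field x) < 0

/-- A time function: continuous, and strictly increasing along every future-directed causal
curve. -/
def IsTimeFunction [IsManifold 𝓘(ℝ, E4) ∞ M] (g : LorentzMetric M) (o : TimeOrientation g)
    (T : M → ℝ) : Prop :=
  Continuous T ∧ ∀ (a b : ℝ) (γ : ℝ → M), a < b →
    ContMDiffOn 𝓘(ℝ, ℝ) 𝓘(ℝ, E4) 1 γ (Icc a b) →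
    (∀ t ∈ Icc a b, IsFutureCausal g o (γ t)
      (mfderivWithin 𝓘(ℝ, ℝ) 𝓘(ℝ, E4) γ (Icc a b) t (1 : ℝ))) →
    T (γ a) < T (γ b)

/-- The matrix `g_{μν}` in the coordinates `φ`. -/
def LorentzMetric.coord (g : LorentzMetric M) (φ : OpenPartialHomeomorph M E4) :
    E4 → Matrix (Fin 4) (Fin 4) ℝ :=
  components g.val φ

/-- `D`, contained in the domain of the chart `φ`, is a convex normal neighbourhood: it is open,
any two of its points are joined by exactly one geodesic in `D`, and this geodesic depends smoothly
on its end points. -/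
structure IsConvexNormal (g : LorentzMetric M) (φ : OpenPartialHomeomorph M E4) (D : Set M) :
    Prop where
  isOpen : IsOpen D
  subset_source : D ⊆ φ.source
  exists_geodesic : ∀ u ∈ φ '' D, ∀ u' ∈ φ '' D,
    ∃ c c', IsGeodesic (g.coord φ) (φ '' D) c c' ∧ c 0 = u ∧ c 1 = u'
  unique_geodesic : ∀ c₁ c₁' c₂ c₂' : ℝ → E4,
    IsGeodesic (g.coord φ) (φ '' D) c₁ c₁' → IsGeodesic (g.coord φ) (φ '' D) c₂ c₂' →
    c₁ 0 = c₂ 0 → c₁ 1 = c₂ 1 → EqOn c₁ c₂ (Icc 0 1)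
  smooth_velocity : ContDiffOn ℝ ∞ (fun p : E4 × E4 => geodVel (g.coord φ) (φ '' D) p.1 p.2)
    ((φ '' D) ×ˢ (φ '' D))

/-! ### Bi-scalars -/

section BiScalars

variable {F : Type*} [NormedAddCommGroup F] [NormedSpace ℝ F]

/-- The bi-scalar `A` is of class `C^n` on `D × D`. -/
def IsCOn (D : Set M) (n : ℕ∞) (A : M → M → F) : Prop :=
  ContMDiffOn (𝓘(ℝ, E4).prod 𝓘(ℝ, E4)) 𝓘(ℝ, F) n (fun p : M × M => A p.1 p.2) (D ×ˢ D)

/-- The components in the coordinates `φ` of `∇_{I 0} ⋯ ∇_{I (k-1)} A(x, x')`; all the derivatives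
act on the first argument. -/
def covD (g : LorentzMetric M) (φ : OpenPartialHomeomorph M E4) (k : ℕ) (I : Fin k → Fin 4)
    (A : M → M → F) (x x' : M) : F :=
  iterCov (g.coord φ) (fun u => A (φ.symm u) x') k I (φ x)

/-- `B` is an order-`n` split-point approximation of `A` on `D`: both are of class `C^n`, and
`[∇_{a_k} ⋯ ∇_{a_1} B] = [∇_{a_k} ⋯ ∇_{a_1} A]` for `0 ≤ k ≤ n`. -/
structure IsApprox (g : LorentzMetric M) (φ : OpenPartialHomeomorph M E4) (D : Set M) (n : ℕ)
    (A B : M → M → F) : Prop where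
  left : IsCOn D n A
  right : IsCOn D n B
  coincidence : ∀ k ≤ n, ∀ I : Fin k → Fin 4, ∀ x ∈ D, ∃ L : F,
    Tendsto (fun x' => covD g φ k I B x x') (𝓝[≠] x) (𝓝 L) ∧
    Tendsto (fun x' => covD g φ k I A x x') (𝓝[≠] x) (𝓝 L)

/-- The coincidence limit of a bi-scalar that is singular at null separation, such as the ones built
from `1/Σ` and `log Σ`: `f x x'` tends to `L` as `x'` tends to `x` along any trajectory that reaches
`x` with a tangent vector which is not null. -/
def HasCoincidenceLimit (g : LorentzMetric M) (f : M → M → F) (x : M) (L : F) : Prop :=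
  ∀ γ : ℝ → M, γ 0 = x → MDifferentiableWithinAt 𝓘(ℝ, ℝ) 𝓘(ℝ, E4) γ (Ici 0) 0 →
    g.val (γ 0) (mfderivWithin 𝓘(ℝ, ℝ) 𝓘(ℝ, E4) γ (Ici 0) 0 (1 : ℝ))
      (mfderivWithin 𝓘(ℝ, ℝ) 𝓘(ℝ, E4) γ (Ici 0) 0 (1 : ℝ)) ≠ 0 →
    Tendsto (fun s => f x (γ s)) (𝓝[>] 0) (𝓝 L)

end BiScalars

/-- Half the squared geodesic distance `Σ(x, x')` in the convex normal neighbourhood `D`. -/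
def worldFn (g : LorentzMetric M) (φ : OpenPartialHomeomorph M E4) (D : Set M) (x x' : M) : ℝ :=
  halfSqDist (g.coord φ) (φ '' D) (φ x) (φ x')

/-- The van Vleck-Morette determinant
`Δ(x, x') = -det(-∂_μ ∂_ν' Σ(x, x')) / (√(-g(x)) √(-g(x')))`. -/
def vanVleck (g : LorentzMetric M) (φ : OpenPartialHomeomorph M E4) (D : Set M) (x x' : M) : ℝ :=
  -(Matrix.of fun i j : Fin 4 =>
      -pd i (fun u => pd j (fun u' => halfSqDist (g.coord φ) (φ '' D) u u') (φ x')) (φ x)).det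
    / (√(-(g.coord φ (φ x)).det) * √(-(g.coord φ (φ x')).det))

/-- The Hadamard coefficient `U = Δ^{1/2}`. -/
def hadamardU (g : LorentzMetric M) (φ : OpenPartialHomeomorph M E4) (D : Set M) (x x' : M) : ℝ :=
  √(vanVleck g φ D x x')

/-- `g^{ab} ∇_a A ∇_b B`, with the derivatives acting on the first argument. -/
def gradDot (g : LorentzMetric M) (φ : OpenPartialHomeomorph M E4) (A B : M → M → ℝ)
    (x x' : M) : ℝ :=
  ∑ a, ∑ b, (g.coord φ (φ x))⁻¹ a b * covD g φ 1 ![a] A x x' * covD g φ 1 ![b] B x x'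

/-- The Klein-Gordon operator `g^{ab} ∇_a ∇_b - m² - ξ R`, acting on the first argument. -/
def kleinGordon (g : LorentzMetric M) (φ : OpenPartialHomeomorph M E4) (m ξ : ℝ) (A : M → M → ℝ)
    (x x' : M) : ℝ :=
  ∑ a, ∑ b, (g.coord φ (φ x))⁻¹ a b * covD g φ 2 ![a, b] A x x'
    - m ^ 2 * A x x' - ξ * scalarCurv (g.coord φ) (φ x) * A x x'

/-- `V` is a Hadamard coefficient for the Klein-Gordon operator with mass `m` and curvature coupling
`ξ`: a smooth symmetric bi-scalar with the asymptotic expansion `V ~ ∑ V_n Σ^n`, where the `V_n`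
are smooth and satisfy the Hadamard recursion relations. -/
def IsHadamardV (g : LorentzMetric M) (φ : OpenPartialHomeomorph M E4) (D : Set M) (m ξ : ℝ)
    (V : M → M → ℝ) : Prop :=
  IsCOn D ⊤ V ∧ (∀ x ∈ D, ∀ x' ∈ D, V x x' = V x' x) ∧
  ∃ Vn : ℕ → M → M → ℝ, (∀ n, IsCOn D ⊤ (Vn n)) ∧
    (∀ x ∈ D, ∀ x' ∈ D,
      2 * Vn 0 x x' + 2 * gradDot g φ (Vn 0) (worldFn g φ D) x x'
        - 2 * Vn 0 x x' * (hadamardU g φ D x x')⁻¹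
            * gradDot g φ (hadamardU g φ D) (worldFn g φ D) x x'
        + kleinGordon g φ m ξ (hadamardU g φ D) x x' = 0) ∧
    (∀ n : ℕ, ∀ x ∈ D, ∀ x' ∈ D,
      2 * (n + 1) * (n + 2) * Vn (n + 1) x x'
        + 2 * (n + 1) * gradDot g φ (Vn (n + 1)) (worldFn g φ D) x x'
        - 2 * (n + 1) * Vn (n + 1) x x' * (hadamardU g φ D x x')⁻¹
            * gradDot g φ (hadamardU g φ D) (worldFn g φ D) x x'
        + kleinGordon g φ m ξ (Vn n) x x' = 0) ∧
    ∀ N : ℕ, ∀ p ∈ D ×ˢ D,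
      (fun q : M × M => V q.1 q.2 - ∑ n ∈ Finset.range N, Vn n q.1 q.2 * worldFn g φ D q.1 q.2 ^ n)
        =O[𝓝 p] fun q => worldFn g φ D q.1 q.2 ^ N

/-- `W` is the regular part `G⁺ - H^ℓ` of a two-point function `G⁺` that has the Hadamard form on
`D`: it is smooth on `D × D`, and it is `G⁺ - H^ℓ` wherever this makes sense pointwise, namely at
non-null separation. Moreover `G⁺` satisfies local commutativity: it is symmetric at spacelike
separation. -/
structure IsHadamardForm (g : LorentzMetric M) (φ : OpenPartialHomeomorph M E4) (D : Set M)
    (T : M → ℝ) (ℓ : ℝ) (V : M → M → ℝ) (Gp W : M → M → ℂ) : Prop where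
  smooth : IsCOn D ⊤ W
  eq_sub : ∀ x ∈ D, ∀ x' ∈ D, worldFn g φ D x x' ≠ 0 →
    W x x' = Gp x x' - hadamardH T ℓ (worldFn g φ D) (hadamardU g φ D) V x x'
  commute : ∀ x ∈ D, ∀ x' ∈ D, 0 < worldFn g φ D x x' → Gp x x' = Gp x' x

/-- The contravariant gradient `g^{ab} ∇_b Σ(x, x')`. -/
def gradUp (g : LorentzMetric M) (φ : OpenPartialHomeomorph M E4) (D : Set M) (x x' : M)
    (a : Fin 4) : ℝ :=
  ∑ b, (g.coord φ (φ x))⁻¹ a b * covD g φ 1 ![b] (worldFn g φ D) x x'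

/-- The components `w = (w⁰, w¹_a, w²_{ab})`, with `w²_{ab}` symmetric, are the coefficients of the
second-order covariant Taylor expansion of `W` at `x`: as `x' → x`,
`W(x,x') = w⁰ + w¹^a ∇_a Σ(x,x') + (1/2!) w²^{ab} ∇_a Σ(x,x') ∇_b Σ(x,x') + O(|∇Σ(x,x')|³)`. -/
def IsCovTaylor (g : LorentzMetric M) (φ : OpenPartialHomeomorph M E4) (D : Set M)
    (W : M → M → ℂ) (x : M) (w : ℂ × (Fin 4 → ℂ) × Matrix (Fin 4) (Fin 4) ℂ) : Prop :=
  w.2.2.IsSymm ∧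
  (fun x' => W x x' - (w.1 + ∑ a, w.2.1 a * gradUp g φ D x x' a
      + (1 / 2) * ∑ a, ∑ b, w.2.2 a b * gradUp g φ D x x' a * gradUp g φ D x x' b))
    =O[𝓝 x] fun x' => ‖gradUp g φ D x x'‖ ^ 3

end Spacetime

end Hadamard

end

noncomputable section

namespace Hadamard

/-! Everything is computed in the chart, with `a` the image of `x`, `u'` that of `x'`, and `r = ‖u'
- a‖`.

The Taylor coefficients. Along a geodesic leaving `u` with velocity `w`, the inverse exponential map
takes the value `t w`. Differentiating this twice (`IsNormal.D2_vel_jet`) gives its 2-jet on the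
diagonal, and from it that of `Σ^a = ∇^aΣ(x,·)`: value `0`, first derivatives `-δ`, second
derivatives `-Γ`. Thus `-Σ^a` agrees to second order with normal coordinates at `x`, and expanding
the smooth `W(x,·)` in powers of `Σ^a` gives unique coefficients (`isCovTaylor_iff_eq`); the zeroth
is `W(x,x)` and the second is the covariant Hessian of `W(x,·)` at `x`.

From `x'` to `x`. That Hessian acts at the second point, whereas the coincidence limits
differentiate at the first. At spacelike separation `Σ`, `U`, `V` and `G⁺` are symmetric, hence so
is `W`. As `x` lies in the closure of the open set of points spacelike to it, the 2-jets of `W(·,x)`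
and `W(x,·)` agree at `x` (`IsHadamardForm.jet_symm`).

The approximation. It remains to see that the 2-jet at `x` of `H - H̃` in the first argument tends
to zero (`negligible_sub`). Approximation to order `n` means that the difference vanishes on the
diagonal with its derivatives up to order `n`, so that it is `o(r^n)`, each derivative costing one
power of `r`. A trajectory with non-null tangent satisfies `|Σ| ≥ κ r²`. Two derivatives must be
survived, so each term of `H - H̃` needs size `o(r²)`. With `e = Σ̃ - Σ`, the term `U e / (Σ Σ̃)` is
`o(r⁶) / r⁴`, `(Ũ - U) / Σ̃` is `o(r⁴) / r²`, and `V log(1 + e / Σ)` is `o(r⁴)`. In `(Ṽ - V) log Σ̃`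
the bound `o(r²)` would lose against the logarithm; here `Ṽ` being `C³` gives `O(r³)`. These are the
orders six, four and two of the hypotheses. `JetO` keeps the account of powers of `r` for a function
together with its first two derivatives.

The branch. At timelike separation the `ε`-limit of the logarithm is `log|S| ± iπ`, with the sign of
`T(x) - T(x')`. This difference is nonzero because a timelike geodesic, run in one of its two
directions, is future-directed (`time_ne_of_timelike`). Near each pair of non-null separated points
on the trajectory both singular parts use the same branch, so the imaginary part only adds a bounded
multiple of `V - Ṽ`. `tendsto_approx` collects all this. -/

theorem natCast_le_infty (n : ℕ) : (n : WithTop ℕ∞) ≤ ∞ := by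
  exact_mod_cast le_top

theorem two_le_infty : (2 : WithTop ℕ∞) ≤ ∞ := natCast_le_infty 2

theorem three_le_infty : (3 : WithTop ℕ∞) ≤ ∞ := natCast_le_infty 3

/-! ### Partial derivatives -/

section PartialDerivatives

variable {F : Type*} [NormedAddCommGroup F] [NormedSpace ℝ F]

theorem pd_congr {f g : E4 → F} {u : E4} (h : f =ᶠ[𝓝 u] g) (i : Fin 4) : pd i f u = pd i g u := by
  unfold pd; rw [h.fderiv_eq]

theorem pd_eventuallyEq {f g : E4 → F} {u : E4} (h : f =ᶠ[𝓝 u] g) (i : Fin 4) :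
    pd i f =ᶠ[𝓝 u] pd i g :=
  h.eventuallyEq_nhds.mono fun _ hy => pd_congr hy i

theorem pd_const (i : Fin 4) (c : F) (u : E4) : pd i (fun _ => c) u = 0 := by
  simp [pd]

theorem pd_add {f g : E4 → F} {u : E4} (hf : DifferentiableAt ℝ f u) (hg : DifferentiableAt ℝ g u)
    (i : Fin 4) : pd i (fun y => f y + g y) u = pd i f u + pd i g u := by
  unfold pd; rw [fderiv_fun_add hf hg]; rfl

theorem pd_sub {f g : E4 → F} {u : E4} (hf : DifferentiableAt ℝ f u) (hg : DifferentiableAt ℝ g u)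
    (i : Fin 4) : pd i (fun y => f y - g y) u = pd i f u - pd i g u := by
  unfold pd; rw [fderiv_fun_sub hf hg]; rfl

theorem pd_neg {f : E4 → F} {u : E4} (i : Fin 4) : pd i (fun y => -f y) u = -pd i f u := by
  unfold pd; rw [fderiv_fun_neg]; rfl

theorem pd_smul {f : E4 → ℝ} {g : E4 → F} {u : E4} (hf : DifferentiableAt ℝ f u)
    (hg : DifferentiableAt ℝ g u) (i : Fin 4) :
    pd i (fun y => f y • g y) u = pd i f u • g u + f u • pd i g u := by
  unfold pd; rw [fderiv_fun_smul hf hg]; simp [add_comm]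

theorem pd_mul {f g : E4 → ℝ} {u : E4} (hf : DifferentiableAt ℝ f u)
    (hg : DifferentiableAt ℝ g u) (i : Fin 4) :
    pd i (fun y => f y * g y) u = pd i f u * g u + f u * pd i g u :=
  pd_smul hf hg i

theorem pd_sum {ι : Type*} {s : Finset ι} {f : ι → E4 → F} {u : E4}
    (hf : ∀ k ∈ s, DifferentiableAt ℝ (f k) u) (i : Fin 4) :
    pd i (fun y => ∑ k ∈ s, f k y) u = ∑ k ∈ s, pd i (f k) u := by
  unfold pd; rw [fderiv_fun_sum hf]; simp

theorem pd_comp {h : ℝ → ℝ} {f : E4 → ℝ} {u : E4} (hh : DifferentiableAt ℝ h (f u))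
    (hf : DifferentiableAt ℝ f u) (i : Fin 4) :
    pd i (fun y => h (f y)) u = deriv h (f u) * pd i f u := by
  unfold pd
  have := (hh.hasDerivAt.comp_hasFDerivAt u hf.hasFDerivAt).fderiv
  rw [show (fun y => h (f y)) = h ∘ f from rfl, this]; rfl

theorem sum_smul_single (w : E4) : w = ∑ i, w i • EuclideanSpace.single i (1 : ℝ) := by
  ext k; simp [Pi.single_apply]

theorem fderiv_eq_sum_pd (f : E4 → F) (u w : E4) : fderiv ℝ f u w = ∑ i, w i • pd i f u := by
  conv_lhs => rw [sum_smul_single w]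
  simp [pd]

theorem norm_fderiv_le_sum_pd (f : E4 → F) (u : E4) : ‖fderiv ℝ f u‖ ≤ ∑ i, ‖pd i f u‖ := by
  refine ContinuousLinearMap.opNorm_le_bound _ (Finset.sum_nonneg fun _ _ => norm_nonneg _)
    fun w => ?_
  rw [fderiv_eq_sum_pd, Finset.sum_mul]
  refine (norm_sum_le _ _).trans (Finset.sum_le_sum fun i _ => ?_)
  rw [norm_smul, mul_comm]
  exact mul_le_mul_of_nonneg_left (PiLp.norm_apply_le w i) (norm_nonneg _)

/-- A function that vanishes at `a`, and whose partial derivatives are of order `n`, is of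
order `n + 1`. -/
theorem norm_le_of_pd_le {s : Set E4} (hs : Convex ℝ s) {a : E4} (ha : a ∈ s) {f : E4 → F}
    (hf : ∀ z ∈ s, DifferentiableAt ℝ f z) (hfa : f a = 0) {K : ℝ} {n : ℕ}
    (hK : ∀ i, ∀ z ∈ s, ‖pd i f z‖ ≤ K * ‖z - a‖ ^ n) {z : E4} (hz : z ∈ s) :
    ‖f z‖ ≤ 4 * K * ‖z - a‖ ^ (n + 1) := by
  rcases eq_or_ne z a with rfl | hza
  · simp [hfa]
  have hpos : 0 < ‖z - a‖ := norm_pos_iff.2 (sub_ne_zero.2 hza)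
  have hK0 : 0 ≤ K := by
    have := (norm_nonneg _).trans (hK 0 z hz)
    exact nonneg_of_mul_nonneg_left this (by positivity)
  have hseg : segment ℝ a z ⊆ s := hs.segment_subset ha hz
  -- The factor 4 counts the coordinates, the operator norm being at most the sum of the four
  -- partial derivatives. Working on the segment from `a` to `z` allows `‖y - a‖` to be replaced by
  -- `‖z - a‖`.
  have hb : ∀ y ∈ segment ℝ a z, ‖fderiv ℝ f y‖ ≤ 4 * K * ‖z - a‖ ^ n := by
    intro y hy
    have hy' : ‖y - a‖ ≤ ‖z - a‖ := by
      obtain ⟨t, ht, rfl⟩ := (segment_eq_image' ℝ a z ▸ hy :)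
      simp only [add_sub_cancel_left, norm_smul, Real.norm_eq_abs, abs_of_nonneg ht.1]
      exact mul_le_of_le_one_left (norm_nonneg _) ht.2
    calc ‖fderiv ℝ f y‖ ≤ ∑ i, ‖pd i f y‖ := norm_fderiv_le_sum_pd f y
      _ ≤ ∑ _i : Fin 4, K * ‖z - a‖ ^ n := Finset.sum_le_sum fun i _ =>
          (hK i y (hseg hy)).trans (by gcongr)
      _ = 4 * K * ‖z - a‖ ^ n := by simp; ring
  have := (convex_segment a z).norm_image_sub_le_of_norm_hasFDerivWithin_le
    (fun y hy => (hf y (hseg hy)).hasFDerivAt.hasFDerivWithinAt) hb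
    (left_mem_segment ℝ a z) (right_mem_segment ℝ a z)
  rw [hfa, sub_zero] at this
  rw [pow_succ, ← mul_assoc]
  exact this

theorem _root_.ContDiffAt.pd {f : E4 → F} {u : E4} {m n : WithTop ℕ∞} (hf : ContDiffAt ℝ n f u)
    (hmn : m + 1 ≤ n) (i : Fin 4) : ContDiffAt ℝ m (pd i f) u :=
  (hf.fderiv_right hmn).clm_apply contDiffAt_const

theorem _root_.ContDiffOn.pd {f : E4 → F} {Ω : Set E4} (hΩ : IsOpen Ω) {m n : WithTop ℕ∞}
    (hf : ContDiffOn ℝ n f Ω) (hmn : m + 1 ≤ n) (i : Fin 4) : ContDiffOn ℝ m (pd i f) Ω :=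
  fun _ hu => ((hf.contDiffAt (hΩ.mem_nhds hu)).pd hmn i).contDiffWithinAt

theorem pd_comm {f : E4 → F} {u : E4} (hf : ContDiffAt ℝ 2 f u) (i j : Fin 4) :
    pd i (pd j f) u = pd j (pd i f) u := by
  have hd : DifferentiableAt ℝ (fderiv ℝ f) u :=
    (hf.fderiv_right (m := 1) (by norm_num)).differentiableAt (by norm_num)
  have key : ∀ i j : Fin 4, pd i (pd j f) u =
      fderiv ℝ (fderiv ℝ f) u (EuclideanSpace.single i 1) (EuclideanSpace.single j 1) := by
    intro i j
    unfold pd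
    rw [fderiv_clm_apply hd (differentiableAt_const _)]
    simp
  rw [key, key]
  exact (hf.isSymmSndFDerivAt (by simp)).eq _ _

theorem pd_pd_add {f g : E4 → F} {u : E4} (hf : ContDiffAt ℝ 2 f u) (hg : ContDiffAt ℝ 2 g u)
    (i j : Fin 4) :
    pd i (pd j fun y => f y + g y) u = pd i (pd j f) u + pd i (pd j g) u := by
  have h1 : (pd j fun y => f y + g y) =ᶠ[𝓝 u] fun y => pd j f y + pd j g y := by
    filter_upwards [hf.eventually (by simp), hg.eventually (by simp)] with y h1 h2
    exact pd_add (h1.differentiableAt (by simp)) (h2.differentiableAt (by simp)) j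
  rw [pd_congr h1]
  exact pd_add ((hf.pd (m := 1) (by norm_num) j).differentiableAt (by simp))
    ((hg.pd (m := 1) (by norm_num) j).differentiableAt (by simp)) i

theorem pd_pd_sum {ι : Type*} {s : Finset ι} {f : ι → E4 → F} {u : E4}
    (hf : ∀ k ∈ s, ContDiffAt ℝ 2 (f k) u) (i j : Fin 4) :
    pd i (pd j fun y => ∑ k ∈ s, f k y) u = ∑ k ∈ s, pd i (pd j (f k)) u := by
  have h1 : (pd j fun y => ∑ k ∈ s, f k y) =ᶠ[𝓝 u] fun y => ∑ k ∈ s, pd j (f k) y := by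
    have : ∀ᶠ y in 𝓝 u, ∀ k ∈ s, ContDiffAt ℝ 2 (f k) y := by
      rw [Filter.eventually_all_finset]
      exact fun k hk => (hf k hk).eventually (by simp)
    filter_upwards [this] with y h1
    exact pd_sum (fun k hk => (h1 k hk).differentiableAt (by simp)) j
  rw [pd_congr h1]
  exact pd_sum (fun k hk => ((hf k hk).pd (m := 1) (by norm_num) j).differentiableAt (by simp)) i

theorem pd_pd_smul {f : E4 → ℝ} {g : E4 → F} {u : E4} (hf : ContDiffAt ℝ 2 f u)
    (hg : ContDiffAt ℝ 2 g u) (i j : Fin 4) :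
    pd i (pd j fun y => f y • g y) u = pd i (pd j f) u • g u + pd j f u • pd i g u
      + (pd i f u • pd j g u + f u • pd i (pd j g) u) := by
  have h1 : (pd j fun y => f y • g y) =ᶠ[𝓝 u] fun y => pd j f y • g y + f y • pd j g y := by
    filter_upwards [hf.eventually (by simp), hg.eventually (by simp)] with y h1 h2
    exact pd_smul (h1.differentiableAt (by simp)) (h2.differentiableAt (by simp)) j
  have hf' := (hf.pd (m := 1) (by norm_num) j).differentiableAt (by simp)
  have hg' := (hg.pd (m := 1) (by norm_num) j).differentiableAt (by simp)
  have hf0 := hf.differentiableAt (by simp)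
  have hg0 := hg.differentiableAt (by simp)
  rw [pd_congr h1, pd_add (f := fun y => pd j f y • g y) (g := fun y => f y • pd j g y)
    (hf'.smul hg0) (hf0.smul hg'), pd_smul hf' hg0, pd_smul hf0 hg']

theorem pd_pd_mul {f g : E4 → ℝ} {u : E4} (hf : ContDiffAt ℝ 2 f u)
    (hg : ContDiffAt ℝ 2 g u) (i j : Fin 4) :
    pd i (pd j fun y => f y * g y) u = pd i (pd j f) u * g u + pd j f u * pd i g u
      + (pd i f u * pd j g u + f u * pd i (pd j g) u) :=
  pd_pd_smul hf hg i j

theorem pd_pd_comp {h : ℝ → ℝ} {f : E4 → ℝ} {u : E4} (hh : ContDiffAt ℝ 2 h (f u))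
    (hf : ContDiffAt ℝ 2 f u) (i j : Fin 4) :
    pd i (pd j fun y => h (f y)) u =
      deriv (deriv h) (f u) * pd i f u * pd j f u + deriv h (f u) * pd i (pd j f) u := by
  have h1 : (pd j fun y => h (f y)) =ᶠ[𝓝 u] fun y => deriv h (f y) * pd j f y := by
    filter_upwards [hf.eventually (by simp),
      hf.continuousAt.eventually (hh.eventually (by simp))] with y h1 h2
    exact pd_comp (h2.differentiableAt (by simp)) (h1.differentiableAt (by simp)) j
  have hf' := (hf.pd (m := 1) (by norm_num) j).differentiableAt (by simp)
  have hf0 := hf.differentiableAt (by simp)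
  have hd : DifferentiableAt ℝ (deriv h) (f u) := by
    have := hh.fderiv_right (m := 1) (by norm_num)
    exact ((this.differentiableAt (by simp)).clm_apply (differentiableAt_const (1 : ℝ)))
  have hd' : DifferentiableAt ℝ (fun y => deriv h (f y)) u := hd.comp u hf0
  rw [pd_congr h1, pd_mul hd' hf', pd_comp hd hf0]

/-- A function of class `C³` whose second-order jet at `a` vanishes is of order three. -/
theorem isBigO_norm_pow_three {f : E4 → F} {a : E4} (hf : ContDiffAt ℝ 3 f a) (h0 : f a = 0)
    (h1 : ∀ i, pd i f a = 0) (h2 : ∀ i j, pd i (pd j f) a = 0) :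
    f =O[𝓝 a] fun y => ‖y - a‖ ^ 3 := by
  have hc : ∀ i j k, ContinuousAt (pd i (pd j (pd k f))) a := fun i j k =>
    (((hf.pd (m := 2) (by norm_num) k).pd (m := 1) (by norm_num) j).pd (m := 0)
      (by norm_num) i).continuousAt
  have hbd : ∀ᶠ y in 𝓝 a, ∀ i j k, ‖pd i (pd j (pd k f)) y‖ ≤
      1 + ∑ i, ∑ j, ∑ k, ‖pd i (pd j (pd k f)) a‖ := by
    simp only [Filter.eventually_all]
    intro i j k
    have hlt : ‖pd i (pd j (pd k f)) a‖ < 1 + ∑ i, ∑ j, ∑ k, ‖pd i (pd j (pd k f)) a‖ := by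
      have e1 : ‖pd i (pd j (pd k f)) a‖ ≤ ∑ k, ‖pd i (pd j (pd k f)) a‖ :=
        Finset.single_le_sum (f := fun k => ‖pd i (pd j (pd k f)) a‖)
          (fun _ _ => norm_nonneg _) (Finset.mem_univ k)
      have e2 := Finset.single_le_sum (f := fun j => ∑ k, ‖pd i (pd j (pd k f)) a‖)
          (fun _ _ => Finset.sum_nonneg fun _ _ => norm_nonneg _) (Finset.mem_univ j)
      have e3 := Finset.single_le_sum (f := fun i => ∑ j, ∑ k, ‖pd i (pd j (pd k f)) a‖)
          (fun _ _ => Finset.sum_nonneg fun _ _ => Finset.sum_nonneg fun _ _ => norm_nonneg _)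
          (Finset.mem_univ i)
      linarith
    exact ((hc i j k).norm.eventually_lt_const hlt).mono fun _ h => h.le
  obtain ⟨δ, hδ, hball⟩ := Metric.eventually_nhds_iff_ball.1 (hbd.and (hf.eventually (by simp)))
  set K := 1 + ∑ i, ∑ j, ∑ k, ‖pd i (pd j (pd k f)) a‖
  have ha : a ∈ Metric.ball a δ := Metric.mem_ball_self hδ
  have hcv := convex_ball a δ
  -- From bounded third derivatives, `norm_le_of_pd_le` is applied three times, each use gaining one
  -- power of the distance.
  have s2 : ∀ j k, ∀ z ∈ Metric.ball a δ, ‖pd j (pd k f) z‖ ≤ 4 * K * ‖z - a‖ ^ (0 + 1) :=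
    fun j k z hz => norm_le_of_pd_le hcv ha
      (fun z hz => (((hball z hz).2.pd (m := 2) (by norm_num) k).pd (m := 1)
        (by norm_num) j).differentiableAt (by simp)) (h2 j k)
      (fun i z hz => by simpa using (hball z hz).1 i j k) hz
  have s1 : ∀ k, ∀ z ∈ Metric.ball a δ, ‖pd k f z‖ ≤ 4 * (4 * K) * ‖z - a‖ ^ (0 + 1 + 1) :=
    fun k z hz => norm_le_of_pd_le hcv ha
      (fun z hz => ((hball z hz).2.pd (m := 2) (by norm_num) k).differentiableAt (by simp)) (h1 k)
      (fun i z hz => s2 i k z hz) hz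
  refine Asymptotics.IsBigO.of_bound (4 * (4 * (4 * K))) ?_
  filter_upwards [Metric.ball_mem_nhds a hδ] with z hz
  have := norm_le_of_pd_le hcv ha
      (fun z hz => (hball z hz).2.differentiableAt (by simp)) h0 s1 hz
  simpa using this

end PartialDerivatives

/-! ### Functions of two points -/

section TwoPoints

variable {F : Type*} [NormedAddCommGroup F] [NormedSpace ℝ F]

/-- `f` is of class `C^n` on `Ω × Ω`. -/
def Reg (Ω : Set E4) (n : WithTop ℕ∞) (f : E4 → E4 → F) : Prop :=
  ContDiffOn ℝ n (fun p : E4 × E4 => f p.1 p.2) (Ω ×ˢ Ω)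

/-- The partial derivative in the first argument. -/
def D1 (i : Fin 4) (f : E4 → E4 → F) : E4 → E4 → F := fun u u' => pd i (fun y => f y u') u

/-- The partial derivative in the second argument. -/
def D2 (i : Fin 4) (f : E4 → E4 → F) : E4 → E4 → F := fun u u' => pd i (f u) u'

variable {Ω : Set E4} {m n : WithTop ℕ∞} {f g : E4 → E4 → F}

theorem Reg.of_le (hf : Reg Ω n f) (h : m ≤ n) : Reg Ω m f := ContDiffOn.of_le hf h

theorem Reg.contDiffAt (hΩ : IsOpen Ω) (hf : Reg Ω n f) {u u' : E4} (hu : u ∈ Ω) (hu' : u' ∈ Ω) :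
    ContDiffAt ℝ n (fun p : E4 × E4 => f p.1 p.2) (u, u') :=
  ContDiffOn.contDiffAt hf ((hΩ.prod hΩ).mem_nhds ⟨hu, hu'⟩)

theorem Reg.contDiffAt_left (hΩ : IsOpen Ω) (hf : Reg Ω n f) {u u' : E4} (hu : u ∈ Ω)
    (hu' : u' ∈ Ω) : ContDiffAt ℝ n (fun y => f y u') u :=
  (hf.contDiffAt hΩ hu hu').comp (f := fun y : E4 => (y, u')) u
    (contDiffAt_id.prodMk contDiffAt_const)

theorem Reg.contDiffAt_right (hΩ : IsOpen Ω) (hf : Reg Ω n f) {u u' : E4} (hu : u ∈ Ω)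
    (hu' : u' ∈ Ω) : ContDiffAt ℝ n (f u) u' :=
  (hf.contDiffAt hΩ hu hu').comp (f := fun y : E4 => (u, y)) u'
    (contDiffAt_const.prodMk contDiffAt_id)

theorem Reg.swap (hf : Reg Ω n f) : Reg Ω n fun u u' => f u' u :=
  ContDiffOn.comp (g := fun p : E4 × E4 => f p.1 p.2) hf
    (contDiff_snd.prodMk contDiff_fst).contDiffOn fun _ hp => ⟨hp.2, hp.1⟩

theorem Reg.add (hf : Reg Ω n f) (hg : Reg Ω n g) : Reg Ω n fun u u' => f u u' + g u u' :=
  ContDiffOn.add hf hg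

theorem Reg.sub (hf : Reg Ω n f) (hg : Reg Ω n g) : Reg Ω n fun u u' => f u u' - g u u' :=
  ContDiffOn.sub hf hg

theorem Reg.smul {a : E4 → E4 → ℝ} (ha : Reg Ω n a) (hf : Reg Ω n f) :
    Reg Ω n fun u u' => a u u' • f u u' :=
  ContDiffOn.smul ha hf

theorem Reg.mul {a b : E4 → E4 → ℝ} (ha : Reg Ω n a) (hb : Reg Ω n b) :
    Reg Ω n fun u u' => a u u' * b u u' :=
  ContDiffOn.mul ha hb

theorem Reg.sum {ι : Type*} {s : Finset ι} {f : ι → E4 → E4 → F} (hf : ∀ i ∈ s, Reg Ω n (f i)) :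
    Reg Ω n fun u u' => ∑ i ∈ s, f i u u' :=
  ContDiffOn.sum hf

theorem reg_of_left {a : E4 → F} (ha : ContDiffOn ℝ n a Ω) : Reg Ω n fun u _ => a u :=
  ContDiffOn.comp ha contDiff_fst.contDiffOn fun _ hp => hp.1

/-- The second argument is a parameter: joint smoothness of the partial derivative is
`ContDiffAt.fderiv` for the family `y ↦ f y u'`, evaluated at `y = u`. -/
theorem Reg.D1 (hΩ : IsOpen Ω) (hf : Reg Ω n f) (hmn : m + 1 ≤ n) (i : Fin 4) :
    Reg Ω m (D1 i f) := by
  rintro ⟨u, u'⟩ ⟨hu, hu'⟩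
  have h1 : ContDiffAt ℝ n
      (Function.uncurry fun (p : E4 × E4) (y : E4) => f y p.2) ((u, u'), u) :=
    (hf.contDiffAt hΩ hu hu').comp (f := fun q : (E4 × E4) × E4 => (q.2, q.1.2)) ((u, u'), u)
      (contDiffAt_snd.prodMk (contDiffAt_snd.comp _ contDiffAt_fst))
  have := (h1.fderiv (g := fun p : E4 × E4 => p.1) contDiffAt_fst hmn).clm_apply
    (contDiffAt_const (c := (EuclideanSpace.single i (1 : ℝ) : E4)))
  exact this.contDiffWithinAt

theorem Reg.D2 (hΩ : IsOpen Ω) (hf : Reg Ω n f) (hmn : m + 1 ≤ n) (i : Fin 4) :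
    Reg Ω m (D2 i f) :=
  (hf.swap.D1 hΩ hmn i).swap

theorem Reg.continuousAt_right (hΩ : IsOpen Ω) (hf : Reg Ω n f) {u u' : E4} (hu : u ∈ Ω)
    (hu' : u' ∈ Ω) : ContinuousAt (f u) u' :=
  (hf.contDiffAt_right hΩ hu hu').continuousAt

theorem D1_eq_fderiv {u u' : E4} (hf : DifferentiableAt ℝ (fun p : E4 × E4 => f p.1 p.2) (u, u'))
    (i : Fin 4) : D1 i f u u' =
      fderiv ℝ (fun p : E4 × E4 => f p.1 p.2) (u, u') (EuclideanSpace.single i 1, 0) := by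
  have h := hf.hasFDerivAt.comp (f := fun y : E4 => (y, u')) u
    ((hasFDerivAt_id u).prodMk (hasFDerivAt_const u' u))
  unfold D1 pd
  rw [show (fun y => f y u') = (fun p : E4 × E4 => f p.1 p.2) ∘ fun y : E4 => (y, u') from rfl,
    h.fderiv]
  rfl

theorem D2_eq_fderiv {u u' : E4} (hf : DifferentiableAt ℝ (fun p : E4 × E4 => f p.1 p.2) (u, u'))
    (i : Fin 4) : D2 i f u u' =
      fderiv ℝ (fun p : E4 × E4 => f p.1 p.2) (u, u') (0, EuclideanSpace.single i 1) := by
  have h := hf.hasFDerivAt.comp (f := fun y : E4 => (u, y)) u'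
    ((hasFDerivAt_const u u').prodMk (hasFDerivAt_id u'))
  unfold D2 pd
  rw [show f u = (fun p : E4 × E4 => f p.1 p.2) ∘ fun y : E4 => (u, y) from rfl, h.fderiv]
  rfl

/-- If `f` is constant on the diagonal, its two partial derivatives there are opposite. -/
theorem D1_eq_neg_D2 (hΩ : IsOpen Ω) (hf : Reg Ω 1 f) {c : F} (hc : ∀ u ∈ Ω, f u u = c) {u : E4}
    (hu : u ∈ Ω) (i : Fin 4) : D1 i f u u = -D2 i f u u := by
  have hd := (hf.contDiffAt hΩ hu hu).differentiableAt (by simp)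
  rw [D1_eq_fderiv hd, D2_eq_fderiv hd, eq_neg_iff_add_eq_zero, ← map_add]
  have h := hd.hasFDerivAt.comp (f := fun y : E4 => (y, y)) u
    ((hasFDerivAt_id u).prodMk (hasFDerivAt_id u))
  have h0 : HasFDerivAt ((fun p : E4 × E4 => f p.1 p.2) ∘ fun y : E4 => (y, y))
      (0 : E4 →L[ℝ] F) u :=
    (hasFDerivAt_const c u).congr_of_eventuallyEq
      (Filter.eventually_of_mem (hΩ.mem_nhds hu) fun y hy => hc y hy)
  have := congrArg (fun L : E4 →L[ℝ] F => L (EuclideanSpace.single i 1)) (h.unique h0)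
  simpa using this

/-- Both sides are entries of the second derivative of the joint function on `E4 × E4`, which is
symmetric. -/
theorem D2_D1_comm (hΩ : IsOpen Ω) (hf : Reg Ω 2 f) {u u' : E4} (hu : u ∈ Ω) (hu' : u' ∈ Ω)
    (i j : Fin 4) : D2 j (D1 i f) u u' = D1 i (D2 j f) u u' := by
  set Φ : E4 × E4 → F := fun p => f p.1 p.2
  have hΦ : ∀ y ∈ Ω, ∀ y' ∈ Ω, ContDiffAt ℝ 2 Φ (y, y') := fun y hy y' hy' =>
    hf.contDiffAt hΩ hy hy'
  have hd : DifferentiableAt ℝ (fderiv ℝ Φ) (u, u') :=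
    ((hΦ u hu u' hu').fderiv_right (m := 1) (by norm_num)).differentiableAt (by simp)
  have e1 : D2 j (D1 i f) u u' =
      fderiv ℝ (fderiv ℝ Φ) (u, u') (0, EuclideanSpace.single j 1)
        (EuclideanSpace.single i 1, 0) := by
    have : D1 i f u =ᶠ[𝓝 u'] fun y => fderiv ℝ Φ (u, y) (EuclideanSpace.single i 1, 0) :=
      Filter.eventually_of_mem (hΩ.mem_nhds hu') fun y hy =>
        D1_eq_fderiv ((hΦ u hu y hy).differentiableAt (by simp)) i
    have h := (hd.hasFDerivAt.comp (f := fun y : E4 => (u, y)) u'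
      ((hasFDerivAt_const u u').prodMk (hasFDerivAt_id u'))).clm_apply
      (hasFDerivAt_const ((EuclideanSpace.single i 1, 0) : E4 × E4) u')
    unfold D2
    rw [pd_congr this]
    unfold pd
    erw [h.fderiv]
    simp
  have e2 : D1 i (D2 j f) u u' =
      fderiv ℝ (fderiv ℝ Φ) (u, u') (EuclideanSpace.single i 1, 0)
        (0, EuclideanSpace.single j 1) := by
    have : (fun y => D2 j f y u') =ᶠ[𝓝 u]
        fun y => fderiv ℝ Φ (y, u') (0, EuclideanSpace.single j 1) :=
      Filter.eventually_of_mem (hΩ.mem_nhds hu) fun y hy =>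
        D2_eq_fderiv ((hΦ y hy u' hu').differentiableAt (by simp)) j
    have h := (hd.hasFDerivAt.comp (f := fun y : E4 => (y, u')) u
      ((hasFDerivAt_id u).prodMk (hasFDerivAt_const u' u))).clm_apply
      (hasFDerivAt_const ((0, EuclideanSpace.single j 1) : E4 × E4) u)
    unfold D1
    rw [pd_congr this]
    unfold pd
    erw [h.fderiv]
    simp
  rw [e1, e2]
  exact ((hΦ u hu u' hu').isSymmSndFDerivAt (by simp)).eq _ _

/-! ### Functions that vanish on the diagonal with their derivatives -/

/-- `f` is of class `C^n`, and it vanishes on the diagonal together with its partial derivatives in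
the first argument up to order `n`. -/
def Flat (Ω : Set E4) : ℕ → (E4 → E4 → F) → Prop
  | 0, f => Reg Ω 0 f ∧ ∀ u ∈ Ω, f u u = 0
  | n + 1, f => Reg Ω (n + 1 : ℕ) f ∧ (∀ u ∈ Ω, f u u = 0) ∧ ∀ i, Flat Ω n (D1 i f)

theorem Flat.reg {k : ℕ} (hf : Flat Ω k f) : Reg Ω k f := by
  cases k with
  | zero => exact hf.1
  | succ k => exact hf.1

theorem Flat.diag {k : ℕ} (hf : Flat Ω k f) {u : E4} (hu : u ∈ Ω) : f u u = 0 := by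
  cases k with
  | zero => exact hf.2 u hu
  | succ k => exact hf.2.1 u hu

/-- By induction on `k`, integrate the bound on the first derivatives along the segment from `y'` to
`y`; the function vanishes at the end on the diagonal. The bound is uniform in both points because
the induction moves the first one while the second stays a parameter. -/
theorem exists_ball_norm_le_mul (hΩ : IsOpen Ω) {k : ℕ} (hf : Flat Ω k f) {a : E4} (ha : a ∈ Ω)
    {ε : ℝ} (hε : 0 < ε) : ∃ δ > 0, ∀ y ∈ Metric.ball a δ, ∀ y' ∈ Metric.ball a δ,
      ‖f y y'‖ ≤ ε * ‖y - y'‖ ^ k := by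
  induction k generalizing f ε with
  | zero =>
    have hc : ContinuousAt (fun p : E4 × E4 => f p.1 p.2) (a, a) :=
      (hf.reg.contDiffAt hΩ ha ha).continuousAt
    have h0 : ∀ᶠ p in 𝓝 (a, a), ‖f p.1 p.2‖ < ε :=
      hc.norm.eventually_lt_const (by simpa [hf.diag ha] using hε)
    obtain ⟨δ, hδ, h⟩ := Metric.eventually_nhds_iff_ball.1 h0
    refine ⟨δ, hδ, fun y hy y' hy' => ?_⟩
    have := h (y, y') (by rw [← ball_prod_same]; exact ⟨hy, hy'⟩)
    simpa using this.le
  | succ k ih =>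
    -- The quarter compensates the factor 4 of `norm_le_of_pd_le`.
    have hex : ∀ i, ∃ δ > 0, ∀ y ∈ Metric.ball a δ, ∀ y' ∈ Metric.ball a δ,
        ‖D1 i f y y'‖ ≤ (ε / 4) * ‖y - y'‖ ^ k := fun i => ih (hf.2.2 i) (by positivity)
    choose δ hδ h using hex
    obtain ⟨δ', hδ', hΩ'⟩ := Metric.isOpen_iff.1 hΩ a ha
    set η := min δ' (Finset.univ.inf' Finset.univ_nonempty δ)
    have hη : 0 < η := lt_min hδ' ((Finset.lt_inf'_iff _).2 fun i _ => hδ i)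
    have hηi : ∀ i, η ≤ δ i := fun i =>
      (min_le_right _ _).trans (Finset.inf'_le _ (Finset.mem_univ i))
    refine ⟨η, hη, fun y hy y' hy' => ?_⟩
    have hsub : ∀ z ∈ Metric.ball a η, z ∈ Ω := fun z hz =>
      hΩ' (Metric.ball_subset_ball (min_le_left _ _) hz)
    have := norm_le_of_pd_le (f := fun z => f z y') (convex_ball a η) hy'
      (fun z hz => (hf.reg.contDiffAt_left hΩ (hsub z hz) (hsub y' hy')).differentiableAt
        (by simp)) (hf.diag (hsub y' hy'))
      (fun i z hz => h i z (Metric.ball_subset_ball (hηi i) hz) y'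
        (Metric.ball_subset_ball (hηi i) hy')) hy
    convert this using 2
    ring

/-- If the partial derivatives in the first argument of `f` are of order `k` near `a`, and `f`
vanishes on the diagonal, then `f` is of order `k + 1`. -/
theorem exists_ball_norm_le_of_D1 (hΩ : IsOpen Ω) (hf : Reg Ω 1 f) (h0 : ∀ u ∈ Ω, f u u = 0)
    {a : E4} (ha : a ∈ Ω) {k : ℕ}
    (h : ∀ i, ∃ K : ℝ, ∃ δ > 0, ∀ y ∈ Metric.ball a δ, ∀ y' ∈ Metric.ball a δ,
      ‖D1 i f y y'‖ ≤ K * ‖y - y'‖ ^ k) :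
    ∃ K : ℝ, ∃ δ > 0, ∀ y ∈ Metric.ball a δ, ∀ y' ∈ Metric.ball a δ,
      ‖f y y'‖ ≤ K * ‖y - y'‖ ^ (k + 1) := by
  choose K δ hδ h using h
  obtain ⟨δ', hδ', hΩ'⟩ := Metric.isOpen_iff.1 hΩ a ha
  set η := min δ' (Finset.univ.inf' Finset.univ_nonempty δ)
  have hη : 0 < η := lt_min hδ' ((Finset.lt_inf'_iff _).2 fun i _ => hδ i)
  have hηi : ∀ i, η ≤ δ i := fun i =>
    (min_le_right _ _).trans (Finset.inf'_le _ (Finset.mem_univ i))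
  refine ⟨4 * Finset.univ.sup' Finset.univ_nonempty K, η, hη, fun y hy y' hy' => ?_⟩
  have hsub : ∀ z ∈ Metric.ball a η, z ∈ Ω := fun z hz =>
    hΩ' (Metric.ball_subset_ball (min_le_left _ _) hz)
  refine norm_le_of_pd_le (f := fun z => f z y') (convex_ball a η) hy'
    (fun z hz => (hf.contDiffAt_left hΩ (hsub z hz) (hsub y' hy')).differentiableAt
      (by simp)) (h0 y' (hsub y' hy')) (fun i z hz => ?_) hy
  refine (h i z (Metric.ball_subset_ball (hηi i) hz) y'
    (Metric.ball_subset_ball (hηi i) hy')).trans ?_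
  gcongr
  exact Finset.le_sup' _ (Finset.mem_univ i)

theorem exists_ball_norm_le_const (hΩ : IsOpen Ω) (hf : Reg Ω 0 f) {a : E4} (ha : a ∈ Ω) :
    ∃ K : ℝ, ∃ δ > 0, ∀ y ∈ Metric.ball a δ, ∀ y' ∈ Metric.ball a δ,
      ‖f y y'‖ ≤ K * ‖y - y'‖ ^ 0 := by
  have hc : ContinuousAt (fun p : E4 × E4 => f p.1 p.2) (a, a) :=
    (hf.contDiffAt hΩ ha ha).continuousAt
  have h0 : ∀ᶠ p in 𝓝 (a, a), ‖f p.1 p.2‖ < ‖f a a‖ + 1 :=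
    hc.norm.eventually_lt_const (by simp)
  obtain ⟨δ, hδ, h⟩ := Metric.eventually_nhds_iff_ball.1 h0
  refine ⟨‖f a a‖ + 1, δ, hδ, fun y hy y' hy' => ?_⟩
  have := h (y, y') (by rw [← ball_prod_same]; exact ⟨hy, hy'⟩)
  simpa using this.le

/-- One order of differentiability more than the order of flatness improves the bound. -/
theorem exists_ball_norm_le_of_flat (hΩ : IsOpen Ω) {k : ℕ} (hf : Flat Ω k f)
    (hf' : Reg Ω (k + 1 : ℕ) f) {a : E4} (ha : a ∈ Ω) :
    ∃ K : ℝ, ∃ δ > 0, ∀ y ∈ Metric.ball a δ, ∀ y' ∈ Metric.ball a δ,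
      ‖f y y'‖ ≤ K * ‖y - y'‖ ^ (k + 1) := by
  induction k generalizing f with
  | zero =>
    exact exists_ball_norm_le_of_D1 hΩ (hf'.of_le (by simp)) hf.2 ha fun i =>
      exists_ball_norm_le_const hΩ (hf'.D1 hΩ (by simp) i) ha
  | succ k ih =>
    refine exists_ball_norm_le_of_D1 hΩ (hf'.of_le ?_) hf.2.1 ha fun i =>
      ih (hf.2.2 i) (hf'.D1 hΩ ?_ i)
    · exact_mod_cast Nat.le_add_left _ _
    · exact_mod_cast le_rfl

theorem D1_add {u u' : E4} (hΩ : IsOpen Ω) (hf : Reg Ω 1 f) (hg : Reg Ω 1 g) (hu : u ∈ Ω)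
    (hu' : u' ∈ Ω) (i : Fin 4) :
    D1 i (fun u u' => f u u' + g u u') u u' = D1 i f u u' + D1 i g u u' :=
  pd_add ((hf.contDiffAt_left hΩ hu hu').differentiableAt (by simp))
    ((hg.contDiffAt_left hΩ hu hu').differentiableAt (by simp)) i

theorem Reg.congr (hf : Reg Ω n f) (h : ∀ u ∈ Ω, ∀ u' ∈ Ω, g u u' = f u u') : Reg Ω n g :=
  ContDiffOn.congr hf fun p hp => h p.1 hp.1 p.2 hp.2

theorem D1_congr (hΩ : IsOpen Ω) (h : ∀ u ∈ Ω, ∀ u' ∈ Ω, g u u' = f u u') {u u' : E4} (hu : u ∈ Ω)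
    (hu' : u' ∈ Ω) (i : Fin 4) : D1 i g u u' = D1 i f u u' :=
  pd_congr (Filter.eventually_of_mem (hΩ.mem_nhds hu) fun y hy => h y hy u' hu') i

theorem Flat.congr (hΩ : IsOpen Ω) {k : ℕ} (hf : Flat Ω k f)
    (h : ∀ u ∈ Ω, ∀ u' ∈ Ω, g u u' = f u u') : Flat Ω k g := by
  induction k generalizing f g with
  | zero => exact ⟨hf.1.congr h, fun u hu => (h u hu u hu).trans (hf.2 u hu)⟩
  | succ k ih =>
    exact ⟨hf.1.congr h, fun u hu => (h u hu u hu).trans (hf.2.1 u hu), fun i =>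
      ih (hf.2.2 i) fun u hu u' hu' => D1_congr hΩ h hu hu' i⟩

theorem Flat.add (hΩ : IsOpen Ω) {k : ℕ} (hf : Flat Ω k f) (hg : Flat Ω k g) :
    Flat Ω k fun u u' => f u u' + g u u' := by
  induction k generalizing f g with
  | zero => exact ⟨hf.1.add hg.1, fun u hu => by simp [hf.2 u hu, hg.2 u hu]⟩
  | succ k ih =>
    refine ⟨hf.1.add hg.1, fun u hu => by simp [hf.2.1 u hu, hg.2.1 u hu], fun i =>
      (ih (hf.2.2 i) (hg.2.2 i)).congr hΩ fun u hu u' hu' => ?_⟩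
    exact D1_add hΩ (hf.reg.of_le (by simp)) (hg.reg.of_le (by simp)) hu hu' i

theorem Flat.of_succ {k : ℕ} (hf : Flat Ω (k + 1) f) : Flat Ω k f := by
  induction k generalizing f with
  | zero => exact ⟨hf.1.of_le (by simp), hf.2.1⟩
  | succ k ih =>
    exact ⟨hf.1.of_le (by exact_mod_cast Nat.le_succ _), hf.2.1, fun i => ih (hf.2.2 i)⟩

theorem Flat.of_le {k l : ℕ} (hf : Flat Ω k f) (h : l ≤ k) : Flat Ω l f := by
  induction h with
  | refl => exact hf
  | step _ ih => exact ih hf.of_succ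

/-- In the Leibniz rule the derivative that falls on `a` leaves `f` itself, which is flat to one
order more than is needed. This serves for the Christoffel symbols in a covariant derivative. -/
theorem Flat.smul_left (hΩ : IsOpen Ω) {a : E4 → ℝ} (ha : ContDiffOn ℝ ∞ a Ω) {k : ℕ}
    (hf : Flat Ω k f) : Flat Ω k fun u u' => a u • f u u' := by
  induction k generalizing a f with
  | zero =>
    exact ⟨(reg_of_left (ha.of_le (by simp))).smul hf.1, fun u hu => by simp [hf.2 u hu]⟩
  | succ k ih =>
    refine ⟨(reg_of_left (ha.of_le (by exact_mod_cast le_top))).smul hf.1,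
      fun u hu => by simp [hf.2.1 u hu], fun i => ?_⟩
    refine ((ih (ha.pd hΩ (m := ∞) (by simp) i) hf.of_succ).add hΩ
      (ih ha (hf.2.2 i))).congr hΩ fun u hu u' hu' => ?_
    exact pd_smul ((ha.contDiffAt (hΩ.mem_nhds hu)).differentiableAt (by simp))
      ((hf.reg.contDiffAt_left hΩ hu hu').differentiableAt (by simp)) i

theorem Flat.sum (hΩ : IsOpen Ω) {ι : Type*} {s : Finset ι} {f : ι → E4 → E4 → F} {k : ℕ}
    (hf : ∀ j ∈ s, Flat Ω k (f j)) : Flat Ω k fun u u' => ∑ j ∈ s, f j u u' := by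
  classical
  induction s using Finset.induction_on with
  | empty =>
    have : ∀ k, Flat Ω k fun _ _ : E4 => (0 : F) := by
      intro k
      induction k with
      | zero => exact ⟨contDiffOn_const, fun _ _ => rfl⟩
      | succ k ih =>
        exact ⟨contDiffOn_const, fun _ _ => rfl, fun i =>
          ih.congr hΩ fun u _ u' _ => pd_const i 0 u⟩
    simpa using this k
  | insert j s hj ih =>
    simp only [Finset.sum_insert hj]
    exact (hf j (Finset.mem_insert_self _ _)).add hΩ
      (ih fun l hl => hf l (Finset.mem_insert_of_mem hl))

end TwoPoints

/-! ### Covariant derivatives and flatness -/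

section CovariantDerivatives

variable {F : Type*} [NormedAddCommGroup F] [NormedSpace ℝ F]
variable {Ω : Set E4} {G : E4 → Matrix (Fin 4) (Fin 4) ℝ}

theorem contDiffOn_det (hG : ∀ i j, ContDiffOn ℝ ∞ (fun u => G u i j) Ω) :
    ContDiffOn ℝ ∞ (fun u => (G u).det) Ω := by
  simp only [Matrix.det_apply']
  exact ContDiffOn.sum fun τ _ => contDiffOn_const.mul (contDiffOn_prod fun i _ => hG _ _)

theorem contDiffOn_inv_apply (hG : ∀ i j, ContDiffOn ℝ ∞ (fun u => G u i j) Ω)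
    (hdet : ∀ u ∈ Ω, (G u).det ≠ 0) (i j : Fin 4) :
    ContDiffOn ℝ ∞ (fun u => (G u)⁻¹ i j) Ω := by
  simp only [Matrix.inv_def, Matrix.smul_apply, Ring.inverse_eq_inv', smul_eq_mul]
  refine ((contDiffOn_det hG).inv hdet).mul ?_
  simp only [Matrix.adjugate_apply]
  refine contDiffOn_det fun k l => ?_
  simp only [Matrix.updateRow_apply]
  split_ifs
  · exact contDiffOn_const
  · exact hG _ _

theorem contDiffOn_christoffel (hΩ : IsOpen Ω) (hG : ∀ i j, ContDiffOn ℝ ∞ (fun u => G u i j) Ω)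
    (hdet : ∀ u ∈ Ω, (G u).det ≠ 0) (c a b : Fin 4) :
    ContDiffOn ℝ ∞ (christoffel G c a b) Ω := by
  unfold christoffel
  refine contDiffOn_const.mul (ContDiffOn.sum fun d _ =>
    (contDiffOn_inv_apply hG hdet c d).mul ?_)
  exact (((hG _ _).pd hΩ (by simp) _).add ((hG _ _).pd hΩ (by simp) _)).sub
    ((hG _ _).pd hΩ (by simp) _)

theorem iterCov_one (f : E4 → F) (I : Fin 1 → Fin 4) (u : E4) :
    iterCov G f 1 I u = pd (I 0) f u := by
  simp only [iterCov, Finset.univ_eq_empty, Finset.sum_empty, sub_zero]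

theorem iterCov_two (f : E4 → F) (a b : Fin 4) (u : E4) :
    iterCov G f 2 ![a, b] u =
      pd a (pd b f) u - ∑ c, christoffel G c a b u • pd c f u := by
  have h : iterCov G f 1 (Fin.tail ![a, b]) = pd b f := by
    ext y; rw [iterCov_one]; rfl
  rw [iterCov, h]
  simp [iterCov_one]

theorem contDiffOn_iterCov (hΩ : IsOpen Ω) (hΓ : ∀ c a b, ContDiffOn ℝ ∞ (christoffel G c a b) Ω)
    {f : E4 → F} {m n : ℕ} (hf : ContDiffOn ℝ n f Ω) (k : ℕ) (hmn : m + k ≤ n)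
    (I : Fin k → Fin 4) : ContDiffOn ℝ m (iterCov G f k I) Ω := by
  induction k generalizing m with
  | zero => exact hf.of_le (by exact_mod_cast hmn)
  | succ k ih =>
    refine ((ih (m := m + 1) (by omega) _).pd hΩ (by norm_cast) _).sub
      (ContDiffOn.sum fun p _ => ContDiffOn.sum fun c _ => ?_)
    exact ((hΓ _ _ _).of_le (by exact_mod_cast le_top)).smul (ih (by omega) _)

theorem iterCov_sub (hΩ : IsOpen Ω) (hΓ : ∀ c a b, ContDiffOn ℝ ∞ (christoffel G c a b) Ω)
    {f g : E4 → F} (k : ℕ) (hf : ContDiffOn ℝ k f Ω) (hg : ContDiffOn ℝ k g Ω) (I : Fin k → Fin 4)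
    {u : E4} (hu : u ∈ Ω) :
    iterCov G (fun y => f y - g y) k I u = iterCov G f k I u - iterCov G g k I u := by
  induction k generalizing u with
  | zero => rfl
  | succ k ih =>
    have hf' : ContDiffOn ℝ k f Ω := hf.of_le (by exact_mod_cast Nat.le_succ k)
    have hg' : ContDiffOn ℝ k g Ω := hg.of_le (by exact_mod_cast Nat.le_succ k)
    have h1 : iterCov G (fun y => f y - g y) k (Fin.tail I) =ᶠ[𝓝 u]
        fun y => iterCov G f k (Fin.tail I) y - iterCov G g k (Fin.tail I) y :=
      Filter.eventually_of_mem (hΩ.mem_nhds hu) fun y hy => ih hf' hg' _ hy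
    have hd : ∀ {h : E4 → F}, ContDiffOn ℝ (k + 1 : ℕ) h Ω →
        DifferentiableAt ℝ (iterCov G h k (Fin.tail I)) u := fun hh =>
      ((contDiffOn_iterCov hΩ hΓ (m := 1) hh k (by omega) _).contDiffAt
        (hΩ.mem_nhds hu)).differentiableAt (by simp)
    simp only [iterCov]
    rw [pd_congr h1, pd_sub (hd hf) (hd hg)]
    simp only [ih hf' hg' _ hu, smul_sub, Finset.sum_sub_distrib]
    abel

theorem Reg.iterCov (hΩ : IsOpen Ω) (hΓ : ∀ c a b, ContDiffOn ℝ ∞ (christoffel G c a b) Ω)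
    {f : E4 → E4 → F} {m n : ℕ} (hf : Reg Ω n f) (k : ℕ) (hmn : m + k ≤ n)
    (I : Fin k → Fin 4) : Reg Ω m fun u u' => iterCov G (fun y => f y u') k I u := by
  induction k generalizing m with
  | zero => exact hf.of_le (by exact_mod_cast hmn)
  | succ k ih =>
    refine Reg.sub ((ih (m := m + 1) (by omega) (Fin.tail I)).D1 hΩ (by norm_cast) (I 0))
      (Reg.sum (f := fun (p : Fin k) u u' => ∑ c, christoffel G c (I 0) (I p.succ) u •
        Hadamard.iterCov G (fun y => f y u') k (Function.update (Fin.tail I) p c) u)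
        fun p _ => Reg.sum fun c _ => ?_)
    exact (reg_of_left ((hΓ _ _ _).of_le (by exact_mod_cast le_top))).smul (ih (by omega) _)

/-- If all iterated covariant derivatives vanish on the diagonal, so do the partial derivatives. -/
theorem flat_of_iterCov (hΩ : IsOpen Ω) (hΓ : ∀ c a b, ContDiffOn ℝ ∞ (christoffel G c a b) Ω)
    {e : E4 → E4 → F} {n : ℕ} (he : Reg Ω n e)
    (h0 : ∀ k ≤ n, ∀ I : Fin k → Fin 4, ∀ u ∈ Ω, iterCov G (fun y => e y u) k I u = 0) :
    Flat Ω n e := by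
  -- Induction on the order `j` of flatness, for covariant derivatives of every order `k` at once:
  -- `∂_i ∇^k e` is `∇_i ∇^k e` plus Christoffel symbols times components of `∇^k e`, and all of
  -- these are flat of order `j` already.
  have key : ∀ j k, k + j ≤ n → ∀ I : Fin k → Fin 4,
      Flat Ω j fun u u' => iterCov G (fun y => e y u') k I u := by
    intro j
    induction j with
    | zero =>
      intro k hk I
      exact ⟨by simpa using he.iterCov hΩ hΓ (m := 0) k (by omega) I,
        fun u hu => h0 k (by omega) I u hu⟩
    | succ j ih =>
      intro k hk I
      refine ⟨he.iterCov hΩ hΓ k (by omega) I, fun u hu => h0 k (by omega) I u hu, fun i => ?_⟩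
      refine ((ih (k + 1) (by omega) (Fin.cons i I)).add hΩ
        (Flat.sum hΩ (s := Finset.univ) (f := fun (p : Fin k) u u' =>
          ∑ c, christoffel G c i (I p) u • Hadamard.iterCov G (fun y => e y u') k
            (Function.update I p c) u) fun p _ => Flat.sum hΩ fun c _ =>
          (ih k (by omega) (Function.update I p c)).smul_left hΩ (hΓ c i (I p)))).congr hΩ
        fun u hu u' hu' => ?_
      simp [Hadamard.iterCov, D1]
  simpa [Hadamard.iterCov] using key n 0 (by omega) Fin.elim0

end CovariantDerivatives

/-! ### Geodesics in a convex normal neighbourhood -/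

section Geodesics

/-- The coordinate form of a convex normal neighbourhood with a nondegenerate metric. -/
structure IsNormal (G : E4 → Matrix (Fin 4) (Fin 4) ℝ) (Ω : Set E4) : Prop where
  isOpen : IsOpen Ω
  smooth : ∀ i j, ContDiffOn ℝ ∞ (fun u => G u i j) Ω
  symm : ∀ u ∈ Ω, ∀ i j, G u i j = G u j i
  det_ne_zero : ∀ u ∈ Ω, (G u).det ≠ 0
  exists_geodesic : ∀ u ∈ Ω, ∀ u' ∈ Ω, ∃ c c', IsGeodesic G Ω c c' ∧ c 0 = u ∧ c 1 = u'
  unique_geodesic : ∀ c₁ c₁' c₂ c₂' : ℝ → E4, IsGeodesic G Ω c₁ c₁' → IsGeodesic G Ω c₂ c₂' →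
    c₁ 0 = c₂ 0 → c₁ 1 = c₂ 1 → EqOn c₁ c₂ (Icc 0 1)
  smooth_velocity : ContDiffOn ℝ ∞ (fun p : E4 × E4 => geodVel G Ω p.1 p.2) (Ω ×ˢ Ω)

variable {G : E4 → Matrix (Fin 4) (Fin 4) ℝ} {Ω : Set E4}

/-- The acceleration `-Γ^k_{ij} w^i w^j` of a geodesic with velocity `w`. -/
def geodAcc (G : E4 → Matrix (Fin 4) (Fin 4) ℝ) (u w : E4) : E4 :=
  WithLp.toLp 2 fun k => -∑ i, ∑ j, christoffel G k i j u * w i * w j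

theorem geodAcc_smul (u w : E4) (b : ℝ) : geodAcc G u (b • w) = b ^ 2 • geodAcc G u w := by
  ext k
  simp only [geodAcc, PiLp.smul_apply, smul_eq_mul, mul_neg, Finset.mul_sum]
  congr 1
  exact Finset.sum_congr rfl fun i _ => Finset.sum_congr rfl fun j _ => by ring

/-- The acceleration is homogeneous of degree two in the velocity, so affine reparametrizations
preserve the geodesic equation. The case `a = 1`, `b = -1` reverses a geodesic; `a = 0`, `b = t`
stretches the piece over `[0, t]` to `[0, 1]`. -/
theorem isGeodesic_reparam {s : Set ℝ} {c c' : ℝ → E4} (hmem : ∀ t ∈ s, c t ∈ Ω)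
    (hc : ∀ t ∈ s, HasDerivWithinAt c (c' t) s t)
    (hc' : ∀ t ∈ s, HasDerivWithinAt c' (geodAcc G (c t) (c' t)) s t) (a b : ℝ)
    (hs : MapsTo (fun t => a + b * t) (Icc 0 1) s) :
    IsGeodesic G Ω (fun t => c (a + b * t)) fun t => b • c' (a + b * t) := by
  intro t ht
  have hd : HasDerivWithinAt (fun t => a + b * t) b (Icc 0 1) t := by
    simpa using ((hasDerivWithinAt_id t (Icc 0 1)).const_mul b).const_add a
  refine ⟨hmem _ (hs ht), (hc _ (hs ht)).scomp t hd hs, ?_⟩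
  have h2 := ((hc' _ (hs ht)).scomp t hd hs).const_smul b
  rw [smul_smul, ← pow_two, ← geodAcc_smul] at h2
  exact h2

theorem IsGeodesic.reverse {c c' : ℝ → E4} (h : IsGeodesic G Ω c c') :
    IsGeodesic G Ω (fun t => c (1 - t)) fun t => -c' (1 - t) := by
  have := isGeodesic_reparam (G := G) (Ω := Ω) (fun t ht => (h t ht).1) (fun t ht => (h t ht).2.1)
    (fun t ht => (h t ht).2.2) 1 (-1) (fun t ht => ⟨by linarith [ht.2], by linarith [ht.1]⟩)
  simpa [sub_eq_add_neg] using this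

/-- `geodVel` chooses some geodesic; uniqueness makes it coincide with `c` on `[0, 1]`, and the
one-sided derivative at `0` then determines the initial velocity. -/
theorem IsNormal.geodVel_eq (hN : IsNormal G Ω) {c c' : ℝ → E4} (h : IsGeodesic G Ω c c') :
    geodVel G Ω (c 0) (c 1) = c' 0 := by
  have hex : ∃ p : (ℝ → E4) × (ℝ → E4), IsGeodesic G Ω p.1 p.2 ∧ p.1 0 = c 0 ∧ p.1 1 = c 1 :=
    ⟨(c, c'), h, rfl, rfl⟩
  have h0 : (0 : ℝ) ∈ Icc (0 : ℝ) 1 := ⟨le_rfl, zero_le_one⟩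
  rw [geodVel, dif_pos hex]
  obtain ⟨h1, h2, h3⟩ := hex.choose_spec
  have heq := hN.unique_geodesic _ _ _ _ h1 h h2 h3
  have hd := ((h 0 h0).2.1).congr heq (heq h0)
  exact (uniqueDiffOn_Icc zero_lt_one 0 h0).eq_deriv _ (h1 0 h0).2.1 hd

theorem IsNormal.contDiffOn_christoffel (hN : IsNormal G Ω) (c a b : Fin 4) :
    ContDiffOn ℝ ∞ (christoffel G c a b) Ω :=
  Hadamard.contDiffOn_christoffel hN.isOpen hN.smooth hN.det_ne_zero c a b

theorem IsNormal.pd_symm (hN : IsNormal G Ω) {u : E4} (hu : u ∈ Ω) (k i j : Fin 4) :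
    pd k (fun y => G y i j) u = pd k (fun y => G y j i) u :=
  pd_congr (Filter.eventually_of_mem (hN.isOpen.mem_nhds hu) fun y hy => hN.symm y hy i j) k

theorem IsNormal.christoffel_symm (hN : IsNormal G Ω) {u : E4} (hu : u ∈ Ω) (c a b : Fin 4) :
    christoffel G c a b u = christoffel G c b a u := by
  unfold christoffel
  congr 1
  refine Finset.sum_congr rfl fun d _ => ?_
  rw [hN.pd_symm hu d a b]
  ring

theorem IsNormal.sum_mul_christoffel (hN : IsNormal G Ω) {u : E4} (hu : u ∈ Ω) (j k l : Fin 4) :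
    ∑ i, G u j i * christoffel G i k l u = 1 / 2 *
      (pd k (fun y => G y j l) u + pd l (fun y => G y j k) u - pd j (fun y => G y k l) u) := by
  have hinv : ∀ d, ∑ i, G u j i * (G u)⁻¹ i d = if j = d then 1 else 0 := by
    intro d
    have := congrFun₂ (Matrix.mul_nonsing_inv (G u) (hN.det_ne_zero u hu).isUnit) j d
    rwa [Matrix.mul_apply, Matrix.one_apply] at this
  unfold christoffel
  calc _ = 1 / 2 * ∑ d, (∑ i, G u j i * (G u)⁻¹ i d) *
        (pd k (fun y => G y d l) u + pd l (fun y => G y d k) u - pd d (fun y => G y k l) u) := by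
        simp only [Finset.mul_sum, Finset.sum_mul]
        rw [Finset.sum_comm]
        refine Finset.sum_congr rfl fun d _ => Finset.sum_congr rfl fun i _ => ?_
        ring
    _ = _ := by simp [hinv]

/-- The algebra behind conservation of energy: contracted with three copies of `w`, all permutations
of the indices of `P` give the same sum, and the Christoffel combination of three terms leaves one.
-/
theorem sum_mul_lower (P : Fin 4 → Fin 4 → Fin 4 → ℝ) (w : Fin 4 → ℝ) :
    ∑ j, w j * ∑ k, ∑ l, 1 / 2 * (P k j l + P l j k - P j k l) * w k * w l =
      1 / 2 * ∑ i, ∑ j, ∑ k, P k i j * w k * w i * w j := by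
  have e1 : ∑ j, ∑ k, ∑ l, P k j l * w j * w k * w l =
      ∑ i, ∑ j, ∑ k, P k i j * w k * w i * w j := by
    refine Finset.sum_congr rfl fun i _ => ?_
    rw [Finset.sum_comm]
    exact Finset.sum_congr rfl fun j _ => Finset.sum_congr rfl fun k _ => by ring
  have e2 : ∑ j, ∑ k, ∑ l, P l j k * w j * w k * w l =
      ∑ i, ∑ j, ∑ k, P k i j * w k * w i * w j :=
    Finset.sum_congr rfl fun i _ => Finset.sum_congr rfl fun j _ =>
      Finset.sum_congr rfl fun k _ => by ring
  have e3 : ∑ j, ∑ k, ∑ l, P j k l * w j * w k * w l =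
      ∑ i, ∑ j, ∑ k, P k i j * w k * w i * w j := by
    rw [Finset.sum_comm]
    refine Finset.sum_congr rfl fun i _ => ?_
    rw [Finset.sum_comm]
  have : ∑ j, w j * ∑ k, ∑ l, 1 / 2 * (P k j l + P l j k - P j k l) * w k * w l =
      1 / 2 * (∑ j, ∑ k, ∑ l, P k j l * w j * w k * w l + ∑ j, ∑ k, ∑ l, P l j k * w j * w k * w l
        - ∑ j, ∑ k, ∑ l, P j k l * w j * w k * w l) := by
    simp only [Finset.mul_sum, ← Finset.sum_add_distrib, ← Finset.sum_sub_distrib]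
    refine Finset.sum_congr rfl fun i _ => Finset.sum_congr rfl fun j _ =>
      Finset.sum_congr rfl fun k _ => by ring
  rw [this, e1, e2, e3]
  ring

/-- `g(c', c')` is constant along a geodesic. -/
theorem IsNormal.energy_const (hN : IsNormal G Ω) {c c' : ℝ → E4} (h : IsGeodesic G Ω c c') {t : ℝ}
    (ht : t ∈ Icc (0 : ℝ) 1) :
    ∑ i, ∑ j, G (c t) i j * c' t i * c' t j = ∑ i, ∑ j, G (c 0) i j * c' 0 i * c' 0 j := by
  have hder : ∀ t ∈ Icc (0 : ℝ) 1, HasDerivWithinAt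
      (fun t => ∑ i, ∑ j, G (c t) i j * c' t i * c' t j) 0 (Icc 0 1) t := by
    intro t ht
    obtain ⟨hm, h1, h2⟩ := h t ht
    have hG : ∀ i j, HasDerivWithinAt (fun t => G (c t) i j)
        (∑ k, c' t k * pd k (fun y => G y i j) (c t)) (Icc 0 1) t := by
      intro i j
      have hf := (((hN.smooth i j).contDiffAt (hN.isOpen.mem_nhds hm)).differentiableAt
        (by simp)).hasFDerivAt.comp_hasDerivWithinAt t h1
      rw [fderiv_eq_sum_pd] at hf
      exact hf
    have hv : ∀ i, HasDerivWithinAt (fun t => c' t i) (geodAcc G (c t) (c' t) i) (Icc 0 1) t :=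
      fun i => (EuclideanSpace.proj i : E4 →L[ℝ] ℝ).hasFDerivAt.comp_hasDerivWithinAt t h2
    have hs := HasDerivWithinAt.fun_sum fun i (_ : i ∈ Finset.univ) =>
      HasDerivWithinAt.fun_sum fun j (_ : j ∈ Finset.univ) => ((hG i j).mul (hv i)).mul (hv j)
    refine hs.congr_deriv ?_
    set w := c' t
    set u := c t
    set P : Fin 4 → Fin 4 → Fin 4 → ℝ := fun k i j => pd k (fun y => G y i j) u
    have hA : ∀ j, ∑ i, G u j i * geodAcc G u w i =
        -∑ k, ∑ l, 1 / 2 * (P k j l + P l j k - P j k l) * w k * w l := by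
      intro j
      simp only [P, ← hN.sum_mul_christoffel hm, geodAcc, mul_neg, Finset.sum_neg_distrib,
        Finset.mul_sum, Finset.sum_mul]
      congr 1
      rw [Finset.sum_comm]
      refine Finset.sum_congr rfl fun k _ => ?_
      rw [Finset.sum_comm]
      exact Finset.sum_congr rfl fun l _ => Finset.sum_congr rfl fun i _ => by ring
    -- Each of the two acceleration terms in the derivative of `g(c', c')` equals minus half of the
    -- term where the metric is differentiated, so the total is zero.
    have h3 : ∑ j, w j * ∑ i, G u j i * geodAcc G u w i =
        -(1 / 2 * ∑ i, ∑ j, ∑ k, P k i j * w k * w i * w j) := by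
      simp only [hA, mul_neg, Finset.sum_neg_distrib, sum_mul_lower]
    have h4 : ∑ i, ∑ j, G u i j * w i * geodAcc G u w j =
        ∑ j, w j * ∑ i, G u j i * geodAcc G u w i := by
      simp only [Finset.mul_sum]
      exact Finset.sum_congr rfl fun i _ => Finset.sum_congr rfl fun j _ => by ring
    have h5 : ∑ i, ∑ j, G u i j * geodAcc G u w i * w j =
        ∑ j, w j * ∑ i, G u j i * geodAcc G u w i := by
      simp only [Finset.mul_sum]
      rw [Finset.sum_comm]
      exact Finset.sum_congr rfl fun i _ => Finset.sum_congr rfl fun j _ => by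
        rw [hN.symm u hm j i]; ring
    calc _ = ∑ i, ∑ j, ∑ k, P k i j * w k * w i * w j
          + ∑ i, ∑ j, G u i j * geodAcc G u w i * w j
          + ∑ i, ∑ j, G u i j * w i * geodAcc G u w j := by
          simp only [← Finset.sum_add_distrib]
          refine Finset.sum_congr rfl fun i _ => Finset.sum_congr rfl fun j _ => ?_
          simp only [add_mul, Finset.sum_mul, P]
          congr 2
          refine Finset.sum_congr rfl fun k _ => by ring
      _ = 0 := by rw [h4, h5, h3]; ring
  exact constant_of_derivWithin_zero (fun t ht => (hder t ht).differentiableWithinAt)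
    (fun t ht => (hder t (Ico_subset_Icc_self ht)).derivWithin
      (uniqueDiffOn_Icc zero_lt_one t (Ico_subset_Icc_self ht))) t ht

theorem IsNormal.halfSqDist_eq (hN : IsNormal G Ω) {c c' : ℝ → E4} (h : IsGeodesic G Ω c c') :
    halfSqDist G Ω (c 0) (c 1) = 1 / 2 * ∑ i, ∑ j, G (c 0) i j * c' 0 i * c' 0 j := by
  rw [halfSqDist, hN.geodVel_eq h]

/-- The reversed geodesic starts with minus the final velocity, and `g(c', c')` has the same value
at both ends. -/
theorem IsNormal.halfSqDist_symm (hN : IsNormal G Ω) {u u' : E4} (hu : u ∈ Ω) (hu' : u' ∈ Ω) :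
    halfSqDist G Ω u u' = halfSqDist G Ω u' u := by
  obtain ⟨c, c', h, rfl, rfl⟩ := hN.exists_geodesic u hu u' hu'
  have h2 := hN.halfSqDist_eq h.reverse
  simp only [sub_zero, sub_self] at h2
  rw [hN.halfSqDist_eq h, h2, ← hN.energy_const h ⟨zero_le_one, le_rfl⟩]
  simp

theorem IsNormal.contDiffAt_geodAcc (hN : IsNormal G Ω) {u : E4} (hu : u ∈ Ω) (w : E4) :
    ContDiffAt ℝ ∞ (fun p : E4 × E4 => geodAcc G p.1 p.2) (u, w) := by
  refine contDiffAt_euclidean.2 fun k => ?_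
  refine ContDiffAt.neg (ContDiffAt.sum fun i _ => ContDiffAt.sum fun j _ => ?_)
  have h2 : ∀ i, ContDiffAt ℝ ∞ (fun p : E4 × E4 => p.2 i) (u, w) := fun i =>
    (EuclideanSpace.proj i : E4 →L[ℝ] ℝ).contDiff.contDiffAt.comp _ contDiffAt_snd
  exact ((((hN.contDiffOn_christoffel k i j).contDiffAt (hN.isOpen.mem_nhds hu)).comp (u, w)
    contDiffAt_fst).mul (h2 i)).mul (h2 j)

/-- There is a geodesic with any given initial velocity `w`, for a short time; and the exponential
map takes `t w` to its value at `t`. -/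
theorem IsNormal.exists_local_geodesic (hN : IsNormal G Ω) {u : E4} (hu : u ∈ Ω) (w : E4) :
    ∃ ε > 0, ∃ c c' : ℝ → E4, c 0 = u ∧ c' 0 = w ∧ ∀ t ∈ Ico 0 ε, c t ∈ Ω ∧
      HasDerivAt c (c' t) t ∧ HasDerivAt c' (geodAcc G (c t) (c' t)) t ∧
      geodVel G Ω u (c t) = t • w := by
  -- The geodesic equation as a first-order system for position and velocity, to which the
  -- Picard–Lindelöf theorem applies.
  have hX : ContDiffAt ℝ 1 (fun p : E4 × E4 => (p.2, geodAcc G p.1 p.2)) (u, w) :=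
    contDiffAt_snd.prodMk ((hN.contDiffAt_geodAcc hu w).of_le (by simp))
  obtain ⟨α, hα0, ε, hε, hα⟩ :=
    hX.exists_forall_mem_closedBall_exists_eq_forall_mem_Ioo_hasDerivAt₀ 0
  simp only [zero_sub, zero_add] at hα
  have hmem : ∀ᶠ t in 𝓝 (0 : ℝ), (α t).1 ∈ Ω := by
    have hc : ContinuousAt (fun t => (α t).1) 0 := (hα 0 ⟨by linarith, hε⟩).continuousAt.fst
    exact hc.eventually_mem (hN.isOpen.mem_nhds (by simpa [hα0] using hu))
  obtain ⟨δ, hδ, hball⟩ := Metric.eventually_nhds_iff.1 hmem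
  have hd1 : ∀ t ∈ Ioo (-ε) ε, HasDerivAt (fun t => (α t).1) (α t).2 t := fun t ht =>
    (hα t ht).fst
  have hd2 : ∀ t ∈ Ioo (-ε) ε,
      HasDerivAt (fun t => (α t).2) (geodAcc G (α t).1 (α t).2) t := fun t ht =>
    (hα t ht).snd
  refine ⟨min ε δ, lt_min hε hδ, fun t => (α t).1, fun t => (α t).2, by simp [hα0],
    by simp [hα0], fun t ht => ?_⟩
  have htε : ∀ s, 0 ≤ s → s ≤ t → s ∈ Ioo (-ε) ε := fun s h1 h2 =>
    ⟨by linarith, h2.trans_lt (ht.2.trans_le (min_le_left _ _))⟩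
  have htδ : ∀ s, 0 ≤ s → s ≤ t → (α s).1 ∈ Ω := fun s h1 h2 => hball (by
    rw [Real.dist_eq, sub_zero, abs_of_nonneg h1]
    exact h2.trans_lt (ht.2.trans_le (min_le_right _ _)))
  refine ⟨htδ t ht.1 le_rfl, hd1 t (htε t ht.1 le_rfl), hd2 t (htε t ht.1 le_rfl), ?_⟩
  -- Stretched to `[0, 1]`, the piece over `[0, t]` has initial velocity `t w`, which is what
  -- `geodVel` returns.
  have hgeo := isGeodesic_reparam (G := G) (Ω := Ω) (s := Icc 0 t)
    (fun s hs => htδ s hs.1 hs.2)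
    (fun s hs => (hd1 s (htε s hs.1 hs.2)).hasDerivWithinAt)
    (fun s hs => (hd2 s (htε s hs.1 hs.2)).hasDerivWithinAt) 0 t
    (fun s hs => ⟨by simpa using mul_nonneg ht.1 hs.1, by
      simpa using mul_le_of_le_one_right ht.1 hs.2⟩)
  have := hN.geodVel_eq hgeo
  simpa [hα0] using this

/-- The components of the initial velocity of the geodesic from `u` to `u'`. -/
def vel (G : E4 → Matrix (Fin 4) (Fin 4) ℝ) (Ω : Set E4) (a : Fin 4) (u u' : E4) : ℝ :=
  geodVel G Ω u u' a

theorem IsNormal.reg_vel (hN : IsNormal G Ω) (a : Fin 4) : Reg Ω ∞ (vel G Ω a) :=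
  (EuclideanSpace.proj a : E4 →L[ℝ] ℝ).contDiff.comp_contDiffOn hN.smooth_velocity

theorem IsNormal.vel_diag (hN : IsNormal G Ω) {u : E4} (hu : u ∈ Ω) (a : Fin 4) :
    vel G Ω a u u = 0 := by
  obtain ⟨ε, hε, c, c', rfl, -, h⟩ := hN.exists_local_geodesic hu 0
  have := (h 0 ⟨le_rfl, hε⟩).2.2.2
  simp [vel, this]

/-- Differentiate `vel^a(u, c(t)) = t w^a` once and twice at `t = 0`, where `c` is the geodesic
leaving `u` with velocity `w`. In the second identity the geodesic equation has replaced `c''` by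
`-Γ w w`. -/
theorem IsNormal.D2_vel_jet (hN : IsNormal G Ω) {u : E4} (hu : u ∈ Ω) (a : Fin 4) (w : E4) :
    ∑ k, w k * D2 k (vel G Ω a) u u = w a ∧
      ∑ k, ∑ l, D2 l (D2 k (vel G Ω a)) u u * w l * w k =
        ∑ k, ∑ i, ∑ j,
          D2 k (vel G Ω a) u u * christoffel G k i j u * w i * w j := by
  obtain ⟨ε, hε, c, c', h0, h0', h⟩ := hN.exists_local_geodesic hu w
  have hreg := hN.reg_vel a
  have hv : ∀ t ∈ Ico 0 ε, HasDerivAt (fun t => vel G Ω a u (c t))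
      (∑ k, c' t k * D2 k (vel G Ω a) u (c t)) t := by
    intro t ht
    have := ((hreg.contDiffAt_right hN.isOpen hu (h t ht).1).differentiableAt
      (by simp)).hasFDerivAt.comp_hasDerivAt t (h t ht).2.1
    rw [fderiv_eq_sum_pd] at this
    exact this
  have hconst : ∀ t ∈ Ico 0 ε, ∑ k, c' t k * D2 k (vel G Ω a) u (c t) = w a := by
    intro t ht
    -- The identity is known for `t ≥ 0` only, so derivatives are compared from the right.
    have h1 : HasDerivWithinAt (fun t => vel G Ω a u (c t)) (w a) (Ici t) t := by
      have h2 : HasDerivWithinAt (fun t : ℝ => t * w a) (w a) (Ici t) t := by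
        simpa using (hasDerivWithinAt_id t (Ici t)).mul_const (w a)
      refine h2.congr_of_eventuallyEq ?_ (by simp [vel, (h t ht).2.2.2])
      filter_upwards [Ico_mem_nhdsGE ht.2] with s hs
      simp [vel, (h s ⟨ht.1.trans hs.1, hs.2⟩).2.2.2]
    exact (uniqueDiffWithinAt_Ici t).eq_deriv _ (hv t ht).hasDerivWithinAt h1
  refine ⟨by simpa [h0, h0'] using hconst 0 ⟨le_rfl, hε⟩, ?_⟩
  have hD : ∀ k, HasDerivAt (fun t => D2 k (vel G Ω a) u (c t))
      (∑ l, c' 0 l * D2 l (D2 k (vel G Ω a)) u (c 0)) 0 := by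
    intro k
    have := (((hreg.D2 hN.isOpen (m := ∞) (by simp) k).contDiffAt_right hN.isOpen hu
      (h 0 ⟨le_rfl, hε⟩).1).differentiableAt
      (by simp)).hasFDerivAt.comp_hasDerivAt 0 (h 0 ⟨le_rfl, hε⟩).2.1
    rw [fderiv_eq_sum_pd] at this
    exact this
  have hw : ∀ k, HasDerivAt (fun t => c' t k) (geodAcc G (c 0) (c' 0) k) 0 := fun k =>
    (EuclideanSpace.proj k : E4 →L[ℝ] ℝ).hasFDerivAt.comp_hasDerivAt 0 (h 0 ⟨le_rfl, hε⟩).2.2.1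
  have hsum := HasDerivAt.fun_sum fun k (_ : k ∈ Finset.univ) => (hw k).mul (hD k)
  have hz : HasDerivWithinAt (fun t => ∑ k, c' t k * D2 k (vel G Ω a) u (c t)) 0 (Ici 0) 0 := by
    refine (hasDerivWithinAt_const (0 : ℝ) (Ici 0) (w a)).congr_of_eventuallyEq ?_
      (hconst 0 ⟨le_rfl, hε⟩)
    filter_upwards [Ico_mem_nhdsGE hε] with s hs using hconst s hs
  have := (uniqueDiffWithinAt_Ici (0 : ℝ)).eq_deriv _ hsum.hasDerivWithinAt hz
  simp only [h0, h0', geodAcc] at this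
  rw [Finset.sum_add_distrib] at this

  have e1 : ∑ k, w k * ∑ l, w l * D2 l (D2 k (vel G Ω a)) u u =
      ∑ k, ∑ l, D2 l (D2 k (vel G Ω a)) u u * w l * w k := by
    simp only [Finset.mul_sum]
    exact Finset.sum_congr rfl fun k _ => Finset.sum_congr rfl fun l _ => by ring
  have e2 : ∑ k, (-∑ i, ∑ j, christoffel G k i j u * w i * w j) * D2 k (vel G Ω a) u u =
      -∑ k, ∑ i, ∑ j, D2 k (vel G Ω a) u u * christoffel G k i j u * w i * w j := by
    simp only [neg_mul, Finset.sum_neg_distrib, Finset.sum_mul]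
    congr 1
    exact Finset.sum_congr rfl fun k _ => Finset.sum_congr rfl fun i _ =>
      Finset.sum_congr rfl fun l _ => by ring
  rw [e1, e2] at this
  linarith

/-- Polarization, evaluated on sums of two basis vectors. -/
theorem eq_of_quadratic_eq {A B : Fin 4 → Fin 4 → ℝ} (hA : ∀ i j, A i j = A j i)
    (hB : ∀ i j, B i j = B j i)
    (h : ∀ w : E4, ∑ i, ∑ j, A i j * w i * w j = ∑ i, ∑ j, B i j * w i * w j) (i j : Fin 4) :
    A i j = B i j := by
  have key : ∀ (C : Fin 4 → Fin 4 → ℝ) (x y : E4), (∀ i j, C i j = C j i) →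
      ∑ i, ∑ j, C i j * (x + y) i * (x + y) j = ∑ i, ∑ j, C i j * x i * x j
        + ∑ i, ∑ j, C i j * y i * y j + 2 * ∑ i, ∑ j, C i j * x i * y j := by
    intro C x y hC
    have : ∑ i, ∑ j, C i j * y i * x j = ∑ i, ∑ j, C i j * x i * y j := by
      rw [Finset.sum_comm]
      exact Finset.sum_congr rfl fun i _ => Finset.sum_congr rfl fun j _ => by rw [hC j i]; ring
    rw [two_mul]
    nth_rewrite 1 [← this]
    simp only [← Finset.sum_add_distrib, PiLp.add_apply]
    exact Finset.sum_congr rfl fun i _ => Finset.sum_congr rfl fun j _ => by ring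
  have h1 := h (EuclideanSpace.single i 1 + EuclideanSpace.single j 1)
  rw [key A _ _ hA, key B _ _ hB, h, h] at h1
  simpa [Pi.single_apply] using h1

theorem IsNormal.D2_vel (hN : IsNormal G Ω) {u : E4} (hu : u ∈ Ω) (a k : Fin 4) :
    D2 k (vel G Ω a) u u = if a = k then 1 else 0 := by
  have := (hN.D2_vel_jet hu a (EuclideanSpace.single k 1)).1
  simpa [Pi.single_apply] using this

theorem IsNormal.D2_D2_vel (hN : IsNormal G Ω) {u : E4} (hu : u ∈ Ω) (a k l : Fin 4) :
    D2 l (D2 k (vel G Ω a)) u u = christoffel G a k l u := by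
  refine eq_of_quadratic_eq (A := fun k l => D2 l (D2 k (vel G Ω a)) u u)
    (B := fun k l => christoffel G a k l u) (fun i j => ?_) (fun i j => hN.christoffel_symm hu a i j)
    (fun w => ?_) k l
  · have h2 : ContDiffAt ℝ 2 (vel G Ω a u) u :=
      ((hN.reg_vel a).contDiffAt_right hN.isOpen hu hu).of_le two_le_infty
    exact pd_comm h2 j i
  · have := (hN.D2_vel_jet hu a w).2
    simp only [hN.D2_vel hu] at this
    have e : ∑ k, ∑ i, ∑ j, (if a = k then (1 : ℝ) else 0) * christoffel G k i j u * w i * w j =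
        ∑ i, ∑ j, christoffel G a i j u * w i * w j := by
      rw [Finset.sum_eq_single a (fun k _ hk => by simp [hk.symm]) (by simp)]
      simp
    rw [e] at this
    rw [← this]
    exact Finset.sum_congr rfl fun k _ => Finset.sum_congr rfl fun l _ => by ring

end Geodesics

/-! ### The gradient of the half squared distance -/

section Gradient

/-- The gradient of the half squared distance has this shape, with `A = ½ ∂G`, `B = G`, `v` the
velocity and `z` its derivative in the first argument. Since `v` vanishes at `u`, every term that
keeps an undifferentiated `v` disappears; the coefficients `A` contribute from the second derivative
on. -/
theorem pd_quadratic {v z : Fin 4 → E4 → ℝ} {u : E4} (hv : ∀ i, ContDiffAt ℝ 2 (v i) u)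
    (hz : ∀ i, ContDiffAt ℝ 2 (z i) u) (hv0 : ∀ i, v i u = 0) (A B : Fin 4 → Fin 4 → ℝ)
    (b : Fin 4) :
    pd b (fun y => ∑ i, ∑ j, (A i j * (v i y * v j y) + B i j * (z i y * v j y))) u =
      ∑ i, ∑ j, B i j * (z i u * pd b (v j) u) := by
  have hvd := fun i => (hv i).differentiableAt (by simp)
  have hzd := fun i => (hz i).differentiableAt (by simp)
  have h1 : ∀ i j, DifferentiableAt ℝ (fun y => A i j * (v i y * v j y)) u := fun i j =>
    ((hvd i).mul (hvd j)).const_mul (A i j)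
  have h2 : ∀ i j, DifferentiableAt ℝ (fun y => B i j * (z i y * v j y)) u := fun i j =>
    ((hzd i).mul (hvd j)).const_mul (B i j)
  rw [pd_sum (fun i _ => DifferentiableAt.fun_sum fun j _ => (h1 i j).fun_add (h2 i j))]
  refine Finset.sum_congr rfl fun i _ => ?_
  rw [pd_sum (fun j _ => (h1 i j).fun_add (h2 i j))]
  refine Finset.sum_congr rfl fun j _ => ?_
  rw [pd_add (h1 i j) (h2 i j), pd_mul (differentiableAt_const _) ((hvd i).fun_mul (hvd j)),
    pd_mul (differentiableAt_const _) ((hzd i).fun_mul (hvd j))]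
  rw [pd_mul (hvd i) (hvd j), pd_mul (hzd i) (hvd j)]
  simp [hv0, pd_const]

theorem pd_pd_quadratic {v z : Fin 4 → E4 → ℝ} {u : E4} (hv : ∀ i, ContDiffAt ℝ 2 (v i) u)
    (hz : ∀ i, ContDiffAt ℝ 2 (z i) u) (hv0 : ∀ i, v i u = 0) (A B : Fin 4 → Fin 4 → ℝ)
    (c b : Fin 4) :
    pd c (pd b fun y => ∑ i, ∑ j, (A i j * (v i y * v j y) + B i j * (z i y * v j y))) u =
      ∑ i, ∑ j, (A i j * (pd b (v i) u * pd c (v j) u + pd c (v i) u * pd b (v j) u)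
        + B i j * (pd b (z i) u * pd c (v j) u + pd c (z i) u * pd b (v j) u
          + z i u * pd c (pd b (v j)) u)) := by
  have h1 := fun i j => contDiffAt_const (c := A i j).mul ((hv i).mul (hv j))
  have h2 := fun i j => contDiffAt_const (c := B i j).mul ((hz i).mul (hv j))
  rw [pd_pd_sum (fun i _ => ContDiffAt.sum fun j _ => (h1 i j).add (h2 i j))]
  refine Finset.sum_congr rfl fun i _ => ?_
  rw [pd_pd_sum (fun j _ => (h1 i j).add (h2 i j))]
  refine Finset.sum_congr rfl fun j _ => ?_
  have hc : ∀ (c b : Fin 4) (K : ℝ), pd c (pd b fun _ : E4 => K) u = 0 := fun c b K => by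
    rw [show (pd b fun _ : E4 => K) = fun _ => 0 from funext fun y => pd_const b K y, pd_const]
  rw [pd_pd_add (h1 i j) (h2 i j), pd_pd_mul contDiffAt_const ((hv i).mul (hv j)),
    pd_pd_mul contDiffAt_const ((hz i).mul (hv j))]
  erw [pd_pd_mul (hv i) (hv j), pd_pd_mul (hz i) (hv j)]
  simp only [hv0, pd_const, hc, zero_mul, mul_zero, zero_add, add_zero]
  ring

variable {G : E4 → Matrix (Fin 4) (Fin 4) ℝ} {Ω : Set E4}

theorem IsNormal.reg_metric (hN : IsNormal G Ω) (i j : Fin 4) : Reg Ω ∞ fun u _ => G u i j :=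
  reg_of_left (hN.smooth i j)

theorem IsNormal.reg_halfSqDist (hN : IsNormal G Ω) : Reg Ω ∞ (halfSqDist G Ω) := by
  refine ContDiffOn.mul contDiffOn_const (ContDiffOn.sum fun i _ => ContDiffOn.sum fun j _ => ?_)
  exact ((hN.reg_metric i j).mul (hN.reg_vel i)).mul (hN.reg_vel j)

/-- By symmetry of the metric, the two terms in which a velocity is differentiated coincide, which
absorbs the factor `1/2`. -/
theorem IsNormal.D1_halfSqDist (hN : IsNormal G Ω) {u u' : E4} (hu : u ∈ Ω) (hu' : u' ∈ Ω)
    (a : Fin 4) : D1 a (halfSqDist G Ω) u u' =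
      ∑ i, ∑ j, (1 / 2 * pd a (fun y => G y i j) u * (vel G Ω i u u' * vel G Ω j u u')
        + G u i j * (D1 a (vel G Ω i) u u' * vel G Ω j u u')) := by
  have hG := fun i j => ((hN.smooth i j).contDiffAt (hN.isOpen.mem_nhds hu)).differentiableAt
    (by simp)
  have hv := fun i => ((hN.reg_vel i).contDiffAt_left hN.isOpen hu hu').differentiableAt
    (by simp)
  have h1 : ∀ i j, DifferentiableAt ℝ
      (fun y => G y i j * vel G Ω i y u' * vel G Ω j y u') u := fun i j =>
    ((hG i j).mul (hv i)).mul (hv j)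
  have hs : D1 a (halfSqDist G Ω) u u' = 1 / 2 * ∑ i, ∑ j,
      ((pd a (fun y => G y i j) u * vel G Ω i u u' + G u i j * D1 a (vel G Ω i) u u') *
        vel G Ω j u u' + G u i j * vel G Ω i u u' * D1 a (vel G Ω j) u u') := by
    change pd a (fun y => 1 / 2 * ∑ i, ∑ j, G y i j * vel G Ω i y u' * vel G Ω j y u') u = _
    rw [pd_mul (differentiableAt_const _)
      (DifferentiableAt.fun_sum fun i _ => DifferentiableAt.fun_sum fun j _ => h1 i j),
      pd_const, zero_mul, zero_add, pd_sum (fun i _ => DifferentiableAt.fun_sum fun j _ => h1 i j)]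
    congr 1
    refine Finset.sum_congr rfl fun i _ => ?_
    rw [pd_sum (fun j _ => h1 i j)]
    refine Finset.sum_congr rfl fun j _ => ?_
    erw [pd_mul ((hG i j).mul (hv i)) (hv j), pd_mul (hG i j) (hv i)]
    rfl
  have hsym : ∑ i, ∑ j, G u i j * (vel G Ω i u u' * D1 a (vel G Ω j) u u') =
      ∑ i, ∑ j, G u i j * (D1 a (vel G Ω i) u u' * vel G Ω j u u') := by
    rw [Finset.sum_comm]
    exact Finset.sum_congr rfl fun i _ => Finset.sum_congr rfl fun j _ => by
      rw [hN.symm u hu j i]; ring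
  have e : ∀ x y z : ℝ, x = 1 / 2 * y + 1 / 2 * z + 1 / 2 * z → x = 1 / 2 * y + z := by
    intros; linarith
  rw [hs]
  have h3 : ∑ i, ∑ j, (1 / 2 * pd a (fun y => G y i j) u * (vel G Ω i u u' * vel G Ω j u u')
        + G u i j * (D1 a (vel G Ω i) u u' * vel G Ω j u u')) =
      1 / 2 * ∑ i, ∑ j, pd a (fun y => G y i j) u * (vel G Ω i u u' * vel G Ω j u u')
        + ∑ i, ∑ j, G u i j * (D1 a (vel G Ω i) u u' * vel G Ω j u u') := by
    simp only [Finset.mul_sum, ← Finset.sum_add_distrib]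
    exact Finset.sum_congr rfl fun i _ => Finset.sum_congr rfl fun j _ => by ring
  rw [h3]
  apply e
  nth_rewrite 1 [← hsym]
  simp only [Finset.mul_sum, ← Finset.sum_add_distrib]
  exact Finset.sum_congr rfl fun i _ => Finset.sum_congr rfl fun j _ => by ring

theorem IsNormal.D1_vel (hN : IsNormal G Ω) {u : E4} (hu : u ∈ Ω) (a i : Fin 4) :
    D1 a (vel G Ω i) u u = -if i = a then 1 else 0 := by
  rw [D1_eq_neg_D2 hN.isOpen ((hN.reg_vel i).of_le (m := 1) (by simp)) (fun u hu => hN.vel_diag hu i) hu,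
    hN.D2_vel hu]

/-- `D2 b` of the velocity equals `δ` all along the diagonal, so its two partial derivatives there
are opposite, and the one in the second argument is `Γ`. -/
theorem IsNormal.D2_D1_vel (hN : IsNormal G Ω) {u : E4} (hu : u ∈ Ω) (a b i : Fin 4) :
    D2 b (D1 a (vel G Ω i)) u u = -christoffel G i b a u := by
  rw [D2_D1_comm hN.isOpen ((hN.reg_vel i).of_le two_le_infty) hu hu,
    D1_eq_neg_D2 hN.isOpen (((hN.reg_vel i).D2 (m := ∞) hN.isOpen (by simp) b).of_le (m := 1) (by simp))
      (fun u hu => hN.D2_vel hu i b) hu, hN.D2_D2_vel hu]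

theorem IsNormal.D1_halfSqDist_diag (hN : IsNormal G Ω) {u : E4} (hu : u ∈ Ω) (a : Fin 4) :
    D1 a (halfSqDist G Ω) u u = 0 := by
  simp [hN.D1_halfSqDist hu hu, hN.vel_diag hu]

theorem IsNormal.D2_D1_halfSqDist (hN : IsNormal G Ω) {u : E4} (hu : u ∈ Ω) (a b : Fin 4) :
    D2 b (D1 a (halfSqDist G Ω)) u u = -G u a b := by
  have hv := fun i => ((hN.reg_vel i).contDiffAt_right hN.isOpen hu hu).of_le two_le_infty
  have hz := fun i => (((hN.reg_vel i).D1 (m := ∞) hN.isOpen (by simp) a).contDiffAt_right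
    hN.isOpen hu hu).of_le two_le_infty
  unfold D2
  rw [pd_congr (Filter.eventually_of_mem (hN.isOpen.mem_nhds hu) fun y hy =>
    hN.D1_halfSqDist hu hy a)]
  rw [pd_quadratic (v := fun i => vel G Ω i u) (z := fun i => D1 a (vel G Ω i) u) hv hz
    (fun i => hN.vel_diag hu i) (fun i j => 1 / 2 * pd a (fun y => G y i j) u) (fun i j => G u i j)]
  have h1 : ∀ j, pd b (vel G Ω j u) u = if j = b then 1 else 0 := fun j => hN.D2_vel hu j b
  simp [h1, hN.D1_vel hu]

/-- Metric compatibility, `∂_a g_{bc} = Γ_{c,ba} + Γ_{b,ca}`, cancels every term except the one with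
the second derivative of the velocity. -/
theorem IsNormal.D2_D2_D1_halfSqDist (hN : IsNormal G Ω) {u : E4} (hu : u ∈ Ω) (a b c : Fin 4) :
    D2 c (D2 b (D1 a (halfSqDist G Ω))) u u = -∑ j, G u a j * christoffel G j b c u := by
  have hv := fun i => ((hN.reg_vel i).contDiffAt_right hN.isOpen hu hu).of_le two_le_infty
  have hz := fun i => (((hN.reg_vel i).D1 (m := ∞) hN.isOpen (by simp) a).contDiffAt_right
    hN.isOpen hu hu).of_le two_le_infty
  unfold D2
  rw [pd_congr (pd_eventuallyEq (Filter.eventually_of_mem (hN.isOpen.mem_nhds hu) fun y hy =>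
    hN.D1_halfSqDist hu hy a) b)]
  rw [pd_pd_quadratic (v := fun i => vel G Ω i u) (z := fun i => D1 a (vel G Ω i) u) hv hz
    (fun i => hN.vel_diag hu i) (fun i j => 1 / 2 * pd a (fun y => G y i j) u) (fun i j => G u i j)]
  have h1 : ∀ b j, pd b (vel G Ω j u) u = if j = b then 1 else 0 := fun b j => hN.D2_vel hu j b
  have h2 : ∀ b j, pd b (D1 a (vel G Ω j) u) u = -christoffel G j b a u := fun b j =>
    hN.D2_D1_vel hu a b j
  have h3 : ∀ j, pd c (pd b (vel G Ω j u)) u = christoffel G j b c u := fun j =>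
    hN.D2_D2_vel hu j b c
  simp only [h1, h2, h3, hN.D1_vel hu, mul_add, Finset.sum_add_distrib]
  simp only [mul_ite, ite_mul, mul_one, mul_zero, zero_mul, one_mul, neg_mul, mul_neg,
    Finset.sum_neg_distrib, Finset.sum_ite_eq', Finset.mem_univ, if_true, Finset.sum_ite_irrel,
    Finset.sum_const_zero, neg_ite, neg_zero]
  have e1 := hN.sum_mul_christoffel hu c b a
  have e2 := hN.sum_mul_christoffel hu b c a
  simp only [fun i => hN.symm u hu i c, fun i => hN.symm u hu i b]
  rw [e1, e2, hN.pd_symm hu a c b, hN.pd_symm hu b c a, hN.pd_symm hu c b a]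
  ring

/-- The contravariant gradient of the half squared distance. -/
def gradSq (G : E4 → Matrix (Fin 4) (Fin 4) ℝ) (Ω : Set E4) (a : Fin 4) (u u' : E4) : ℝ :=
  ∑ b, (G u)⁻¹ a b * D1 b (halfSqDist G Ω) u u'

theorem IsNormal.reg_gradSq (hN : IsNormal G Ω) (a : Fin 4) : Reg Ω ∞ (gradSq G Ω a) :=
  Reg.sum fun b _ => (reg_of_left (contDiffOn_inv_apply hN.smooth hN.det_ne_zero a b)).mul
    (hN.reg_halfSqDist.D1 hN.isOpen (by simp) b)

theorem IsNormal.gradSq_diag (hN : IsNormal G Ω) {u : E4} (hu : u ∈ Ω) (a : Fin 4) :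
    gradSq G Ω a u u = 0 := by
  simp [gradSq, hN.D1_halfSqDist_diag hu]

theorem IsNormal.sum_inv_mul (hN : IsNormal G Ω) {u : E4} (hu : u ∈ Ω) (a b : Fin 4) :
    ∑ i, (G u)⁻¹ a i * G u i b = if a = b then 1 else 0 := by
  have := congrFun₂ (Matrix.nonsing_inv_mul (G u) (hN.det_ne_zero u hu).isUnit) a b
  rwa [Matrix.mul_apply, Matrix.one_apply] at this

theorem IsNormal.pd_gradSq (hN : IsNormal G Ω) {u : E4} (hu : u ∈ Ω) (a b : Fin 4) :
    pd b (gradSq G Ω a u) u = -if a = b then 1 else 0 := by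
  have hp := fun i => ((hN.reg_halfSqDist.D1 (m := ∞) hN.isOpen (by simp) i).contDiffAt_right
    hN.isOpen hu hu).differentiableAt (by simp)
  unfold gradSq
  rw [pd_sum (fun i _ => (hp i).const_mul _), ← hN.sum_inv_mul hu, ← Finset.sum_neg_distrib]
  refine Finset.sum_congr rfl fun i _ => ?_
  rw [pd_mul (differentiableAt_const _) (hp i), pd_const]
  have := hN.D2_D1_halfSqDist hu i b
  simp only [D2] at this
  rw [this]
  ring

/-- With `IsNormal.gradSq_diag` and `IsNormal.pd_gradSq` this is the full 2-jet of `Σ^a` in `x'`.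
The second derivatives `-Γ` are what turns coordinate Taylor coefficients into covariant ones. -/
theorem IsNormal.pd_pd_gradSq (hN : IsNormal G Ω) {u : E4} (hu : u ∈ Ω) (a b c : Fin 4) :
    pd c (pd b (gradSq G Ω a u)) u = -christoffel G a b c u := by
  have hp := fun i => ((hN.reg_halfSqDist.D1 (m := ∞) hN.isOpen (by simp) i).contDiffAt_right
    hN.isOpen hu hu).of_le two_le_infty
  have hc : ∀ (c b : Fin 4) (K : ℝ), pd c (pd b fun _ : E4 => K) u = 0 := fun c b K => by
    rw [show (pd b fun _ : E4 => K) = fun _ => 0 from funext fun y => pd_const b K y, pd_const]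
  unfold gradSq
  rw [pd_pd_sum (fun i _ => contDiffAt_const.mul (hp i))]
  have h1 : ∀ i, pd c (pd b fun y => (G u)⁻¹ a i * D1 i (halfSqDist G Ω) u y) u =
      ∑ j, -(((G u)⁻¹ a i * G u i j) * christoffel G j b c u) := by
    intro i
    rw [pd_pd_mul contDiffAt_const (hp i), hc, pd_const, pd_const]
    have := hN.D2_D2_D1_halfSqDist hu i b c
    simp only [D2] at this
    erw [this]
    simp only [zero_mul, zero_add, mul_neg, Finset.sum_neg_distrib, Finset.mul_sum]
    congr 1
    exact Finset.sum_congr rfl fun j _ => by ring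
  simp only [h1]
  rw [Finset.sum_comm]
  simp only [Finset.sum_neg_distrib, ← Finset.sum_mul, hN.sum_inv_mul hu]
  simp

end Gradient

/-! ### Second-order Taylor expansions in powers of a coordinate-like map -/

section Taylor

variable {F : Type*} [NormedAddCommGroup F] [NormedSpace ℝ F]

theorem pd_pd_const (i j : Fin 4) (c : F) (u : E4) : pd i (pd j fun _ => c) u = 0 := by
  rw [show (pd j fun _ : E4 => c) = fun _ => 0 from funext fun y => pd_const j c y, pd_const]

theorem pd_smul_const {f : E4 → ℝ} {u : E4} (hf : DifferentiableAt ℝ f u) (c : F) (i : Fin 4) :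
    pd i (fun y => f y • c) u = pd i f u • c := by
  rw [pd_smul hf (differentiableAt_const c), pd_const, smul_zero, add_zero]

theorem pd_pd_smul_const {f : E4 → ℝ} {u : E4} (hf : ContDiffAt ℝ 2 f u) (c : F) (i j : Fin 4) :
    pd i (pd j fun y => f y • c) u = pd i (pd j f) u • c := by
  rw [pd_pd_smul hf contDiffAt_const, pd_const, pd_const, pd_pd_const]
  simp

theorem pd_pd_sub {f g : E4 → F} {u : E4} (hf : ContDiffAt ℝ 2 f u) (hg : ContDiffAt ℝ 2 g u)
    (i j : Fin 4) :
    pd i (pd j fun y => f y - g y) u = pd i (pd j f) u - pd i (pd j g) u := by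
  have h := pd_pd_add hf (hg.neg) i j
  have hn : pd i (pd j fun y => -g y) u = -pd i (pd j g) u := by
    rw [show (pd j fun y => -g y) = fun y => -pd j g y from funext fun y => pd_neg j, pd_neg]
  simp only [sub_eq_add_neg]
  rw [← hn]
  exact h

variable {q : Fin 4 → E4 → ℝ} {a : E4}

/-- The polynomial `w⁰ + w¹_i q^i + ½ w²_{ij} q^i q^j`. -/
def quadPoly (w : F × (Fin 4 → F) × (Fin 4 → Fin 4 → F)) (q : Fin 4 → ℝ) : F :=
  w.1 + ∑ i, q i • w.2.1 i + (1 / 2 : ℝ) • ∑ i, ∑ j, (q i * q j) • w.2.2 i j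

theorem quadPoly_sub (w w' : F × (Fin 4 → F) × (Fin 4 → Fin 4 → F)) (q : Fin 4 → ℝ) :
    quadPoly w q - quadPoly w' q = quadPoly (w - w') q := by
  simp only [quadPoly, Prod.fst_sub, Prod.snd_sub, Pi.sub_apply, smul_sub,
    Finset.sum_sub_distrib]
  abel

theorem contDiffAt_quadPoly {n : WithTop ℕ∞} (hq : ∀ i, ContDiffAt ℝ n (q i) a)
    (w : F × (Fin 4 → F) × (Fin 4 → Fin 4 → F)) :
    ContDiffAt ℝ n (fun y => quadPoly w fun i => q i y) a :=
  (contDiffAt_const.add (ContDiffAt.sum fun i _ => (hq i).smul contDiffAt_const)).add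
    (contDiffAt_const.smul (ContDiffAt.sum fun i _ => ContDiffAt.sum fun j _ =>
      ((hq i).mul (hq j)).smul contDiffAt_const))

theorem pd_quadPoly (hq : ∀ i, ContDiffAt ℝ 2 (q i) a) (hq0 : ∀ i, q i a = 0)
    (w : F × (Fin 4 → F) × (Fin 4 → Fin 4 → F)) (b : Fin 4) :
    pd b (fun y => quadPoly w fun i => q i y) a = ∑ i, pd b (q i) a • w.2.1 i := by
  have hd := fun i => (hq i).differentiableAt (by simp)
  have h1 : ∀ i, DifferentiableAt ℝ (fun y => q i y • w.2.1 i) a := fun i =>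
    (hd i).smul_const _
  have h2 : ∀ i j, DifferentiableAt ℝ (fun y => (q i y * q j y) • w.2.2 i j) a := fun i j =>
    ((hd i).mul (hd j)).smul_const _
  have h2' := fun i => DifferentiableAt.fun_sum fun j (_ : j ∈ Finset.univ) => h2 i j
  have h2s := DifferentiableAt.fun_sum fun i (_ : i ∈ Finset.univ) => h2' i
  have h1s := DifferentiableAt.fun_sum fun i (_ : i ∈ Finset.univ) => h1 i
  unfold quadPoly
  rw [pd_add ((differentiableAt_const _).fun_add h1s) (h2s.fun_const_smul _),
    pd_add (differentiableAt_const _) h1s, pd_const, pd_smul (differentiableAt_const _) h2s,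
    pd_const, pd_sum fun i _ => h1 i, pd_sum fun i _ => h2' i]
  have h3 : ∀ i, pd b (fun y => ∑ j, (q i y * q j y) • w.2.2 i j) a = 0 := by
    intro i
    rw [pd_sum fun j _ => h2 i j]
    refine Finset.sum_eq_zero fun j _ => ?_
    rw [pd_smul_const ((hd i).fun_mul (hd j)), pd_mul (hd i) (hd j), hq0, hq0]
    simp
  simp only [h3, fun i => pd_smul_const (hd i) (w.2.1 i) b]
  simp

theorem pd_pd_quadPoly (hq : ∀ i, ContDiffAt ℝ 2 (q i) a) (hq0 : ∀ i, q i a = 0)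
    (w : F × (Fin 4 → F) × (Fin 4 → Fin 4 → F)) (c b : Fin 4) :
    pd c (pd b fun y => quadPoly w fun i => q i y) a = ∑ i, pd c (pd b (q i)) a • w.2.1 i
      + (1 / 2 : ℝ) • ∑ i, ∑ j,
        (pd b (q i) a * pd c (q j) a + pd c (q i) a * pd b (q j) a) • w.2.2 i j := by
  have h1 : ∀ i, ContDiffAt ℝ 2 (fun y => q i y • w.2.1 i) a := fun i =>
    (hq i).smul contDiffAt_const
  have h2 : ∀ i j, ContDiffAt ℝ 2 (fun y => (q i y * q j y) • w.2.2 i j) a := fun i j =>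
    ((hq i).mul (hq j)).smul contDiffAt_const
  have h2' := fun i => ContDiffAt.sum fun j (_ : j ∈ Finset.univ) => h2 i j
  have h2s := ContDiffAt.sum fun i (_ : i ∈ Finset.univ) => h2' i
  have h1s := ContDiffAt.sum fun i (_ : i ∈ Finset.univ) => h1 i
  have h1c : ContDiffAt ℝ 2 (fun y => w.1 + ∑ i, q i y • w.2.1 i) a := contDiffAt_const.add h1s
  have h2c : ContDiffAt ℝ 2 (fun y => (1 / 2 : ℝ) • ∑ i, ∑ j, (q i y * q j y) • w.2.2 i j) a :=
    contDiffAt_const.smul h2s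
  unfold quadPoly
  rw [pd_pd_add h1c h2c, pd_pd_add contDiffAt_const h1s, pd_pd_const, pd_pd_smul contDiffAt_const h2s, pd_const,
    pd_const, pd_pd_const, pd_pd_sum fun i _ => h1 i, pd_pd_sum fun i _ => h2' i]
  have h3 : ∀ i, pd c (pd b fun y => ∑ j, (q i y * q j y) • w.2.2 i j) a =
      ∑ j, (pd b (q i) a * pd c (q j) a + pd c (q i) a * pd b (q j) a) • w.2.2 i j := by
    intro i
    rw [pd_pd_sum fun j _ => h2 i j]
    refine Finset.sum_congr rfl fun j _ => ?_
    rw [pd_pd_smul_const ((hq i).mul (hq j)), pd_pd_mul (hq i) (hq j), hq0, hq0]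
    simp
  simp only [h3, fun i => pd_pd_smul_const (hq i) (w.2.1 i) c b]
  simp

variable {Γ : Fin 4 → Fin 4 → Fin 4 → ℝ}

/-- The second-order Taylor expansion in powers of functions `q^i` with
`q^i(a) = 0`, `∂_j q^i(a) = -δ^i_j` and `∂_j ∂_k q^i(a) = -Γ^i_{kj}`. -/
theorem sub_quadPoly_isBigO (hq : ∀ i, ContDiffAt ℝ 3 (q i) a) (hq0 : ∀ i, q i a = 0)
    (hq1 : ∀ i b, pd b (q i) a = -if i = b then 1 else 0)
    (hq2 : ∀ i b c, pd c (pd b (q i)) a = -Γ i b c) {W : E4 → F} (hW : ContDiffAt ℝ 3 W a) :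
    (fun y => W y - quadPoly (W a, (fun i => -pd i W a),
      fun i j => pd i (pd j W) a - ∑ k, Γ k i j • pd k W a) fun i => q i y)
      =O[𝓝 a] fun y => ‖y - a‖ ^ 3 := by
  have h2 : (2 : WithTop ℕ∞) ≤ 3 := by norm_num
  have hq' := fun i => (hq i).of_le h2
  set w : F × (Fin 4 → F) × (Fin 4 → Fin 4 → F) := (W a, (fun i => -pd i W a),
      fun i j => pd i (pd j W) a - ∑ k, Γ k i j • pd k W a)
  have hP := contDiffAt_quadPoly hq w
  -- The symmetry of `Γ` is inherited from the second derivatives of `q`.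
  have hΓ : ∀ i b c, Γ i b c = Γ i c b := fun i b c => by
    rw [← neg_inj, ← hq2, ← hq2, pd_comm (hq' i)]
  refine isBigO_norm_pow_three (hW.sub hP) ?_ (fun b => ?_) (fun c b => ?_)
  · simp [quadPoly, hq0, w]
  · rw [pd_sub (hW.differentiableAt (by simp)) (hP.differentiableAt (by simp)),
      pd_quadPoly hq' hq0]
    simp [hq1, w]
  · rw [pd_pd_sub (hW.of_le h2) (hP.of_le h2), pd_pd_quadPoly hq' hq0]
    simp only [hq1, hq2, w]
    have e : ∀ X : Fin 4 → Fin 4 → F, ∑ i, ∑ j,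
        (((-if i = b then (1 : ℝ) else 0) * -if j = c then (1 : ℝ) else 0) +
          (-if i = c then (1 : ℝ) else 0) * -if j = b then (1 : ℝ) else 0) • X i j =
        X b c + X c b := by
      intro X
      simp only [add_smul, Finset.sum_add_distrib, neg_mul_neg, mul_smul, ← Finset.smul_sum]
      simp
    rw [e, pd_comm (hW.of_le h2) b c]
    simp only [fun k => hΓ k b c, neg_smul, smul_neg, neg_neg]
    rw [← two_smul ℝ, smul_smul]
    norm_num

theorem tendsto_line (hq : ∀ i, ContDiffAt ℝ 3 (q i) a) (hq0 : ∀ i, q i a = 0)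
    (hq1 : ∀ i b, pd b (q i) a = -if i = b then 1 else 0) (v : E4) (i : Fin 4) :
    Tendsto (fun t : ℝ => t⁻¹ * q i (a + t • v)) (𝓝[≠] 0) (𝓝 (-v i)) := by
  have hl : HasDerivAt (fun t : ℝ => a + t • v) v 0 := by
    simpa using ((hasDerivAt_id (0 : ℝ)).smul_const v).const_add a
  have hd : HasFDerivAt (q i) (fderiv ℝ (q i) a) (a + (0 : ℝ) • v) := by
    simpa using ((hq i).differentiableAt (by simp)).hasFDerivAt
  have h := (hd.comp_hasDerivAt 0 hl).tendsto_slope_zero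
  rw [fderiv_eq_sum_pd] at h
  simpa [hq1, hq0] using h

theorem tendsto_pow_smul_of_isBigO {f : E4 → F} (h : f =O[𝓝 a] fun y => ‖y - a‖ ^ 3) (v : E4)
    {k : ℕ} (hk : k < 3) :
    Tendsto (fun t : ℝ => t⁻¹ ^ k • f (a + t • v)) (𝓝[≠] 0) (𝓝 0) := by
  have hl : Tendsto (fun t : ℝ => a + t • v) (𝓝[≠] 0) (𝓝 a) := by
    have : Continuous fun t : ℝ => a + t • v := by fun_prop
    simpa using (this.tendsto 0).mono_left (nhdsWithin_le_nhds (s := {0}ᶜ))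
  have h1 := (Asymptotics.isBigO_refl (fun t : ℝ => t⁻¹ ^ k) (𝓝[≠] 0)).smul (h.comp_tendsto hl)
  refine h1.trans_tendsto ?_
  have h2 : Tendsto (fun t : ℝ => t⁻¹ ^ k * (|t| ^ 3 * ‖v‖ ^ 3)) (𝓝[≠] 0) (𝓝 0) := by
    have h3 : Tendsto (fun t : ℝ => |t| ^ (3 - k) * ‖v‖ ^ 3) (𝓝[≠] 0) (𝓝 0) := by
      have : Continuous fun t : ℝ => |t| ^ (3 - k) * ‖v‖ ^ 3 := by fun_prop
      have h4 := (this.tendsto 0).mono_left (nhdsWithin_le_nhds (s := {0}ᶜ))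
      have h5 : 3 - k ≠ 0 := by omega
      simpa [h5] using h4
    refine squeeze_zero_norm' ?_ h3
    filter_upwards [self_mem_nhdsWithin] with t ht
    have ht' : |t| ≠ 0 := abs_ne_zero.2 ht
    rw [norm_mul, norm_pow, norm_inv, Real.norm_eq_abs, Real.norm_eq_abs,
      abs_of_nonneg (by positivity : (0 : ℝ) ≤ |t| ^ 3 * ‖v‖ ^ 3), ← mul_assoc]
    refine le_of_eq ?_
    congr 1
    have : |t| ^ 3 = |t| ^ k * |t| ^ (3 - k) := by rw [← pow_add]; congr 1; omega
    rw [this, ← mul_assoc, inv_pow, inv_mul_cancel₀ (pow_ne_zero _ ht'), one_mul]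
  refine h2.congr fun t => ?_
  simp [norm_smul, mul_pow]

/-- Uniqueness of Taylor coefficients: on the lines `a + t v`, where `q ≈ -t v`, divide by `t^k` for
`k = 0, 1, 2` and let `t → 0`. The `k`-th homogeneous part must vanish for every `v`; polarization
and symmetry then finish the quadratic part. -/
theorem quadPoly_eq_zero_of_isBigO (hq : ∀ i, ContDiffAt ℝ 3 (q i) a) (hq0 : ∀ i, q i a = 0)
    (hq1 : ∀ i b, pd b (q i) a = -if i = b then 1 else 0)
    {w : F × (Fin 4 → F) × (Fin 4 → Fin 4 → F)} (hsymm : ∀ i j, w.2.2 i j = w.2.2 j i)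
    (h : (fun y => quadPoly w fun i => q i y) =O[𝓝 a] fun y => ‖y - a‖ ^ 3) : w = 0 := by
  obtain ⟨w0, w1, w2⟩ := w
  have hline := tendsto_line hq hq0 hq1
  have hq_id : ∀ (v : E4) (i : Fin 4),
      Tendsto (fun t : ℝ => q i (a + t • v)) (𝓝[≠] 0) (𝓝 0) := by
    intro v i
    have h1 : Tendsto (fun t : ℝ => t) (𝓝[≠] 0) (𝓝 0) := nhdsWithin_le_nhds
    have h2 := h1.mul (hline v i)
    rw [zero_mul] at h2
    refine h2.congr' ?_
    filter_upwards [self_mem_nhdsWithin] with t ht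
    rw [← mul_assoc, mul_inv_cancel₀ ht, one_mul]
  have e0 : w0 = 0 := by
    have h1 := tendsto_pow_smul_of_isBigO h 0 (k := 0) (by norm_num)
    refine tendsto_nhds_unique (f := fun _ : ℝ => w0) (l := 𝓝[≠] 0) tendsto_const_nhds
      (h1.congr fun t => ?_)
    simp [quadPoly, hq0]
  have e1 : w1 = 0 := by
    have hv : ∀ v : E4, ∑ i, v i • w1 i = 0 := by
      intro v
      have h1 := tendsto_pow_smul_of_isBigO h v (k := 1) (by norm_num)
      have h2 : Tendsto (fun t : ℝ => ∑ i, (t⁻¹ * q i (a + t • v)) • w1 i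
          + (1 / 2 : ℝ) • ∑ i, ∑ j, ((t⁻¹ * q i (a + t • v)) * q j (a + t • v)) • w2 i j)
          (𝓝[≠] 0) (𝓝 (∑ i, (-v i) • w1 i + (1 / 2 : ℝ) • ∑ i, ∑ j, (-v i * 0) • w2 i j)) :=
        (tendsto_finsetSum _ fun i _ => (hline v i).smul_const _).add
          ((tendsto_finsetSum _ fun i _ => tendsto_finsetSum _ fun j _ =>
            ((hline v i).mul (hq_id v j)).smul_const _).const_smul _)
      have h3 := tendsto_nhds_unique h1 (h2.congr fun t => by
        simp only [quadPoly, e0, zero_add, smul_add, Finset.smul_sum, pow_one, smul_smul]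
        congr 1
        refine Finset.sum_congr rfl fun i _ => Finset.sum_congr rfl fun j _ => ?_
        congr 1
        ring)
      simpa [eq_comm] using h3
    ext i
    simpa [Pi.single_apply] using hv (EuclideanSpace.single i 1)
  have e2 : w2 = 0 := by
    have hv : ∀ v : E4, ∑ i, ∑ j, (v i * v j) • w2 i j = 0 := by
      intro v
      have h1 := tendsto_pow_smul_of_isBigO h v (k := 2) (by norm_num)
      have h2 : Tendsto (fun t : ℝ =>
          (1 / 2 : ℝ) • ∑ i, ∑ j, ((t⁻¹ * q i (a + t • v)) * (t⁻¹ * q j (a + t • v))) • w2 i j)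
          (𝓝[≠] 0) (𝓝 ((1 / 2 : ℝ) • ∑ i, ∑ j, (-v i * -v j) • w2 i j)) :=
        (tendsto_finsetSum _ fun i _ => tendsto_finsetSum _ fun j _ =>
            ((hline v i).mul (hline v j)).smul_const _).const_smul _
      have h3 := tendsto_nhds_unique h1 (h2.congr fun t => by
        simp only [quadPoly, e0, e1, zero_add, Finset.smul_sum, smul_smul, Pi.zero_apply,
          smul_zero, Finset.sum_const_zero]
        refine Finset.sum_congr rfl fun i _ => Finset.sum_congr rfl fun j _ => ?_
        congr 1
        ring)
      simpa using (smul_eq_zero.1 h3.symm).resolve_left (by norm_num)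
    have hdiag : ∀ i, w2 i i = 0 := fun i => by
      simpa [Pi.single_apply] using hv (EuclideanSpace.single i 1)
    ext i j
    have h1 := hv (EuclideanSpace.single i 1 + EuclideanSpace.single j 1)
    have h2 : w2 i j + w2 j i = 0 := by
      simp only [PiLp.add_apply, add_mul, mul_add, add_smul, Finset.sum_add_distrib, mul_smul,
        ← Finset.smul_sum] at h1
      rw [add_comm]
      simpa [Pi.single_apply, hdiag] using h1
    have h3 : (2 : ℝ) • w2 i j = 0 := by
      rw [two_smul]
      nth_rewrite 2 [show w2 i j = w2 j i from hsymm i j]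
      exact h2
    simpa using h3
  simp [e0, e1, e2]

/-- The functions `q` measure the distance to `a`. -/
theorem norm_isTheta (hq : ∀ i, ContDiffAt ℝ 3 (q i) a) (hq0 : ∀ i, q i a = 0)
    (hq1 : ∀ i b, pd b (q i) a = -if i = b then 1 else 0) :
    (fun y => ‖fun i => q i y‖ ^ 3) =Θ[𝓝 a] fun y => ‖y - a‖ ^ 3 := by
  have hd : HasFDerivAt (fun y => (WithLp.toLp 2 fun i => q i y : E4))
      (-ContinuousLinearMap.id ℝ E4) a := by
    rw [← hasFDerivWithinAt_univ, hasFDerivWithinAt_euclidean]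
    intro i
    rw [hasFDerivWithinAt_univ]
    have h := ((hq i).differentiableAt (by simp)).hasFDerivAt
    refine h.congr_fderiv ?_
    ext v
    rw [fderiv_eq_sum_pd]
    simp [hq1]
  have ho := hd.isLittleO
  have ha : (WithLp.toLp 2 fun i => q i a : E4) = 0 := by ext i; simp [hq0]
  rw [ha] at ho
  have heq : Asymptotics.IsEquivalent (𝓝 a) (fun y => (WithLp.toLp 2 fun i => q i y : E4))
      fun y => -(y - a) := by
    refine Asymptotics.IsLittleO.neg_right ?_
    refine ho.congr_left fun y => ?_
    simp
  have h1 : (fun y => (WithLp.toLp 2 fun i => q i y : E4)) =Θ[𝓝 a] fun y => y - a :=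
    heq.isTheta.trans ⟨(Asymptotics.isBigO_refl _ _).neg_left,
      (Asymptotics.isBigO_refl _ _).neg_right⟩
  -- The left side carries the maximum norm of `Fin 4 → ℝ`, as `gradUp` does, the right side the
  -- Euclidean norm of `E4`.
  have h2 : (fun y => (fun i => q i y : Fin 4 → ℝ)) =Θ[𝓝 a]
      fun y => (WithLp.toLp 2 fun i => q i y : E4) := by
    constructor
    · exact ((EuclideanSpace.equiv (Fin 4) ℝ : E4 →L[ℝ] (Fin 4 → ℝ)).isBigO_comp
        (fun y => (WithLp.toLp 2 fun i => q i y : E4)) (𝓝 a))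
    · exact (((EuclideanSpace.equiv (Fin 4) ℝ).symm : (Fin 4 → ℝ) →L[ℝ] E4).isBigO_comp
        (fun y => (fun i => q i y : Fin 4 → ℝ)) (𝓝 a))
  exact ((h2.trans h1).norm_left.norm_right).pow 3

end Taylor

/-! ### Jets with prescribed growth -/

section Growth

open Asymptotics

/-- As `u' → a` along `l`, the function `f(·, u')` and its first and second partial derivatives at
`a` are `O(w(u') |u' - a|²)`, `O(w(u') |u' - a|)` and `O(w(u'))`. -/
structure JetO (l : Filter E4) (a : E4) (w : E4 → ℝ) (f : E4 → E4 → ℝ) : Prop where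
  smooth : ∀ᶠ u' in l, ContDiffAt ℝ 2 (fun y => f y u') a
  zero : f a =O[l] fun u' => w u' * ‖u' - a‖ ^ 2
  one : ∀ i, D1 i f a =O[l] fun u' => w u' * ‖u' - a‖
  two : ∀ i j, D1 i (D1 j f) a =O[l] w

variable {l : Filter E4} {a : E4} {w v : E4 → ℝ} {f g : E4 → E4 → ℝ}

theorem JetO.congr (hf : JetO l a w f)
    (h : ∀ᶠ u' in l, (fun y => g y u') =ᶠ[𝓝 a] fun y => f y u') : JetO l a w g where
  smooth := by
    filter_upwards [h, hf.smooth] with u' h1 h2 using h2.congr_of_eventuallyEq h1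
  zero := hf.zero.congr' (h.mono fun u' h => h.self_of_nhds.symm) EventuallyEq.rfl
  one i := (hf.one i).congr' (h.mono fun u' h => (pd_congr h i).symm) EventuallyEq.rfl
  two i j := (hf.two i j).congr'
    (h.mono fun u' h => (pd_congr (pd_eventuallyEq h j) i).symm) EventuallyEq.rfl

theorem JetO.mono (hf : JetO l a w f) (h : w =O[l] v) : JetO l a v f where
  smooth := hf.smooth
  zero := hf.zero.trans (h.mul (isBigO_refl _ _))
  one i := (hf.one i).trans (h.mul (isBigO_refl _ _))
  two i j := (hf.two i j).trans h

theorem JetO.add (hf : JetO l a w f) (hg : JetO l a w g) :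
    JetO l a w fun u u' => f u u' + g u u' where
  smooth := by filter_upwards [hf.smooth, hg.smooth] with u' h1 h2 using h1.add h2
  zero := hf.zero.add hg.zero
  one i := by
    refine ((hf.one i).add (hg.one i)).congr' ?_ EventuallyEq.rfl
    filter_upwards [hf.smooth, hg.smooth] with u' h1 h2
    exact (pd_add (h1.differentiableAt (by simp)) (h2.differentiableAt (by simp)) i).symm
  two i j := by
    refine ((hf.two i j).add (hg.two i j)).congr' ?_ EventuallyEq.rfl
    filter_upwards [hf.smooth, hg.smooth] with u' h1 h2
    exact (pd_pd_add h1 h2 i j).symm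

/-- Weight `w` stands for size `w r²`, with each derivative costing one `r`. Sizes multiply, so the
product has size `w v r⁴`, that is, weight `w v r²`. -/
theorem JetO.mul (hf : JetO l a w f) (hg : JetO l a v g) :
    JetO l a (fun u' => w u' * v u' * ‖u' - a‖ ^ 2) fun u u' => f u u' * g u u' where
  smooth := by filter_upwards [hf.smooth, hg.smooth] with u' h1 h2 using h1.mul h2
  zero := (hf.zero.mul hg.zero).congr_right fun u' => by ring
  one i := by
    have h1 : (fun u' => D1 i f a u' * g a u' + f a u' * D1 i g a u') =O[l]
        fun u' => w u' * v u' * ‖u' - a‖ ^ 2 * ‖u' - a‖ :=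
      (((hf.one i).mul hg.zero).congr_right fun u' => by ring).add
        ((hf.zero.mul (hg.one i)).congr_right fun u' => by ring)
    refine h1.congr' ?_ EventuallyEq.rfl
    filter_upwards [hf.smooth, hg.smooth] with u' h1 h2
    exact (pd_mul (h1.differentiableAt (by simp)) (h2.differentiableAt (by simp)) i).symm
  two i j := by
    have h1 : (fun u' => D1 i (D1 j f) a u' * g a u' + D1 j f a u' * D1 i g a u'
        + (D1 i f a u' * D1 j g a u' + f a u' * D1 i (D1 j g) a u')) =O[l]
        fun u' => w u' * v u' * ‖u' - a‖ ^ 2 :=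
      ((((hf.two i j).mul hg.zero).congr_right fun u' => by ring).add
        (((hf.one j).mul (hg.one i)).congr_right fun u' => by ring)).add
      ((((hf.one i).mul (hg.one j)).congr_right fun u' => by ring).add
        ((hf.zero.mul (hg.two i j)).congr_right fun u' => by ring))
    refine h1.congr' ?_ EventuallyEq.rfl
    filter_upwards [hf.smooth, hg.smooth] with u' h1 h2
    exact (pd_pd_mul h1 h2 i j).symm

/-- A factor depending on `u'` alone is a constant for the derivatives, so boundedness suffices; no
regularity of `θ` is required. -/
theorem JetO.mul_right (hf : JetO l a w f) {θ : E4 → ℝ} (hθ : θ =O[l] fun _ => (1 : ℝ)) :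
    JetO l a w fun u u' => f u u' * θ u' where
  smooth := by filter_upwards [hf.smooth] with u' h1 using h1.mul contDiffAt_const
  zero := (hf.zero.mul hθ).congr_right fun u' => by ring
  one i := by
    refine ((hf.one i).mul hθ).congr' ?_ (Eventually.of_forall fun u' => by ring)
    filter_upwards [hf.smooth] with u' h1
    have := pd_mul (h1.differentiableAt (by simp)) (differentiableAt_const (θ u')) i
    rw [pd_const, mul_zero, add_zero] at this
    exact this.symm
  two i j := by
    refine ((hf.two i j).mul hθ).congr' ?_ (Eventually.of_forall fun u' => by ring)
    filter_upwards [hf.smooth] with u' h1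
    have := pd_pd_mul h1 (contDiffAt_const (c := θ u')) i j
    rw [pd_const, pd_const, pd_pd_const, mul_zero, mul_zero, mul_zero, add_zero, add_zero,
      add_zero] at this
    exact this.symm

theorem JetO.const_mul (hf : JetO l a w f) (c : ℝ) : JetO l a w fun u u' => c * f u u' := by
  simpa only [mul_comm] using
    hf.mul_right (θ := fun _ => c) (isBigO_const_const c one_ne_zero l)

/-- In the second derivative `h''(f) ∂f ∂f + h'(f) ∂∂f`, `h2` bounds the first summand and `h1` the
second; `h1` also covers the first derivative. -/
theorem JetO.comp (hf : JetO l a w f) {h : ℝ → ℝ}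
    (hh : ∀ᶠ u' in l, ContDiffAt ℝ 2 h (f a u'))
    (h0 : (fun u' => h (f a u')) =O[l] fun u' => v u' * ‖u' - a‖ ^ 2)
    (h1 : (fun u' => deriv h (f a u') * w u') =O[l] v)
    (h2 : (fun u' => deriv (deriv h) (f a u') * (w u' ^ 2 * ‖u' - a‖ ^ 2)) =O[l] v) :
    JetO l a v fun u u' => h (f u u') where
  smooth := by
    filter_upwards [hf.smooth, hh] with u' e1 e2 using e2.comp a e1
  zero := h0
  one i := by
    have e : (fun u' => deriv h (f a u') * D1 i f a u') =O[l] fun u' => v u' * ‖u' - a‖ :=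
      (((isBigO_refl _ _).mul (hf.one i)).congr_right fun u' => by rw [← mul_assoc]).trans
        (h1.mul (isBigO_refl _ _))
    refine e.congr' ?_ EventuallyEq.rfl
    filter_upwards [hf.smooth, hh] with u' e1 e2
    exact (pd_comp (f := fun y => f y u') (e2.differentiableAt (by simp)) (e1.differentiableAt (by simp)) i).symm
  two i j := by
    have e : (fun u' => deriv (deriv h) (f a u') * D1 i f a u' * D1 j f a u'
        + deriv h (f a u') * D1 i (D1 j f) a u') =O[l] v :=
      ((((isBigO_refl (fun u' => deriv (deriv h) (f a u')) l).mul (hf.one i)).mul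
        (hf.one j)).trans ((isBigO_refl _ _).congr_left fun u' => by ring) |>.trans h2).add
        (((isBigO_refl _ _).mul (hf.two i j)).trans h1)
    refine e.congr' ?_ EventuallyEq.rfl
    filter_upwards [hf.smooth, hh] with u' e1 e2
    exact (pd_pd_comp (f := fun y => f y u') e2 e1 i j).symm

theorem deriv_deriv_inv {x : ℝ} (hx : x ≠ 0) : deriv (deriv fun y : ℝ => y⁻¹) x = 2 * x⁻¹ ^ 3 := by
  rw [deriv_inv']
  have h := ((hasDerivAt_pow 2 x).inv (pow_ne_zero 2 hx)).neg
  rw [show (fun y : ℝ => -(y ^ 2)⁻¹) = -(fun y : ℝ => y ^ 2)⁻¹ from rfl, h.deriv]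
  field_simp
  norm_num
  ring

variable {c : ℝ}

/-- The lower bound `c r² ≤ |f|` is the analytic content of approaching along a non-null direction.
-/
theorem inv_isBigO (hc : 0 < c) (hlow : ∀ᶠ u' in l, c * ‖u' - a‖ ^ 2 ≤ |f a u'|)
    (hne : ∀ᶠ u' in l, u' ≠ a) : (fun u' => (f a u')⁻¹) =O[l] fun u' => ‖u' - a‖⁻¹ ^ 2 := by
  refine IsBigO.of_bound c⁻¹ ?_
  filter_upwards [hlow, hne] with u' h1 h2
  have hr : 0 < ‖u' - a‖ := norm_pos_iff.2 (sub_ne_zero.2 h2)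
  rw [norm_inv, Real.norm_eq_abs, norm_pow, norm_inv, norm_norm, inv_pow, ← mul_inv]
  exact inv_anti₀ (by positivity) h1

theorem ne_zero_of_lower (hc : 0 < c) (hlow : ∀ᶠ u' in l, c * ‖u' - a‖ ^ 2 ≤ |f a u'|)
    (hne : ∀ᶠ u' in l, u' ≠ a) : ∀ᶠ u' in l, f a u' ≠ 0 := by
  filter_upwards [hlow, hne] with u' h1 h2
  have hr : 0 < ‖u' - a‖ := norm_pos_iff.2 (sub_ne_zero.2 h2)
  exact abs_pos.1 (lt_of_lt_of_le (by positivity) h1)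

/-- `f⁻¹` has size `r⁻² = r⁻⁴ r²`, and each derivative loses one more power of `r`. -/
theorem JetO.inv (hf : JetO l a (fun _ => 1) f) (hc : 0 < c)
    (hlow : ∀ᶠ u' in l, c * ‖u' - a‖ ^ 2 ≤ |f a u'|) (hne : ∀ᶠ u' in l, u' ≠ a) :
    JetO l a (fun u' => ‖u' - a‖⁻¹ ^ 4) fun u u' => (f u u')⁻¹ := by
  have hinv := inv_isBigO hc hlow hne
  have hf0 := ne_zero_of_lower hc hlow hne
  have hr : ∀ᶠ u' in l, ‖u' - a‖ ≠ 0 := hne.mono fun u' h => (norm_pos_iff.2 (sub_ne_zero.2 h)).ne'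
  refine hf.comp (h := fun y => y⁻¹) (hf0.mono fun u' h => contDiffAt_inv ℝ h) ?_ ?_ ?_
  · refine hinv.congr' EventuallyEq.rfl ?_
    filter_upwards [hr] with u' h
    field_simp
  · refine (hinv.pow 2).neg_left.congr (fun u' => ?_) (fun u' => ?_)
    · rw [deriv_inv]; ring
    · ring
  · refine ((hinv.pow 3).const_mul_left 2 |>.mul (isBigO_refl (fun u' => ‖u' - a‖ ^ 2) l)).congr'
      ?_ ?_
    · filter_upwards [hf0] with u' h
      rw [deriv_deriv_inv h]; ring
    · filter_upwards [hr] with u' h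
      field_simp

/-- The logarithm itself is unbounded, while its derivatives have sizes `r⁻¹` and `r⁻²`; the summand
`1` in the weight accounts for the derivatives where the logarithm is small. `Real.log` is `log|·|`,
so the sign of `f` plays no role. -/
theorem JetO.log (hf : JetO l a (fun _ => 1) f) (hc : 0 < c)
    (hlow : ∀ᶠ u' in l, c * ‖u' - a‖ ^ 2 ≤ |f a u'|) (hne : ∀ᶠ u' in l, u' ≠ a) :
    JetO l a (fun u' => (1 + |Real.log (f a u')|) * ‖u' - a‖⁻¹ ^ 2)
      fun u u' => Real.log (f u u') := by
  have hinv := inv_isBigO hc hlow hne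
  have hf0 := ne_zero_of_lower hc hlow hne
  have hr : ∀ᶠ u' in l, ‖u' - a‖ ≠ 0 := hne.mono fun u' h => (norm_pos_iff.2 (sub_ne_zero.2 h)).ne'
  have hle : (fun u' => ‖u' - a‖⁻¹ ^ 2) =O[l]
      fun u' => (1 + |Real.log (f a u')|) * ‖u' - a‖⁻¹ ^ 2 := by
    refine IsBigO.of_bound 1 (Eventually.of_forall fun u' => ?_)
    rw [one_mul, norm_mul]
    refine le_mul_of_one_le_left (norm_nonneg _) ?_
    rw [Real.norm_eq_abs, abs_of_nonneg (by positivity)]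
    linarith [abs_nonneg (Real.log (f a u'))]
  refine hf.comp (h := Real.log) (hf0.mono fun u' h => Real.contDiffAt_log.2 h) ?_ ?_ ?_
  · refine IsBigO.of_bound 1 ?_
    filter_upwards [hr] with u' h
    rw [one_mul, mul_assoc, ← mul_pow, inv_mul_cancel₀ h, one_pow, mul_one, Real.norm_eq_abs,
      Real.norm_eq_abs, abs_of_nonneg (show 0 ≤ 1 + |Real.log (f a u')| by positivity)]
    linarith [abs_nonneg (Real.log (f a u'))]
  · refine IsBigO.trans ?_ hle
    refine hinv.congr_left fun u' => ?_
    rw [Real.deriv_log]; ring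
  · refine IsBigO.trans ?_ hle
    refine ((hinv.pow 2).neg_left.mul (isBigO_refl (fun u' => ‖u' - a‖ ^ 2) l)).congr'
      (Eventually.of_forall fun u' => ?_) ?_
    · simp only [Real.deriv_log']
      rw [deriv_inv]; ring
    · filter_upwards [hr] with u' h
      field_simp

/-- Once `|f| < 1/2`, `log(1 + f)` is bounded by a multiple of `|f|` and the derivatives of `x ↦
log(1 + x)` are bounded, so no weight is lost. -/
theorem JetO.log_one_add (hf : JetO l a w f) (hw : Tendsto (fun u' => w u' * ‖u' - a‖ ^ 2) l (𝓝 0)) :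
    JetO l a w fun u u' => Real.log (1 + f u u') := by
  have hf0 : Tendsto (f a) l (𝓝 0) := hf.zero.trans_tendsto hw
  have hsmall : ∀ᶠ u' in l, |f a u'| < 1 / 2 := by
    have := hf0.abs
    rw [abs_zero] at this
    exact this.eventually_lt_const (by norm_num)
  have hne : ∀ᶠ u' in l, 1 / 2 ≤ 1 + f a u' := hsmall.mono fun u' h => by
    linarith [(abs_lt.1 h).1]
  have hd : deriv (fun x : ℝ => Real.log (1 + x)) = fun x => (1 + x)⁻¹ := by
    ext x
    have := deriv_comp_const_add (f := Real.log) 1 x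
    rw [this, Real.deriv_log]
  have hdd : ∀ x : ℝ, deriv (fun x : ℝ => (1 + x)⁻¹) x = -((1 + x) ^ 2)⁻¹ := by
    intro x
    have := deriv_comp_const_add (f := fun y : ℝ => y⁻¹) 1 x
    rw [this, deriv_inv]
  have hb : (fun u' => (1 + f a u')⁻¹) =O[l] fun _ => (1 : ℝ) := by
    refine IsBigO.of_bound 2 (hne.mono fun u' h => ?_)
    rw [norm_inv, Real.norm_eq_abs, abs_of_pos (by linarith)]
    simpa using inv_anti₀ (by norm_num) h
  refine hf.comp (h := fun x => Real.log (1 + x)) (hne.mono fun u' h => ?_) ?_ ?_ ?_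
  · exact (contDiffAt_const.add contDiffAt_id).log (by simp; linarith)
  · refine IsBigO.trans (IsBigO.of_bound 2 ?_) hf.zero
    filter_upwards [hsmall, hne] with u' h1 h2
    set x := f a u'
    have hx : 0 < 1 + x := by linarith
    rw [Real.norm_eq_abs, Real.norm_eq_abs]
    have up := Real.log_le_sub_one_of_pos hx
    have lo := Real.one_sub_inv_le_log_of_pos hx
    have h3 : 1 - (1 + x)⁻¹ = x * (1 + x)⁻¹ := by field_simp; ring
    have h4 : |x * (1 + x)⁻¹| ≤ 2 * |x| := by
      rw [abs_mul, mul_comm]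
      gcongr
      rw [abs_of_pos (by positivity)]
      simpa using inv_anti₀ (by norm_num) h2
    rw [abs_le]
    constructor
    · have := neg_abs_le (x * (1 + x)⁻¹)
      linarith
    · have := le_abs_self x
      have := abs_nonneg x
      linarith
  · rw [hd]
    exact (hb.mul (isBigO_refl w l)).congr_right fun u' => one_mul _
  · rw [hd]
    have h1 : (fun u' => w u' * ‖u' - a‖ ^ 2) =O[l] fun _ => (1 : ℝ) := hw.isBigO_one ℝ
    refine (((hb.pow 2).neg_left.mul h1).mul (isBigO_refl w l)).congr (fun u' => ?_) fun u' => ?_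
    · rw [hdd, ← inv_pow]; ring
    · ring

theorem JetO.tendsto (hf : JetO l a w f) (hl : l ≤ 𝓝 a) (hw : Tendsto w l (𝓝 0)) :
    Tendsto (f a) l (𝓝 0) ∧ (∀ i, Tendsto (D1 i f a) l (𝓝 0)) ∧
      ∀ i j, Tendsto (D1 i (D1 j f) a) l (𝓝 0) := by
  have hr : Tendsto (fun u' => ‖u' - a‖) l (𝓝 0) := by
    have : Continuous fun u' : E4 => ‖u' - a‖ := by fun_prop
    simpa using (this.tendsto a).mono_left hl
  refine ⟨hf.zero.trans_tendsto ?_, fun i => (hf.one i).trans_tendsto ?_,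
    fun i j => (hf.two i j).trans_tendsto hw⟩
  · simpa using hw.mul (hr.pow 2)
  · simpa using hw.mul hr

variable {Ω : Set E4}

/-- A function without decay has size `O(1) = O(r⁻² r²)`; its derivatives are bounded, which is
better than this weight demands. -/
theorem Reg.jetO (hΩ : IsOpen Ω) (hf : Reg Ω 2 f) (ha : a ∈ Ω) (hl : l ≤ 𝓝 a)
    (hne : ∀ᶠ u' in l, u' ≠ a) : JetO l a (fun u' => ‖u' - a‖⁻¹ ^ 2) f := by
  have hr0 : ∀ᶠ u' in l, ‖u' - a‖ ≠ 0 :=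
    hne.mono fun u' h => (norm_pos_iff.2 (sub_ne_zero.2 h)).ne'
  have hr : (fun u' => ‖u' - a‖) =O[l] fun _ => (1 : ℝ) := by
    have : Continuous fun u' : E4 => ‖u' - a‖ := by fun_prop
    exact ((this.tendsto a).mono_left hl).isBigO_one ℝ
  have hone : ∀ {h : E4 → E4 → ℝ}, Reg Ω 0 h → h a =O[l] fun _ => (1 : ℝ) := fun hh =>
    ((hh.continuousAt_right hΩ ha ha).tendsto.mono_left hl).isBigO_one ℝ
  have h1 : (fun _ => (1 : ℝ)) =O[l] fun u' => ‖u' - a‖⁻¹ ^ 2 * ‖u' - a‖ := by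
    refine (hr.mul (isBigO_refl (fun u' => ‖u' - a‖⁻¹) l)).congr' ?_ ?_
    · filter_upwards [hr0] with u' h using mul_inv_cancel₀ h
    · filter_upwards [hr0] with u' h
      field_simp
  have h2 : (fun _ => (1 : ℝ)) =O[l] fun u' => ‖u' - a‖⁻¹ ^ 2 := by
    refine ((hr.pow 2).mul (isBigO_refl (fun u' => ‖u' - a‖⁻¹ ^ 2) l)).congr' ?_ ?_
    · filter_upwards [hr0] with u' h
      field_simp
    · exact Eventually.of_forall fun u' => by simp
  refine ⟨?_, ?_, fun i => ?_, fun i j => ?_⟩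
  · exact hl (Filter.eventually_of_mem (hΩ.mem_nhds ha) fun u' hu' => hf.contDiffAt_left hΩ ha hu')
  · refine (hone (hf.of_le (by simp))).congr' EventuallyEq.rfl ?_
    filter_upwards [hr0] with u' h
    field_simp
  · exact (hone (hf.D1 hΩ (by norm_num) i)).trans h1
  · exact (hone ((hf.D1 (m := 1) hΩ (by norm_num) j).D1 hΩ (by norm_num) i)).trans h2

theorem Flat.isLittleO (hΩ : IsOpen Ω) {k : ℕ} (hf : Flat Ω k f) (ha : a ∈ Ω) (hl : l ≤ 𝓝 a) :
    f a =o[l] fun u' => ‖u' - a‖ ^ k := by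
  refine IsLittleO.of_bound fun ε hε => ?_
  obtain ⟨δ, hδ, h⟩ := exists_ball_norm_le_mul hΩ hf ha hε
  filter_upwards [hl (Metric.ball_mem_nhds a hδ)] with u' hu'
  rw [norm_pow, norm_norm, norm_sub_rev u' a]
  exact h a (Metric.mem_ball_self hδ) u' hu'

/-- The `η` is the sum of the absolute values of `f`, of its first and of its second derivatives,
divided by `r^(k+2)`, `r^(k+1)` and `r^k`; each quotient tends to zero by flatness. -/
theorem Flat.jetO (hΩ : IsOpen Ω) {k : ℕ} (hf : Flat Ω (k + 2) f) (ha : a ∈ Ω) (hl : l ≤ 𝓝 a)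
    (hne : ∀ᶠ u' in l, u' ≠ a) :
    ∃ η : E4 → ℝ, Tendsto η l (𝓝 0) ∧ JetO l a (fun u' => η u' * ‖u' - a‖ ^ k) f := by
  have hr0 : ∀ᶠ u' in l, ‖u' - a‖ ≠ 0 :=
    hne.mono fun u' h => (norm_pos_iff.2 (sub_ne_zero.2 h)).ne'
  have h0 := (hf.isLittleO hΩ ha hl).tendsto_div_nhds_zero.norm
  have h1 := fun i => ((hf.2.2 i).isLittleO hΩ ha hl).tendsto_div_nhds_zero.norm
  have h2 := fun i j => (((hf.2.2 j).2.2 i).isLittleO hΩ ha hl).tendsto_div_nhds_zero.norm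
  have hη := (h0.add (tendsto_finsetSum Finset.univ fun i _ => h1 i)).add
    (tendsto_finsetSum Finset.univ fun i _ => tendsto_finsetSum Finset.univ fun j _ => h2 i j)
  simp only [norm_zero, Finset.sum_const_zero, add_zero] at hη
  refine ⟨_, hη, ?_, ?_, fun i => ?_, fun i j => ?_⟩
  · refine hl (Filter.eventually_of_mem (hΩ.mem_nhds ha) fun u' hu' =>
      (hf.reg.contDiffAt_left hΩ ha hu').of_le ?_)
    exact_mod_cast Nat.le_add_left 2 k
  all_goals
    refine IsBigO.of_bound 1 (hr0.mono fun u' h => ?_)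
    have hpos : 0 < ‖u' - a‖ := (norm_nonneg _).lt_of_ne' h
    set A := ‖f a u' / ‖u' - a‖ ^ (k + 2)‖ with hA
    set B := fun i => ‖D1 i f a u' / ‖u' - a‖ ^ (k + 1)‖ with hB
    set C := fun i j => ‖D1 i (D1 j f) a u' / ‖u' - a‖ ^ k‖ with hC
    have hA0 : 0 ≤ A := norm_nonneg _
    have hB0 : 0 ≤ ∑ i, B i := Finset.sum_nonneg fun i _ => norm_nonneg _
    have hC0 : 0 ≤ ∑ i, ∑ j, C i j := Finset.sum_nonneg fun i _ =>
      Finset.sum_nonneg fun j _ => norm_nonneg _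
    rw [one_mul]
    simp only [norm_mul, norm_pow, norm_norm]
    rw [Real.norm_eq_abs (A + ∑ i, B i + ∑ i, ∑ j, C i j), abs_of_nonneg (by positivity)]
  · have e : ‖f a u'‖ = A * ‖u' - a‖ ^ k * ‖u' - a‖ ^ 2 := by
      rw [hA, norm_div, norm_pow, norm_norm]; field_simp; ring
    rw [e]
    gcongr
    linarith
  · have e : ‖D1 i f a u'‖ = B i * ‖u' - a‖ ^ k * ‖u' - a‖ := by
      simp only [hB, norm_div, norm_pow, norm_norm]; field_simp; ring
    rw [e]
    gcongr
    have := Finset.single_le_sum (f := B) (fun i _ => norm_nonneg _) (Finset.mem_univ i)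
    linarith
  · have e : ‖D1 i (D1 j f) a u'‖ = C i j * ‖u' - a‖ ^ k := by
      simp only [hC, norm_div, norm_pow, norm_norm]; field_simp
    rw [e]
    gcongr
    have h3 := Finset.single_le_sum (f := C i) (fun i _ => norm_nonneg _) (Finset.mem_univ j)
    have h4 := Finset.single_le_sum (f := fun i => ∑ j, C i j)
      (fun i _ => Finset.sum_nonneg fun j _ => norm_nonneg _) (Finset.mem_univ i)
    linarith

/-- The third derivative improves `o(r²)` to `O(r³)`. This whole power of `r` is needed to absorb a
logarithm. -/
theorem Flat.jetO_of_reg (hΩ : IsOpen Ω) (hf : Flat Ω 2 f) (hf' : Reg Ω 3 f) (ha : a ∈ Ω)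
    (hl : l ≤ 𝓝 a) : JetO l a (fun u' => ‖u' - a‖) f := by
  have key : ∀ {h : E4 → E4 → ℝ} {k : ℕ}, Flat Ω k h → Reg Ω (k + 1 : ℕ) h →
      h a =O[l] fun u' => ‖u' - a‖ ^ (k + 1) := by
    intro h k h1 h2
    obtain ⟨K, δ, hδ, h⟩ := exists_ball_norm_le_of_flat hΩ h1 h2 ha
    refine IsBigO.of_bound K ?_
    filter_upwards [hl (Metric.ball_mem_nhds a hδ)] with u' hu'
    rw [norm_pow, norm_norm, norm_sub_rev u' a]
    exact h a (Metric.mem_ball_self hδ) u' hu'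
  have hD := fun i => hf'.D1 (m := 2) hΩ (by norm_num) i
  have hDD := fun i j => (hD j).D1 (m := 1) hΩ (by norm_num) i
  refine ⟨?_, ?_, fun i => ?_, fun i j => ?_⟩
  · exact hl (Filter.eventually_of_mem (hΩ.mem_nhds ha) fun u' hu' =>
      hf.reg.contDiffAt_left hΩ ha hu')
  · exact (key hf (by exact_mod_cast hf')).congr_right fun u' => by ring
  · exact (key (hf.2.2 i) (by exact_mod_cast hD i)).congr_right fun u' => by ring
  · exact (key ((hf.2.2 j).2.2 i) (by exact_mod_cast hDD i j)).congr_right fun u' => by ring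

end Growth

/-! ### The difference of two singular parts -/

section SingularPart

open Asymptotics

variable {l : Filter E4} {a : E4} {f g : E4 → E4 → ℝ}

/-- The second-order jet of `f(·, u')` at `a` tends to zero as `u' → a` along `l`. -/
def Negligible (l : Filter E4) (a : E4) (f : E4 → E4 → ℝ) : Prop :=
  ∃ η : E4 → ℝ, Tendsto η l (𝓝 0) ∧ JetO l a η f

theorem Negligible.add (hf : Negligible l a f) (hg : Negligible l a g) :
    Negligible l a fun u u' => f u u' + g u u' := by
  obtain ⟨η, h1, h2⟩ := hf
  obtain ⟨θ, h3, h4⟩ := hg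
  refine ⟨fun u' => |η u'| + |θ u'|, by simpa using h1.abs.add h3.abs, (h2.mono ?_).add (h4.mono ?_)⟩
  · refine IsBigO.of_bound 1 (Eventually.of_forall fun u' => ?_)
    rw [one_mul, Real.norm_eq_abs, Real.norm_eq_abs, abs_of_nonneg (show 0 ≤ |η u'| + |θ u'| by positivity)]
    linarith [abs_nonneg (θ u')]
  · refine IsBigO.of_bound 1 (Eventually.of_forall fun u' => ?_)
    rw [one_mul, Real.norm_eq_abs, Real.norm_eq_abs, abs_of_nonneg (show 0 ≤ |η u'| + |θ u'| by positivity)]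
    linarith [abs_nonneg (η u')]

theorem Negligible.congr (hf : Negligible l a f)
    (h : ∀ᶠ u' in l, (fun y => g y u') =ᶠ[𝓝 a] fun y => f y u') : Negligible l a g := by
  obtain ⟨η, h1, h2⟩ := hf
  exact ⟨η, h1, h2.congr h⟩

theorem tendsto_norm_sub (hl : l ≤ 𝓝 a) : Tendsto (fun u' => ‖u' - a‖) l (𝓝 0) := by
  have : Continuous fun u' : E4 => ‖u' - a‖ := by fun_prop
  simpa using (this.tendsto a).mono_left hl

/-- The lower bound gives `r ≤ c^(-1/2) |s|^(1/2)`, and `|s|^(1/2) log|s| → 0`. -/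
theorem tendsto_norm_mul_log {s : E4 → ℝ} {c : ℝ} (hc : 0 < c) (hs : Tendsto s l (𝓝 0))
    (hlow : ∀ᶠ u' in l, c * ‖u' - a‖ ^ 2 ≤ |s u'|) (hs0 : ∀ᶠ u' in l, s u' ≠ 0) (hl : l ≤ 𝓝 a) :
    Tendsto (fun u' => ‖u' - a‖ * (1 + |Real.log (s u')|)) l (𝓝 0) := by
  have habs : Tendsto (fun u' => |s u'|) l (𝓝[>] 0) :=
    tendsto_nhdsWithin_iff.2 ⟨by simpa using hs.abs, hs0.mono fun u' h => abs_pos.2 h⟩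
  have h1 := ((tendsto_log_mul_rpow_nhdsGT_zero (r := 1 / 2) (by norm_num)).comp habs).norm
  have h2 := (h1.const_mul (√(c⁻¹)))
  simp only [norm_zero, mul_zero] at h2
  have h3 := (tendsto_norm_sub hl).add h2
  rw [add_zero] at h3
  refine squeeze_zero' (Eventually.of_forall fun u' => by positivity) ?_ h3
  filter_upwards [hlow] with u' h
  rw [mul_add, mul_one]
  refine add_le_add le_rfl ?_
  have hr : ‖u' - a‖ ≤ √(c⁻¹) * √|s u'| := by
    rw [← Real.sqrt_mul (by positivity)]
    refine Real.le_sqrt_of_sq_le ?_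
    rw [inv_mul_eq_div, le_div_iff₀ hc]
    linarith
  simp only [Function.comp_apply, Real.log_abs, ← Real.sqrt_eq_rpow, norm_mul, Real.norm_eq_abs]
  rw [abs_of_nonneg (Real.sqrt_nonneg _)]
  calc _ ≤ √(c⁻¹) * √|s u'| * |Real.log (s u')| := by gcongr
    _ = _ := by ring

variable {Ω : Set E4} {S St U Ut V Vt : E4 → E4 → ℝ} {c : ℝ}

theorem eventually_sub_le (hΩ : IsOpen Ω) (ha : a ∈ Ω) (hl : l ≤ 𝓝 a)
    (he : Flat Ω 6 fun u u' => St u u' - S u u') (hc : 0 < c) :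
    ∀ᶠ u' in l, |St a u' - S a u'| ≤ c / 2 * ‖u' - a‖ ^ 2 := by
  have := ((he.of_le (l := 2) (by norm_num)).isLittleO hΩ ha hl).def (half_pos hc)
  simpa using this

/-- The difference of two singular parts, the second of which approximates the first to orders
six, four and two, has a second-order jet that vanishes in the coincidence limit. -/
theorem negligible_sub (hΩ : IsOpen Ω) (ha : a ∈ Ω) (hl : l ≤ 𝓝 a) (hne : ∀ᶠ u' in l, u' ≠ a)
    (hc : 0 < c) (hlow : ∀ᶠ u' in l, c * ‖u' - a‖ ^ 2 ≤ |S a u'|)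
    (hS : JetO l a (fun _ => 1) S) (he : Flat Ω 6 fun u u' => St u u' - S u u')
    (hU : Reg Ω 2 U) (heU : Flat Ω 4 fun u u' => Ut u u' - U u u')
    (hV : Reg Ω 2 V) (heV : Flat Ω 2 fun u u' => Vt u u' - V u u')
    (heV3 : Reg Ω 3 fun u u' => Vt u u' - V u u') (L : ℝ) :
    Negligible l a fun u u' => U u u' / S u u' - Ut u u' / St u u'
      + (V u u' * (Real.log (S u u') - L) - Vt u u' * (Real.log (St u u') - L)) := by
  have hr0 : ∀ᶠ u' in l, ‖u' - a‖ ≠ 0 :=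
    hne.mono fun u' h => (norm_pos_iff.2 (sub_ne_zero.2 h)).ne'
  have hr := tendsto_norm_sub hl
  obtain ⟨η, hη, Je⟩ := he.jetO hΩ ha hl hne
  obtain ⟨θ, hθ, JeU⟩ := heU.jetO hΩ ha hl hne
  have JeV := heV.jetO_of_reg hΩ heV3 ha hl
  have JU := hU.jetO hΩ ha hl hne
  have JV := hV.jetO hΩ ha hl hne
  have JSt : JetO l a (fun _ => 1) St := by
    have h1 : Tendsto (fun u' => η u' * ‖u' - a‖ ^ 4) l (𝓝 0) := by simpa using hη.mul (hr.pow 4)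
    refine (hS.add (Je.mono (h1.isBigO_one ℝ))).congr (Eventually.of_forall fun u' => ?_)
    exact Eventually.of_forall fun y => by simp
  -- Since `St - S` is eventually at most `c/2 r²`, half of the lower bound survives for `St`.
  have hlowt : ∀ᶠ u' in l, c / 2 * ‖u' - a‖ ^ 2 ≤ |St a u'| := by
    filter_upwards [hlow, eventually_sub_le hΩ ha hl he hc] with u' h1 h2
    have := abs_sub_abs_le_abs_sub (S a u') (St a u')
    rw [abs_sub_comm] at this
    linarith
  have hc2 := half_pos hc
  have hS0 := ne_zero_of_lower hc hlow hne
  have hSt0 := ne_zero_of_lower hc2 hlowt hne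
  have Jinv := hS.inv hc hlow hne
  have Jinvt := JSt.inv hc2 hlowt hne
  -- Weights: `η r⁴` for the difference, `r⁻⁴` for `1/S`, and `r²` from the product.
  have Jq : JetO l a (fun u' => η u' * ‖u' - a‖ ^ 2)
      fun u u' => (St u u' - S u u') * (S u u')⁻¹ := by
    refine (Je.mul Jinv).mono (EventuallyEq.isBigO ?_)
    filter_upwards [hr0] with u' h
    field_simp
  have hη4 : Tendsto (fun u' => η u' * ‖u' - a‖ ^ 2 * ‖u' - a‖ ^ 2) l (𝓝 0) := by
    simpa using (hη.mul (hr.pow 2)).mul (hr.pow 2)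
  -- With `e = St - S`, the difference is split as `U e/(S St) - (Ut - U)/St - V log(1 + e/S) - (Vt
  -- - V) log St + L (Vt - V)`. In this first term the weights `r⁻²`, `η r²` and `r⁻⁴`, with `r²`
  -- from each of the two products, give exactly `η`: order six is just enough.
  have N1 : Negligible l a fun u u' =>
      U u u' * ((St u u' - S u u') * (S u u')⁻¹) * (St u u')⁻¹ := by
    refine ⟨η, hη, ((JU.mul Jq).mul Jinvt).mono (EventuallyEq.isBigO ?_)⟩
    filter_upwards [hr0] with u' h
    field_simp
  -- Order four is just enough: `θ r²` times `r⁻⁴` times `r²`.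
  have N2 : Negligible l a fun u u' => -1 * ((Ut u u' - U u u') * (St u u')⁻¹) := by
    refine ⟨θ, hθ, ((JeU.mul Jinvt).mono (EventuallyEq.isBigO ?_)).const_mul (-1)⟩
    filter_upwards [hr0] with u' h
    field_simp
  have N3 : Negligible l a fun u u' =>
      -1 * (V u u' * Real.log (1 + (St u u' - S u u') * (S u u')⁻¹)) := by
    refine ⟨fun u' => η u' * ‖u' - a‖ ^ 2, by simpa using hη.mul (hr.pow 2),
      ((JV.mul (Jq.log_one_add hη4)).mono (EventuallyEq.isBigO ?_)).const_mul (-1)⟩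
    filter_upwards [hr0] with u' h
    field_simp
  -- Only here does the logarithm itself appear; the weight is `r (1 + |log St|)`, the factor `r`
  -- being due to the third derivative of `Vt - V`.
  have N4 : Negligible l a fun u u' => -1 * ((Vt u u' - V u u') * Real.log (St u u')) := by
    have hst : Tendsto (St a) l (𝓝 0) := JSt.zero.trans_tendsto (by simpa using hr.pow 2)
    refine ⟨_, tendsto_norm_mul_log hc2 hst hlowt hSt0 hl,
      ((JeV.mul (JSt.log hc2 hlowt hne)).mono (EventuallyEq.isBigO ?_)).const_mul (-1)⟩
    filter_upwards [hr0] with u' h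
    field_simp
  have N5 : Negligible l a fun u u' => L * (Vt u u' - V u u') :=
    ⟨_, hr, JeV.const_mul L⟩
  refine ((((N1.add N2).add N3).add N4).add N5).congr ?_
  filter_upwards [hS.smooth, JSt.smooth, hS0, hSt0] with u' h1 h2 h3 h4
  filter_upwards [h1.continuousAt.eventually_ne h3, h2.continuousAt.eventually_ne h4] with y h5 h6
  have hlog : Real.log (1 + (St y u' - S y u') * (S y u')⁻¹) =
      Real.log (St y u') - Real.log (S y u') := by
    rw [← Real.log_div h6 h5]
    congr 1
    field_simp
    ring
  rw [hlog]
  field_simp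
  ring

end SingularPart

/-! ### The singular part at non-null separation -/

section NonNull

variable {X : Type*}

/-- The multiple of `π` that is the limit of the argument of `S_ε`. -/
def argSign (T : X → ℝ) (S : X → X → ℝ) (x x' : X) : ℝ :=
  if 0 < S x x' then 0 else if T x' < T x then 1 else -1

/-- The imaginary part of `S_ε` has the sign of `T(x) - T(x')`, so `S_ε/ℓ²` approaches the cut from
above or from below, where the principal logarithm tends to `log|·| ± iπ`. No absolute value is
written because `Real.log` ignores the sign of its argument. -/
theorem hadamardH_of_neg (T : X → ℝ) {ℓ : ℝ} (hℓ : 0 < ℓ) (S U V : X → X → ℝ) {x x' : X}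
    (hS : S x x' < 0) (hT : T x ≠ T x') :
    hadamardH T ℓ S U V x x' = 1 / (8 * (Real.pi : ℂ) ^ 2) * ((U x x' : ℂ) / (S x x' : ℂ)
      + (V x x' : ℂ) * ((Real.log (S x x' / ℓ ^ 2) : ℝ)
        + (argSign T S x x' : ℂ) * (Real.pi * Complex.I))) := by
  apply Tendsto.limUnder_eq
  set Z : ℝ → ℂ := fun ε => (S x x' : ℂ) + 2 * Complex.I * ε * ((T x : ℂ) - T x') + (ε : ℂ) ^ 2
  have hc : Tendsto Z (𝓝[>] (0 : ℝ)) (𝓝 (S x x' : ℂ)) := by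
    have : Continuous Z := by fun_prop
    simpa [Z] using (this.tendsto 0).mono_left nhdsWithin_le_nhds
  have hS0 : (S x x' : ℂ) ≠ 0 := by exact_mod_cast hS.ne
  have hq : S x x' / ℓ ^ 2 < 0 := div_neg_of_neg_of_pos hS (by positivity)
  have hcast : (S x x' : ℂ) / (ℓ : ℂ) ^ 2 = ((S x x' / ℓ ^ 2 : ℝ) : ℂ) := by push_cast; rfl
  have hre : ((S x x' : ℂ) / (ℓ : ℂ) ^ 2).re < 0 := by rw [hcast, Complex.ofReal_re]; exact hq
  have him : ((S x x' : ℂ) / (ℓ : ℂ) ^ 2).im = 0 := by rw [hcast, Complex.ofReal_im]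
  have hnorm : Real.log ‖(S x x' : ℂ) / (ℓ : ℂ) ^ 2‖ = Real.log (S x x' / ℓ ^ 2) := by
    rw [hcast, Complex.norm_real, Real.norm_eq_abs, Real.log_abs]
  have hZim : ∀ ε : ℝ, (Z ε / (ℓ : ℂ) ^ 2).im = 2 * ε * (T x - T x') / ℓ ^ 2 := by
    intro ε
    have h1 : Z ε / (ℓ : ℂ) ^ 2 = (((S x x' + ε ^ 2) / ℓ ^ 2 : ℝ) : ℂ)
        + ((2 * ε * (T x - T x') / ℓ ^ 2 : ℝ) : ℂ) * Complex.I := by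
      simp only [Z]; push_cast; ring
    rw [h1, Complex.add_im, Complex.ofReal_im, Complex.im_ofReal_mul, Complex.I_im]
    ring
  have hlog : Tendsto (fun ε => Complex.log (Z ε / (ℓ : ℂ) ^ 2)) (𝓝[>] (0 : ℝ))
      (𝓝 ((Real.log (S x x' / ℓ ^ 2) : ℝ)
        + (argSign T S x x' : ℂ) * (Real.pi * Complex.I))) := by
    have hz := hc.div_const ((ℓ : ℂ) ^ 2)
    rcases lt_or_gt_of_ne hT with h | h
    · have h1 := Complex.tendsto_log_nhdsWithin_im_neg_of_re_neg_of_im_zero hre him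
      rw [hnorm] at h1
      have h2 : argSign T S x x' = -1 := by simp [argSign, hS.not_gt, h.not_gt]
      rw [h2]
      have h3 : ((Real.log (S x x' / ℓ ^ 2) : ℝ) : ℂ) + ((-1 : ℝ) : ℂ) * (Real.pi * Complex.I) =
          (Real.log (S x x' / ℓ ^ 2) : ℝ) - Real.pi * Complex.I := by push_cast; ring
      rw [h3]
      refine h1.comp (tendsto_nhdsWithin_iff.2 ⟨hz, ?_⟩)
      filter_upwards [self_mem_nhdsWithin] with ε hε
      have hε' : (0 : ℝ) < ε := hε
      change (Z ε / (ℓ : ℂ) ^ 2).im < 0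
      rw [hZim]
      refine div_neg_of_neg_of_pos (mul_neg_of_pos_of_neg (by positivity) (by linarith))
        (by positivity)
    · have h1 := (Complex.continuousWithinAt_log_of_re_neg_of_im_zero hre him).tendsto
      have h2 : argSign T S x x' = 1 := by simp [argSign, hS.not_gt, h]
      have h3 : Complex.log ((S x x' : ℂ) / (ℓ : ℂ) ^ 2) = ((Real.log (S x x' / ℓ ^ 2) : ℝ) : ℂ)
          + ((1 : ℝ) : ℂ) * (Real.pi * Complex.I) := by
        rw [Complex.log, hnorm, hcast, Complex.arg_ofReal_of_neg hq]
        push_cast; ring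
      rw [h2, ← h3]
      refine h1.comp (tendsto_nhdsWithin_iff.2 ⟨hz, ?_⟩)
      filter_upwards [self_mem_nhdsWithin] with ε hε
      have hε' : (0 : ℝ) < ε := hε
      change 0 ≤ (Z ε / (ℓ : ℂ) ^ 2).im
      rw [hZim]
      have : 0 < T x - T x' := by linarith
      positivity
  exact ((tendsto_const_nhds.div hc hS0).add (tendsto_const_nhds.mul hlog)).const_mul _

/-- Both signs of `S` in one formula: two real functions times fixed complex constants. The growth
estimates are then needed for real functions only. -/
theorem hadamardH_eq (T : X → ℝ) {ℓ : ℝ} (hℓ : 0 < ℓ) (S U V : X → X → ℝ) {x x' : X}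
    (hS : S x x' ≠ 0) (hT : S x x' < 0 → T x ≠ T x') :
    hadamardH T ℓ S U V x x' =
      ((U x x' / S x x' + V x x' * (Real.log (S x x') - Real.log (ℓ ^ 2)) : ℝ) : ℂ)
          * (1 / (8 * (Real.pi : ℂ) ^ 2))
        + ((V x x' * argSign T S x x' : ℝ) : ℂ)
          * (1 / (8 * (Real.pi : ℂ) ^ 2) * (Real.pi * Complex.I)) := by
  have hlog : Real.log (S x x') - Real.log (ℓ ^ 2) = Real.log (S x x' / ℓ ^ 2) :=
    (Real.log_div hS (by positivity)).symm
  rw [hlog]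
  rcases lt_or_gt_of_ne hS with h | h
  · rw [hadamardH_of_neg T hℓ S U V h (hT h)]
    push_cast
    ring
  · rw [hadamardH_of_pos T hℓ S U V h]
    have : argSign T S x x' = 0 := by simp [argSign, h]
    rw [this]
    push_cast
    ring

end NonNull

/-! ### Spacetimes in coordinates -/

section Charts

variable {M : Type*} [TopologicalSpace M] [ChartedSpace E4 M]
variable {g : LorentzMetric M} {φ : OpenPartialHomeomorph M E4} {D : Set M}

theorem mdifferentiable_of_mem_maximalAtlas [IsManifold 𝓘(ℝ, E4) ∞ M]
    (hφ : φ ∈ IsManifold.maximalAtlas 𝓘(ℝ, E4) ∞ M) :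
    φ.MDifferentiable 𝓘(ℝ, E4) 𝓘(ℝ, E4) :=
  ⟨(contMDiffOn_of_mem_maximalAtlas hφ).mdifferentiableOn (by simp),
    (contMDiffOn_symm_of_mem_maximalAtlas hφ).mdifferentiableOn (by simp)⟩

theorem LorentzMetric.val_symm (g : LorentzMetric M) (x : M) (v w : TangentSpace 𝓘(ℝ, E4) x) :
    g.val x v w = g.val x w v := by
  obtain ⟨b, hb⟩ := g.signature x
  have : g.val x = (g.val x).flip := by
    refine b.ext fun i => b.ext fun j => ?_
    rw [LinearMap.flip_apply, hb, hb]
    by_cases h : i = j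
    · subst h; rfl
    · rw [if_neg h, if_neg (Ne.symm h)]
  exact LinearMap.congr_fun₂ this v w

/-- The metric in an orthonormal basis. -/
theorem LorentzMetric.exists_coords (g : LorentzMetric M) (x : M) :
    ∃ b : Module.Basis (Fin 4) ℝ (TangentSpace 𝓘(ℝ, E4) x), ∀ v w, g.val x v w =
      -(b.repr v 0 * b.repr w 0) + b.repr v 1 * b.repr w 1 + b.repr v 2 * b.repr w 2
        + b.repr v 3 * b.repr w 3 := by
  obtain ⟨b, hb⟩ := g.signature x
  refine ⟨b, fun v w => ?_⟩
  conv_lhs => rw [← b.sum_repr v, ← b.sum_repr w]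
  simp only [Fin.sum_univ_four, map_add, map_smul, LinearMap.add_apply, LinearMap.smul_apply,
    smul_eq_mul]
  simp only [hb]
  simp
  ring

theorem LorentzMetric.nondegenerate (g : LorentzMetric M) {x : M} {v : TangentSpace 𝓘(ℝ, E4) x}
    (h : ∀ w, g.val x w v = 0) : v = 0 := by
  obtain ⟨b, hb⟩ := g.exists_coords x
  refine b.repr.map_eq_zero_iff.1 (Finsupp.ext fun i => ?_)
  have := h (b i)
  rw [hb] at this
  fin_cases i <;> simpa [Finsupp.single_apply] using this

/-- The reversed Cauchy–Schwarz argument: orthogonality would make the product of the time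
components equal to the spatial inner product, which is too small when both vectors are timelike. -/
theorem LorentzMetric.val_ne_zero_of_timelike (g : LorentzMetric M) {x : M}
    {v w : TangentSpace 𝓘(ℝ, E4) x} (hv : g.val x v v < 0) (hw : g.val x w w < 0) :
    g.val x v w ≠ 0 := by
  obtain ⟨b, hb⟩ := g.exists_coords x
  rw [hb] at hv hw ⊢
  generalize b.repr v 0 = v0 at *
  generalize b.repr v 1 = v1 at *
  generalize b.repr v 2 = v2 at *
  generalize b.repr v 3 = v3 at *
  generalize b.repr w 0 = w0 at *
  generalize b.repr w 1 = w1 at *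
  generalize b.repr w 2 = w2 at *
  generalize b.repr w 3 = w3 at *
  intro h
  have h1 : v1 * w1 + v2 * w2 + v3 * w3 = v0 * w0 := by linarith
  have h2 : (v0 * w0) ^ 2 ≤ (v1 * v1 + v2 * v2 + v3 * v3) * (w1 * w1 + w2 * w2 + w3 * w3) := by
    rw [← h1]
    nlinarith [sq_nonneg (v1 * w2 - v2 * w1), sq_nonneg (v1 * w3 - v3 * w1),
      sq_nonneg (v2 * w3 - v3 * w2)]
  have h3 : (v1 * v1 + v2 * v2 + v3 * v3) * (w1 * w1 + w2 * w2 + w3 * w3) <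
      (v0 * v0) * (w0 * w0) := by
    apply mul_lt_mul'' (by linarith) (by linarith)
    · nlinarith [mul_self_nonneg v1, mul_self_nonneg v2, mul_self_nonneg v3]
    · nlinarith [mul_self_nonneg w1, mul_self_nonneg w2, mul_self_nonneg w3]
  nlinarith

theorem LorentzMetric.coord_form (g : LorentzMetric M) (φ : OpenPartialHomeomorph M E4)
    (u v w : E4) : ∑ i, ∑ j, g.coord φ u i j * v i * w j =
      g.val (φ.symm u) (mfderiv 𝓘(ℝ, E4) 𝓘(ℝ, E4) φ.symm u v)
        (mfderiv 𝓘(ℝ, E4) 𝓘(ℝ, E4) φ.symm u w) := by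
  have key : ∀ L : E4 →ₗ[ℝ] E4 →ₗ[ℝ] ℝ, L v w = ∑ i, ∑ j,
      L (EuclideanSpace.single i 1) (EuclideanSpace.single j 1) * v i * w j := by
    intro L
    conv_lhs => rw [sum_smul_single v, sum_smul_single w]
    simp only [map_sum, LinearMap.sum_apply, map_smul, LinearMap.smul_apply, smul_eq_mul,
      Finset.mul_sum]
    rw [Finset.sum_comm]
    exact Finset.sum_congr rfl fun i _ => Finset.sum_congr rfl fun j _ => by ring
  let A : E4 →ₗ[ℝ] TangentSpace 𝓘(ℝ, E4) (φ.symm u) :=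
    (mfderiv 𝓘(ℝ, E4) 𝓘(ℝ, E4) φ.symm u).toLinearMap
  exact (key ((g.val (φ.symm u)).compl₁₂ A A)).symm

variable [IsManifold 𝓘(ℝ, E4) ∞ M]

theorem mfderiv_symm_bijective (hφ : φ ∈ IsManifold.maximalAtlas 𝓘(ℝ, E4) ∞ M) {u : E4}
    (hu : u ∈ φ.target) : Function.Bijective (mfderiv 𝓘(ℝ, E4) 𝓘(ℝ, E4) φ.symm u) :=
  (mdifferentiable_of_mem_maximalAtlas hφ).symm.mfderiv_bijective hu

theorem coord_det_ne_zero (hφ : φ ∈ IsManifold.maximalAtlas 𝓘(ℝ, E4) ∞ M) {u : E4}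
    (hu : u ∈ φ.target) : (g.coord φ u).det ≠ 0 := by
  intro h
  obtain ⟨v, hv, hv0⟩ := Matrix.exists_mulVec_eq_zero_iff.2 h
  have hb := mfderiv_symm_bijective hφ hu
  set v' : E4 := WithLp.toLp 2 v
  have h1 : mfderiv 𝓘(ℝ, E4) 𝓘(ℝ, E4) φ.symm u v' = 0 := by
    refine g.nondegenerate fun w => ?_
    obtain ⟨w', rfl⟩ : ∃ w' : E4, mfderiv 𝓘(ℝ, E4) 𝓘(ℝ, E4) φ.symm u w' = w := hb.2 w
    have := g.coord_form φ u w' v'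
    rw [← this]
    refine Finset.sum_eq_zero fun i _ => ?_
    have h2 := congrFun hv0 i
    rw [Matrix.mulVec, dotProduct] at h2
    calc _ = w' i * ∑ j, g.coord φ u i j * v j := by
          rw [Finset.mul_sum]
          exact Finset.sum_congr rfl fun j _ => by simp only [v']; ring
      _ = 0 := by rw [h2]; simp
  have h3 : v' = 0 := hb.1 (h1.trans (map_zero _).symm)
  exact hv (by simpa [v'] using h3)

theorem isNormal (hφ : φ ∈ IsManifold.maximalAtlas 𝓘(ℝ, E4) ∞ M) (hD : IsConvexNormal g φ D) :
    IsNormal (g.coord φ) (φ '' D) := by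
  have hsub : φ '' D ⊆ φ.target := by
    rintro _ ⟨x, hx, rfl⟩
    exact φ.map_source (hD.subset_source hx)
  refine ⟨φ.isOpen_image_of_subset_source hD.isOpen hD.subset_source,
    fun i j => (g.smooth φ hφ i j).mono hsub, fun u _ i j => g.val_symm _ _ _,
    fun u hu => coord_det_ne_zero hφ (hsub hu), hD.exists_geodesic, hD.unique_geodesic,
    hD.smooth_velocity⟩

theorem exists_spacelike (g : LorentzMetric M) (hφ : φ ∈ IsManifold.maximalAtlas 𝓘(ℝ, E4) ∞ M)
    {u : E4} (hu : u ∈ φ.target) : ∃ v : E4, 0 < ∑ i, ∑ j, g.coord φ u i j * v i * v j := by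
  obtain ⟨b, hb⟩ := g.signature (φ.symm u)
  obtain ⟨v, hv⟩ := (mfderiv_symm_bijective hφ hu).2 (b 1)
  refine ⟨v, ?_⟩
  have := g.coord_form φ u v v
  rw [this, hv, hb]
  simp

/-! ### Time functions separate points that are timelike separated -/

/-- The time orientation is continuous as a section of the tangent bundle; the tangent map of the
chart makes its components continuous, as the intermediate value argument of `time_ne_of_timelike`
requires. -/
theorem continuousOn_coord_field {o : TimeOrientation g}
    (hφ : φ ∈ IsManifold.maximalAtlas 𝓘(ℝ, E4) ∞ M) :
    ContinuousOn (fun x => (mfderiv 𝓘(ℝ, E4) 𝓘(ℝ, E4) φ x (o.field x) : E4)) φ.source := by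
  have h1 := (contMDiffOn_of_mem_maximalAtlas hφ).continuousOn_tangentMapWithin (by simp)
    φ.open_source.uniqueMDiffOn
  have h2 := h1.comp o.cont.continuousOn (s := φ.source) fun x hx => hx
  have h3 := (tangentBundleModelSpaceHomeomorph 𝓘(ℝ, E4)).continuous.comp_continuousOn h2
  have h4 : ContinuousOn (fun x => ((tangentBundleModelSpaceHomeomorph 𝓘(ℝ, E4))
    (tangentMapWithin 𝓘(ℝ, E4) 𝓘(ℝ, E4) φ φ.source ⟨x, o.field x⟩)).2) φ.source :=
    continuous_snd.comp_continuousOn h3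
  refine h4.congr fun x hx => ?_
  have := mfderivWithin_of_isOpen (I := 𝓘(ℝ, E4)) (I' := 𝓘(ℝ, E4)) (f := φ) φ.open_source hx
  rw [← this]
  rfl

theorem contDiffOn_of_isGeodesic {G : E4 → Matrix (Fin 4) (Fin 4) ℝ} {Ω : Set E4} {c c' : ℝ → E4}
    (h : IsGeodesic G Ω c c') : ContDiffOn ℝ 1 c (Icc 0 1) := by
  have hu : UniqueDiffOn ℝ (Icc (0 : ℝ) 1) := uniqueDiffOn_Icc zero_lt_one
  rw [show (1 : WithTop ℕ∞) = 0 + 1 by simp, contDiffOn_succ_iff_derivWithin hu]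
  refine ⟨fun t ht => (h t ht).2.1.differentiableWithinAt, by simp, ?_⟩
  rw [contDiffOn_zero]
  have : ContinuousOn c' (Icc 0 1) := fun t ht => (h t ht).2.2.continuousWithinAt
  exact this.congr fun t ht => (h t ht).2.1.derivWithin (hu t ht)

theorem lt_of_future_geodesic {o : TimeOrientation g} {T : M → ℝ} (hT : IsTimeFunction g o T)
    (hφ : φ ∈ IsManifold.maximalAtlas 𝓘(ℝ, E4) ∞ M) (hD : IsConvexNormal g φ D) {c c' : ℝ → E4}
    (h : IsGeodesic (g.coord φ) (φ '' D) c c')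
    (hf : ∀ t ∈ Icc (0 : ℝ) 1, IsFutureCausal g o (φ.symm (c t))
      (mfderiv 𝓘(ℝ, E4) 𝓘(ℝ, E4) φ.symm (c t) (c' t))) :
    T (φ.symm (c 0)) < T (φ.symm (c 1)) := by
  have hsub : φ '' D ⊆ φ.target := by
    rintro _ ⟨x, hx, rfl⟩
    exact φ.map_source (hD.subset_source hx)
  have htar : ∀ t ∈ Icc (0 : ℝ) 1, c t ∈ φ.target := fun t ht => hsub (h t ht).1
  refine hT.2 0 1 (fun t => φ.symm (c t)) zero_lt_one ?_ fun t ht => ?_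
  · exact ((contMDiffOn_symm_of_mem_maximalAtlas hφ).of_le (show (1 : WithTop ℕ∞) ≤ ∞ by simp)).comp
      (contDiffOn_of_isGeodesic h).contMDiffOn htar
  · have h1 : HasMFDerivAt 𝓘(ℝ, E4) 𝓘(ℝ, E4) φ.symm (c t)
        (mfderiv 𝓘(ℝ, E4) 𝓘(ℝ, E4) φ.symm (c t)) :=
      ((mdifferentiable_of_mem_maximalAtlas hφ).mdifferentiableAt_symm (htar t ht)).hasMFDerivAt
    have h2 : HasMFDerivWithinAt 𝓘(ℝ, ℝ) 𝓘(ℝ, E4) c (Icc 0 1) t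
        (ContinuousLinearMap.toSpanSingleton ℝ (c' t)) :=
      (h t ht).2.1.hasFDerivWithinAt.hasMFDerivWithinAt
    have h3 := (h1.comp_hasMFDerivWithinAt t h2).mfderivWithin
      (uniqueDiffOn_Icc zero_lt_one t ht).uniqueMDiffWithinAt
    have h4 : mfderivWithin 𝓘(ℝ, ℝ) 𝓘(ℝ, E4) (fun t => φ.symm (c t)) (Icc 0 1) t (1 : ℝ) =
        mfderiv 𝓘(ℝ, E4) 𝓘(ℝ, E4) φ.symm (c t) (c' t) := by
      have h5 := congrArg (fun L : ℝ →L[ℝ] E4 => L 1) h3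
      exact h5.trans (congrArg (mfderiv 𝓘(ℝ, E4) 𝓘(ℝ, E4) φ.symm (c t)) (one_smul ℝ (c' t)))
    rw [h4]
    exact hf t ht

/-- The geodesic is timelike throughout by conservation of energy, so its product with the time
orientation never vanishes and keeps one sign. Either the geodesic or its reversal is therefore
future-directed, and `T` increases strictly along it. -/
theorem time_ne_of_timelike {o : TimeOrientation g} {T : M → ℝ} (hT : IsTimeFunction g o T)
    (hφ : φ ∈ IsManifold.maximalAtlas 𝓘(ℝ, E4) ∞ M) (hD : IsConvexNormal g φ D) {u u' : E4}
    (hu : u ∈ φ '' D) (hu' : u' ∈ φ '' D) (hlt : halfSqDist (g.coord φ) (φ '' D) u u' < 0) :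
    T (φ.symm u) ≠ T (φ.symm u') := by
  have hN := isNormal hφ hD
  have hsub : φ '' D ⊆ φ.target := by
    rintro _ ⟨x, hx, rfl⟩
    exact φ.map_source (hD.subset_source hx)
  obtain ⟨c, c', h, rfl, rfl⟩ := hN.exists_geodesic u hu u' hu'
  rw [hN.halfSqDist_eq h] at hlt
  have htl : ∀ t ∈ Icc (0 : ℝ) 1, ∑ i, ∑ j, g.coord φ (c t) i j * c' t i * c' t j < 0 := by
    intro t ht
    rw [hN.energy_const h ht]
    linarith
  set ō : E4 → E4 := fun u => mfderiv 𝓘(ℝ, E4) 𝓘(ℝ, E4) φ (φ.symm u) (o.field (φ.symm u))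
  have hō : ∀ u ∈ φ.target,
      mfderiv 𝓘(ℝ, E4) 𝓘(ℝ, E4) φ.symm u (ō u) = o.field (φ.symm u) := by
    intro u hu
    have h1 := (mdifferentiable_of_mem_maximalAtlas hφ).symm_comp_deriv (φ.map_target hu)
    rw [φ.right_inv hu] at h1
    exact congrArg (fun L => L (o.field (φ.symm u))) h1
  set s : ℝ → ℝ := fun t => ∑ i, ∑ j, g.coord φ (c t) i j * c' t i * ō (c t) j
  have hs : ∀ t ∈ Icc (0 : ℝ) 1, s t = g.val (φ.symm (c t))
      (mfderiv 𝓘(ℝ, E4) 𝓘(ℝ, E4) φ.symm (c t) (c' t)) (o.field (φ.symm (c t))) := by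
    intro t ht
    rw [← hō (c t) (hsub (h t ht).1)]
    exact g.coord_form φ (c t) (c' t) (ō (c t))
  have htl' : ∀ t ∈ Icc (0 : ℝ) 1, g.val (φ.symm (c t))
      (mfderiv 𝓘(ℝ, E4) 𝓘(ℝ, E4) φ.symm (c t) (c' t))
      (mfderiv 𝓘(ℝ, E4) 𝓘(ℝ, E4) φ.symm (c t) (c' t)) < 0 := by
    intro t ht
    have := htl t ht
    rwa [g.coord_form φ (c t) (c' t) (c' t)] at this
  have hs0 : ∀ t ∈ Icc (0 : ℝ) 1, s t ≠ 0 := by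
    intro t ht
    rw [hs t ht]
    exact g.val_ne_zero_of_timelike (htl' t ht) (o.timelike _)
  have hcc : ContinuousOn c (Icc 0 1) := fun t ht => (h t ht).2.1.continuousWithinAt
  have hcc' : ContinuousOn c' (Icc 0 1) := fun t ht => (h t ht).2.2.continuousWithinAt
  have hoc : ContinuousOn (fun t => ō (c t)) (Icc 0 1) :=
    (continuousOn_coord_field (o := o) hφ).comp (φ.continuousOn_symm.comp hcc
      fun t ht => hsub (h t ht).1) fun t ht => φ.map_target (hsub (h t ht).1)
  have hcomp : ∀ {f : ℝ → E4}, ContinuousOn f (Icc 0 1) → ∀ i,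
      ContinuousOn (fun t => f t i) (Icc 0 1) := fun hf i =>
    (EuclideanSpace.proj i : E4 →L[ℝ] ℝ).continuous.comp_continuousOn hf
  have hsc : ContinuousOn s (Icc 0 1) :=
    continuousOn_finsetSum _ fun i _ => continuousOn_finsetSum _ fun j _ =>
      (((hN.smooth i j).continuousOn.comp hcc fun t ht => (h t ht).1).mul (hcomp hcc' i)).mul
        (hcomp hoc j)
  have hne : ∀ t ∈ Icc (0 : ℝ) 1, mfderiv 𝓘(ℝ, E4) 𝓘(ℝ, E4) φ.symm (c t) (c' t) ≠ 0 := by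
    intro t ht h0
    have := htl' t ht
    rw [h0] at this
    simp at this
  have hsign : (∀ t ∈ Icc (0 : ℝ) 1, s t < 0) ∨ ∀ t ∈ Icc (0 : ℝ) 1, 0 < s t := by
    by_contra! hcon
    obtain ⟨⟨t₁, ht₁, h₁⟩, t₂, ht₂, h₂⟩ := hcon
    obtain ⟨t, ht, h0⟩ := isPreconnected_Icc.intermediate_value ht₂ ht₁ hsc ⟨h₂, h₁⟩
    exact hs0 t ht h0
  rcases hsign with hneg | hpos
  · refine (lt_of_future_geodesic hT hφ hD h fun t ht => ⟨hne t ht, (htl' t ht).le, ?_⟩).ne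
    rw [← hs t ht]
    exact hneg t ht
  · have hlt2 := lt_of_future_geodesic hT hφ hD h.reverse fun t ht => by
      have ht' : 1 - t ∈ Icc (0 : ℝ) 1 := ⟨by linarith [ht.2], by linarith [ht.1]⟩
      have e : mfderiv 𝓘(ℝ, E4) 𝓘(ℝ, E4) φ.symm (c (1 - t)) (-c' (1 - t)) =
          -mfderiv 𝓘(ℝ, E4) 𝓘(ℝ, E4) φ.symm (c (1 - t)) (c' (1 - t)) := map_neg _ _
      change IsFutureCausal g o (φ.symm (c (1 - t)))
        (mfderiv 𝓘(ℝ, E4) 𝓘(ℝ, E4) φ.symm (c (1 - t)) (-c' (1 - t)))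
      rw [e]
      refine ⟨neg_ne_zero.2 (hne _ ht'), ?_, ?_⟩
      · simpa using (htl' _ ht').le
      · have := hpos _ ht'
        rw [hs _ ht'] at this
        simpa using this
    simp only [sub_zero, sub_self] at hlt2
    exact hlt2.ne'

end Charts

/-! ### Symmetry of the Hadamard coefficients, and spacelike directions -/

section Symmetry

variable {G : E4 → Matrix (Fin 4) (Fin 4) ℝ} {Ω : Set E4}

/-- Exchanging the points transposes the matrix of mixed second derivatives; this gives the symmetry
of the van Vleck–Morette determinant. -/
theorem IsNormal.D1_D2_halfSqDist_symm (hN : IsNormal G Ω) {u u' : E4} (hu : u ∈ Ω) (hu' : u' ∈ Ω)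
    (i j : Fin 4) :
    D1 i (D2 j (halfSqDist G Ω)) u' u = D1 j (D2 i (halfSqDist G Ω)) u u' := by
  have h1 : (fun y => D2 j (halfSqDist G Ω) y u) =ᶠ[𝓝 u'] D1 j (halfSqDist G Ω) u := by
    filter_upwards [hN.isOpen.mem_nhds hu'] with y hy
    exact pd_congr (Filter.eventually_of_mem (hN.isOpen.mem_nhds hu) fun z hz =>
      hN.halfSqDist_symm hy hz) j
  have h2 : D1 i (D2 j (halfSqDist G Ω)) u' u = D2 i (D1 j (halfSqDist G Ω)) u u' :=
    pd_congr h1 i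
  rw [h2, D2_D1_comm hN.isOpen (hN.reg_halfSqDist.of_le two_le_infty) hu hu']

/-- On the geodesic leaving `u` with spacelike velocity `w`, the half squared distance to `u` is `t²
g(w, w)/2 > 0`, and the geodesic tends to `u`. -/
theorem IsNormal.mem_closure_spacelike (hN : IsNormal G Ω) {u w : E4} (hu : u ∈ Ω)
    (hw : 0 < ∑ i, ∑ j, G u i j * w i * w j) :
    u ∈ closure {y | y ∈ Ω ∧ 0 < halfSqDist G Ω y u} := by
  obtain ⟨ε, hε, c, c', rfl, rfl, h⟩ := hN.exists_local_geodesic hu w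
  have hc : Tendsto c (𝓝[>] 0) (𝓝 (c 0)) :=
    (h 0 ⟨le_rfl, hε⟩).2.1.continuousAt.tendsto.mono_left nhdsWithin_le_nhds
  refine mem_closure_of_tendsto hc ?_
  filter_upwards [Ioo_mem_nhdsGT hε] with t ht
  have ht' := h t ⟨ht.1.le, ht.2⟩
  refine ⟨ht'.1, ?_⟩
  rw [hN.halfSqDist_symm ht'.1 hu, halfSqDist, ht'.2.2.2]
  have e : ∑ i, ∑ j, G (c 0) i j * (t • c' 0) i * (t • c' 0) j =
      t ^ 2 * ∑ i, ∑ j, G (c 0) i j * c' 0 i * c' 0 j := by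
    simp only [Finset.mul_sum, PiLp.smul_apply, smul_eq_mul]
    exact Finset.sum_congr rfl fun i _ => Finset.sum_congr rfl fun j _ => by ring
  rw [e]
  have := ht.1
  positivity

variable {F : Type*} [NormedAddCommGroup F] [NormedSpace ℝ F]

/-- A function that vanishes on an open set has a vanishing second-order jet at the points of the
closure of this set. -/
theorem jet_eq_zero_of_mem_closure {s : Set E4} (hs : IsOpen s) {u : E4} (hu : u ∈ closure s)
    {f : E4 → F} (hf : ContDiffAt ℝ 2 f u) (h0 : ∀ y ∈ s, f y = 0) :
    (∀ i, pd i f u = 0) ∧ ∀ i j, pd i (pd j f) u = 0 := by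
  have hev : ∀ y ∈ s, f =ᶠ[𝓝 y] fun _ => 0 := fun y hy =>
    Filter.eventually_of_mem (hs.mem_nhds hy) h0
  have key : ∀ {k : E4 → F}, ContinuousAt k u → (∀ y ∈ s, k y = 0) → k u = 0 := by
    intro k hk hk0
    have : (𝓝[s] u).NeBot := mem_closure_iff_nhdsWithin_neBot.1 hu
    have h1 : Tendsto k (𝓝[s] u) (𝓝 (k u)) := hk.tendsto.mono_left nhdsWithin_le_nhds
    refine tendsto_nhds_unique h1 (tendsto_const_nhds.congr' ?_)
    filter_upwards [self_mem_nhdsWithin] with y hy using (hk0 y hy).symm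
  refine ⟨fun i => key (hf.pd (m := 0) (by norm_num) i).continuousAt fun y hy => ?_,
    fun i j => key (((hf.pd (m := 1) (by norm_num) j).pd (m := 0) (by norm_num)
      i).continuousAt) fun y hy => ?_⟩
  · rw [pd_congr (hev y hy), pd_const]
  · rw [pd_congr (pd_eventuallyEq (hev y hy) j), pd_pd_const]

/-- Along a curve with a non-null tangent, the half squared distance is of the order of the squared
Euclidean distance. -/
theorem IsNormal.eventually_lower_bound (hN : IsNormal G Ω) {u : E4} (hu : u ∈ Ω) {c : ℝ → E4}
    {w : E4} (hc : HasDerivWithinAt c w (Ici 0) 0) (hc0 : c 0 = u)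
    (hw : ∑ i, ∑ j, G u i j * w i * w j ≠ 0) :
    ∃ κ > 0, ∀ᶠ s in 𝓝[>] 0, κ * ‖c s - u‖ ^ 2 ≤ |halfSqDist G Ω u (c s)| ∧ c s ≠ u := by
  have hne : ∀ᶠ s : ℝ in 𝓝[>] 0, 0 < s := self_mem_nhdsWithin
  have hc' : HasDerivWithinAt c w (Ioi 0) 0 := hc.mono Ioi_subset_Ici_self
  have hv : ∀ i, Tendsto (fun s => s⁻¹ * vel G Ω i u (c s)) (𝓝[>] 0) (𝓝 (w i)) := by
    intro i
    have h1 : HasFDerivAt (vel G Ω i u) (fderiv ℝ (vel G Ω i u) u) (c 0) := by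
      rw [hc0]
      exact (((hN.reg_vel i).contDiffAt_right hN.isOpen hu hu).differentiableAt
        (by simp)).hasFDerivAt
    have h2 := h1.comp_hasDerivWithinAt 0 hc'
    rw [fderiv_eq_sum_pd] at h2
    have h3 : ∀ k, pd k (vel G Ω i u) u = if i = k then 1 else 0 := fun k => hN.D2_vel hu i k
    have h4 := hasDerivWithinAt_iff_tendsto_slope.1 h2
    simp only [h3] at h4
    have h5 : Ioi (0 : ℝ) \ {0} = Ioi 0 := by simp
    rw [h5] at h4
    have h6 : (∑ k, w k • (if i = k then (1 : ℝ) else 0)) = w i := by simp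
    rw [h6] at h4
    refine h4.congr fun s => ?_
    rw [slope, vsub_eq_sub, smul_eq_mul, sub_zero, Function.comp_apply, Function.comp_apply, hc0,
      hN.vel_diag hu, sub_zero]
  have hn : Tendsto (fun s => s⁻¹ * ‖c s - u‖) (𝓝[>] 0) (𝓝 ‖w‖) := by
    have h4 := (hasDerivWithinAt_iff_tendsto_slope.1 hc').norm
    have h5 : Ioi (0 : ℝ) \ {0} = Ioi 0 := by simp
    rw [h5] at h4
    refine h4.congr' ?_
    filter_upwards [hne] with s hs
    rw [slope, vsub_eq_sub, norm_smul, norm_inv, sub_zero, Real.norm_eq_abs, abs_of_pos hs, hc0]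
  set k := ∑ i, ∑ j, G u i j * w i * w j
  have hσ : Tendsto (fun s => s⁻¹ ^ 2 * halfSqDist G Ω u (c s)) (𝓝[>] 0) (𝓝 (1 / 2 * k)) := by
    have h1 : Tendsto (fun s => 1 / 2 * ∑ i, ∑ j, G u i j * (s⁻¹ * vel G Ω i u (c s)) *
        (s⁻¹ * vel G Ω j u (c s))) (𝓝[>] 0) (𝓝 (1 / 2 * k)) :=
      (tendsto_finsetSum _ fun i _ => tendsto_finsetSum _ fun j _ =>
        ((hv i).const_mul _).mul (hv j)).const_mul _
    refine h1.congr fun s => ?_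
    simp only [halfSqDist, vel, Finset.mul_sum]
    exact Finset.sum_congr rfl fun i _ => Finset.sum_congr rfl fun j _ => by ring
  have hk : 0 < |k| := abs_pos.2 hw
  have hσ' := hσ.abs
  rw [abs_mul, abs_of_pos (by norm_num : (0 : ℝ) < 1 / 2)] at hσ'
  have e1 := hσ'.eventually_const_lt (show 1 / 4 * |k| < 1 / 2 * |k| by linarith)
  have e2 := hn.eventually_lt_const (show ‖w‖ < ‖w‖ + 1 by linarith)
  have hB : 0 < ‖w‖ + 1 := by positivity
  -- As `s → 0`, `|Σ|/s²` tends to `|k|/2` and `‖c s - u‖/s` to `‖w‖`. The constant comes from the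
  -- weaker bounds `|k|/4` and `‖w‖ + 1`, the latter positive in any case.
  refine ⟨1 / 4 * |k| / (‖w‖ + 1) ^ 2, by positivity, ?_⟩
  filter_upwards [e1, e2, hne] with s h1 h2 hs
  have h3 : 1 / 4 * |k| * s ^ 2 < |halfSqDist G Ω u (c s)| := by
    rw [abs_mul, abs_of_pos (show 0 < s⁻¹ ^ 2 by positivity), inv_pow, inv_mul_eq_div,
      lt_div_iff₀ (by positivity)] at h1
    exact h1
  have h4 : ‖c s - u‖ < (‖w‖ + 1) * s := by
    rwa [inv_mul_eq_div, div_lt_iff₀ hs] at h2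
  constructor
  · have h5 : ‖c s - u‖ ^ 2 ≤ ((‖w‖ + 1) * s) ^ 2 := by gcongr
    calc 1 / 4 * |k| / (‖w‖ + 1) ^ 2 * ‖c s - u‖ ^ 2
        ≤ 1 / 4 * |k| / (‖w‖ + 1) ^ 2 * ((‖w‖ + 1) * s) ^ 2 := by gcongr
      _ = 1 / 4 * |k| * s ^ 2 := by field_simp
      _ ≤ _ := h3.le
  · intro h5
    rw [h5] at h3
    have h6 : halfSqDist G Ω u u = 0 := by
      have := fun i => hN.vel_diag hu i
      simp only [vel] at this
      simp [halfSqDist, this]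
    rw [h6, abs_zero] at h3
    have : 0 ≤ 1 / 4 * |k| * s ^ 2 := by positivity
    linarith

/-- `Σ` is quadratic in the velocity, which is `O(r)`; its gradient vanishes on the diagonal, and
its second derivatives are bounded. -/
theorem IsNormal.jetO_halfSqDist (hN : IsNormal G Ω) {u : E4} (hu : u ∈ Ω) {l : Filter E4}
    (hl : l ≤ 𝓝 u) : JetO l u (fun _ => 1) (halfSqDist G Ω) := by
  have hreg := hN.reg_halfSqDist
  have hO : ∀ {h : E4 → ℝ}, DifferentiableAt ℝ h u → h u = 0 → h =O[l] fun y => ‖y - u‖ := by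
    intro h hd h0
    have := (hd.isBigO_sub).mono hl
    simp only [h0, sub_zero] at this
    exact this.norm_right
  have hv : ∀ i, (vel G Ω i u) =O[l] fun y => ‖y - u‖ := fun i =>
    hO (((hN.reg_vel i).contDiffAt_right hN.isOpen hu hu).differentiableAt (by simp))
      (hN.vel_diag hu i)
  refine ⟨?_, ?_, fun i => ?_, fun i j => ?_⟩
  · exact hl (Filter.eventually_of_mem (hN.isOpen.mem_nhds hu) fun u' hu' =>
      (hreg.contDiffAt_left hN.isOpen hu hu').of_le two_le_infty)
  · refine Asymptotics.IsBigO.const_mul_left (Asymptotics.IsBigO.fun_sum fun i _ =>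
      Asymptotics.IsBigO.fun_sum fun j _ => ?_) _
    refine (((hv i).const_mul_left (G u i j)).mul (hv j)).congr_right fun y => by ring
  · refine (hO (((hreg.D1 (m := ∞) hN.isOpen (by simp) i).contDiffAt_right hN.isOpen hu
      hu).differentiableAt (by simp)) (hN.D1_halfSqDist_diag hu i)).congr_right fun y => by ring
  · exact ((((hreg.D1 (m := ∞) hN.isOpen (by simp) j).D1 (m := ∞) hN.isOpen
      (by simp) i).continuousAt_right hN.isOpen hu hu).tendsto.mono_left hl).isBigO_one ℝ

/-- The coincidence limits of `W + R c₁ + E c₂` are those of `W` if `R` and `E` are negligible. -/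
theorem tendsto_iterCov_two {l : Filter E4} {a : E4} (hΩ : IsOpen Ω) (ha : a ∈ Ω) (hl : l ≤ 𝓝 a)
    {f w : E4 → E4 → ℂ} {R E : E4 → E4 → ℝ} {c₁ c₂ : ℂ} (hw : Reg Ω 2 w) (hR : Negligible l a R)
    (hE : Negligible l a E)
    (hf : ∀ᶠ u' in l, (fun y => f y u') =ᶠ[𝓝 a] fun y => w y u' + R y u' • c₁ + E y u' • c₂) :
    Tendsto (f a) l (𝓝 (w a a)) ∧ ∀ i j,
      Tendsto (fun u' => iterCov G (fun y => f y u') 2 ![i, j] a) l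
        (𝓝 (iterCov G (fun y => w y a) 2 ![i, j] a)) := by
  obtain ⟨η, hη, JR⟩ := hR
  obtain ⟨θ, hθ, JE⟩ := hE
  obtain ⟨R0, R1, R2⟩ := JR.tendsto hl hη
  obtain ⟨E0, E1, E2⟩ := JE.tendsto hl hθ
  have hwc : ∀ᶠ u' in l, ContDiffAt ℝ 2 (fun y => w y u') a :=
    hl (Filter.eventually_of_mem (hΩ.mem_nhds ha) fun u' hu' => hw.contDiffAt_left hΩ ha hu')
  have comb : ∀ {p : E4 → ℂ} {q r : E4 → ℝ} {z : ℂ}, Tendsto p l (𝓝 z) → Tendsto q l (𝓝 0) →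
      Tendsto r l (𝓝 0) → Tendsto (fun u' => p u' + q u' • c₁ + r u' • c₂) l (𝓝 z) := by
    intro p q r z hp hq hr
    simpa using (hp.add (hq.smul_const c₁)).add (hr.smul_const c₂)
  have t0 : Tendsto (w a) l (𝓝 (w a a)) :=
    ((hw.of_le (m := 0) (by simp)).continuousAt_right hΩ ha ha).tendsto.mono_left hl
  have t1 : ∀ i, Tendsto (D1 i w a) l (𝓝 (D1 i w a a)) := fun i =>
    ((hw.D1 (m := 0) hΩ (by norm_num) i).continuousAt_right hΩ ha ha).tendsto.mono_left hl
  have t2 : ∀ i j, Tendsto (D1 i (D1 j w) a) l (𝓝 (D1 i (D1 j w) a a)) := fun i j =>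
    (((hw.D1 (m := 1) hΩ (by norm_num) j).D1 (m := 0) hΩ (by norm_num) i).continuousAt_right hΩ
      ha ha).tendsto.mono_left hl
  have p1 : ∀ i, ∀ᶠ u' in l, D1 i f a u' = D1 i w a u' + D1 i R a u' • c₁ + D1 i E a u' • c₂ := by
    intro i
    filter_upwards [hf, hwc, JR.smooth, JE.smooth] with u' h1 h2 h3 h4
    have d2 := h2.differentiableAt (by simp)
    have d3 := h3.differentiableAt (by simp)
    have d4 := h4.differentiableAt (by simp)
    have e1 := pd_congr h1 i
    rw [pd_add (d2.fun_add (d3.smul_const c₁)) (d4.smul_const c₂), pd_add d2 (d3.smul_const c₁),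
      pd_smul_const d3, pd_smul_const d4] at e1
    exact e1
  have p2 : ∀ i j, ∀ᶠ u' in l, D1 i (D1 j f) a u' =
      D1 i (D1 j w) a u' + D1 i (D1 j R) a u' • c₁ + D1 i (D1 j E) a u' • c₂ := by
    intro i j
    filter_upwards [hf, hwc, JR.smooth, JE.smooth] with u' h1 h2 h3 h4
    have e1 := pd_congr (pd_eventuallyEq h1 j) i
    have s3 : ContDiffAt ℝ 2 (fun y => R y u' • c₁) a := h3.smul contDiffAt_const
    have s4 : ContDiffAt ℝ 2 (fun y => E y u' • c₂) a := h4.smul contDiffAt_const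
    have s23 : ContDiffAt ℝ 2 (fun y => w y u' + R y u' • c₁) a := h2.add s3
    rw [pd_pd_add s23 s4, pd_pd_add h2 s3, pd_pd_smul_const h3, pd_pd_smul_const h4] at e1
    exact e1
  refine ⟨?_, fun i j => ?_⟩
  · refine (comb t0 R0 E0).congr' ?_
    filter_upwards [hf] with u' h1 using h1.self_of_nhds.symm
  · have h1 : Tendsto (D1 i (D1 j f) a) l (𝓝 (D1 i (D1 j w) a a)) :=
      (comb (t2 i j) (R2 i j) (E2 i j)).congr' ((p2 i j).mono fun u' h => h.symm)
    have h2 : ∀ c, Tendsto (D1 c f a) l (𝓝 (D1 c w a a)) := fun c =>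
      (comb (t1 c) (R1 c) (E1 c)).congr' ((p1 c).mono fun u' h => h.symm)
    simp only [iterCov_two]
    exact h1.sub (tendsto_finsetSum _ fun c _ => (h2 c).const_smul (christoffel G c i j a))

end Symmetry

/-! ### Bi-scalars in coordinates -/

section Pull

variable {M : Type*} [TopologicalSpace M] {φ : OpenPartialHomeomorph M E4} {D : Set M}

/-- The coordinate expression of a bi-scalar. -/
def pull {F : Type*} (φ : OpenPartialHomeomorph M E4) (A : M → M → F) (u u' : E4) : F :=
  A (φ.symm u) (φ.symm u')

theorem pull_apply {F : Type*} (A : M → M → F) {x x' : M} (hx : x ∈ φ.source)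
    (hx' : x' ∈ φ.source) :
    pull φ A (φ x) (φ x') = A x x' := by
  rw [pull, φ.left_inv hx, φ.left_inv hx']

/-- The coincidence limits of `IsApprox` run over the punctured neighbourhood, so they identify
values only because no point is isolated. -/
theorem nhdsNE_neBot {x : M} (hx : x ∈ φ.source) : (𝓝[≠] x).NeBot := by
  have h : Tendsto φ.symm (𝓝[≠] (φ x)) (𝓝[≠] x) := by
    refine tendsto_nhdsWithin_iff.2 ⟨?_, ?_⟩
    · have := φ.continuousAt_symm (φ.map_source hx)
      rw [ContinuousAt, φ.left_inv hx] at this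
      exact this.mono_left nhdsWithin_le_nhds
    · filter_upwards [self_mem_nhdsWithin,
        nhdsWithin_le_nhds (φ.open_target.mem_nhds (φ.map_source hx))] with u h1 h2 h3
      exact h1 (by rw [mem_singleton_iff, ← φ.right_inv h2, h3])
  exact h.neBot

theorem image_subset_target (hD : D ⊆ φ.source) : φ '' D ⊆ φ.target := by
  rintro _ ⟨x, hx, rfl⟩
  exact φ.map_source (hD hx)

variable [ChartedSpace E4 M] {g : LorentzMetric M}
variable {F : Type*} [NormedAddCommGroup F] [NormedSpace ℝ F]
theorem covD_eq_iterCov_pull (k : ℕ) (I : Fin k → Fin 4) (A : M → M → F) (x : M) {x' : M}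
    (hx' : x' ∈ φ.source) :
    covD g φ k I A x x' = iterCov (g.coord φ) (fun u => pull φ A u (φ x')) k I (φ x) := by
  simp only [covD, pull, φ.left_inv hx']

theorem pull_worldFn (hD : D ⊆ φ.source) : ∀ u ∈ φ '' D, ∀ u' ∈ φ '' D,
    pull φ (worldFn g φ D) u u' = halfSqDist (g.coord φ) (φ '' D) u u' := by
  rintro _ ⟨x, hx, rfl⟩ _ ⟨x', hx', rfl⟩
  rw [pull_apply _ (hD hx) (hD hx'), worldFn]

theorem IsApprox.of_le {n k : ℕ} {A B : M → M → F} (h : IsApprox g φ D n A B) (hk : k ≤ n) :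
    IsApprox g φ D k A B :=
  ⟨ContMDiffOn.of_le h.left (by exact_mod_cast hk), ContMDiffOn.of_le h.right (by exact_mod_cast hk),
    fun j hj => h.coincidence j (hj.trans hk)⟩

theorem IsCOn.reg_pull [IsManifold 𝓘(ℝ, E4) ∞ M]
    (hφ : φ ∈ IsManifold.maximalAtlas 𝓘(ℝ, E4) ∞ M) (hD : D ⊆ φ.source)
    {n : ℕ∞} {A : M → M → F} (hA : IsCOn D n A) : Reg (φ '' D) n (pull φ A) := by
  have hs : ContMDiffOn 𝓘(ℝ, E4) 𝓘(ℝ, E4) n φ.symm (φ '' D) :=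
    ((contMDiffOn_symm_of_mem_maximalAtlas hφ).of_le (by exact_mod_cast le_top)).mono
      (image_subset_target hD)
  have h1 : ContMDiffOn 𝓘(ℝ, E4 × E4) (𝓘(ℝ, E4).prod 𝓘(ℝ, E4)) n
      (fun p : E4 × E4 => (φ.symm p.1, φ.symm p.2)) ((φ '' D) ×ˢ (φ '' D)) :=
    (hs.comp contDiff_fst.contMDiff.contMDiffOn fun p hp => hp.1).prodMk
      (hs.comp contDiff_snd.contMDiff.contMDiffOn fun p hp => hp.2)
  have hm : MapsTo φ.symm (φ '' D) D := by
    rintro _ ⟨x, hx, rfl⟩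
    rwa [φ.left_inv (hD hx)]
  exact (ContMDiffOn.comp hA h1 fun p hp => ⟨hm hp.1, hm hp.2⟩).contDiffOn

variable [IsManifold 𝓘(ℝ, E4) ∞ M]

/-- Covariant derivatives up to order `n` are continuous in `x'`, so the coincidence limits are
values on the diagonal; those of `B - A` vanish, and `flat_of_iterCov` passes to partial
derivatives. -/
theorem IsApprox.flat (hφ : φ ∈ IsManifold.maximalAtlas 𝓘(ℝ, E4) ∞ M)
    (hD : IsConvexNormal g φ D) {n : ℕ} {A B : M → M → F} (h : IsApprox g φ D n A B) :
    Flat (φ '' D) n fun u u' => pull φ B u u' - pull φ A u u' := by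
  have hN := isNormal hφ hD
  have hΩ := hN.isOpen
  have hΓ := hN.contDiffOn_christoffel
  have rA : Reg (φ '' D) n (pull φ A) := h.left.reg_pull hφ hD.subset_source
  have rB : Reg (φ '' D) n (pull φ B) := h.right.reg_pull hφ hD.subset_source
  refine flat_of_iterCov hΩ hΓ (rB.sub rA) ?_
  rintro k hk I _ ⟨x, hx, rfl⟩
  have hu : φ x ∈ φ '' D := ⟨x, hx, rfl⟩
  have hxs := hD.subset_source hx
  have hkn : (k : WithTop ℕ∞) ≤ n := by exact_mod_cast hk
  have key : ∀ {C : M → M → F} {L : F}, Reg (φ '' D) n (pull φ C) →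
      Tendsto (fun x' => covD g φ k I C x x') (𝓝[≠] x) (𝓝 L) →
      iterCov (g.coord φ) (fun y => pull φ C y (φ x)) k I (φ x) = L := by
    intro C L hC hL
    have h1 := ((hC.iterCov hΩ hΓ (m := 0) k (by omega) I).continuousAt_right hΩ hu hu).tendsto
    have h2 := (h1.comp (φ.continuousAt hxs)).mono_left (nhdsWithin_le_nhds (s := {x}ᶜ))
    have := nhdsNE_neBot hxs
    refine tendsto_nhds_unique (h2.congr' ?_) hL
    filter_upwards [nhdsWithin_le_nhds (φ.open_source.mem_nhds hxs)] with x' hx'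
    exact (covD_eq_iterCov_pull k I C x hx').symm
  obtain ⟨L, hB, hA⟩ := h.coincidence k hk I x hx
  have hl : ∀ {f : E4 → E4 → F}, Reg (φ '' D) n f →
      ContDiffOn ℝ k (fun y => f y (φ x)) (φ '' D) := fun hf y hy =>
    ((hf.contDiffAt_left hΩ hy hu).of_le hkn).contDiffWithinAt
  rw [iterCov_sub hΩ hΓ k (hl rB) (hl rA) I hu, key rB hB, key rA hA, sub_self]

theorem worldFn_symm (hφ : φ ∈ IsManifold.maximalAtlas 𝓘(ℝ, E4) ∞ M) (hD : IsConvexNormal g φ D)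
    {x x' : M} (hx : x ∈ D) (hx' : x' ∈ D) : worldFn g φ D x x' = worldFn g φ D x' x :=
  (isNormal hφ hD).halfSqDist_symm ⟨x, hx, rfl⟩ ⟨x', hx', rfl⟩

/-- A matrix and its transpose have the same determinant, and the two square roots in the
denominator are exchanged. -/
theorem hadamardU_symm (hφ : φ ∈ IsManifold.maximalAtlas 𝓘(ℝ, E4) ∞ M) (hD : IsConvexNormal g φ D)
    {x x' : M} (hx : x ∈ D) (hx' : x' ∈ D) : hadamardU g φ D x x' = hadamardU g φ D x' x := by
  have h := (isNormal hφ hD).D1_D2_halfSqDist_symm ⟨x', hx', rfl⟩ ⟨x, hx, rfl⟩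
  unfold hadamardU vanVleck
  rw [← Matrix.det_transpose, mul_comm (√_)]
  congr 5
  ext i j
  exact congrArg Neg.neg (h i j)

variable {T : M → ℝ} {ℓ : ℝ} {V : M → M → ℝ} {Gp W : M → M → ℂ}

theorem IsHadamardForm.symm_of_spacelike (hφ : φ ∈ IsManifold.maximalAtlas 𝓘(ℝ, E4) ∞ M)
    (hD : IsConvexNormal g φ D) (hℓ : 0 < ℓ) (hV : ∀ x ∈ D, ∀ x' ∈ D, V x x' = V x' x)
    (hW : IsHadamardForm g φ D T ℓ V Gp W) {x x' : M} (hx : x ∈ D) (hx' : x' ∈ D)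
    (h : 0 < worldFn g φ D x x') : W x x' = W x' x := by
  have h' : 0 < worldFn g φ D x' x := by rwa [worldFn_symm hφ hD hx' hx]
  rw [hW.eq_sub x hx x' hx' h.ne', hW.eq_sub x' hx' x hx h'.ne', hW.commute x hx x' hx' h,
    hadamardH_of_pos T hℓ _ _ _ h, hadamardH_of_pos T hℓ _ _ _ h', worldFn_symm hφ hD hx hx',
    hadamardU_symm hφ hD hx hx', hV x hx x' hx']

/-- The second-order jets at `x` of `W(·, x)` and `W(x, ·)` agree. -/
theorem IsHadamardForm.jet_symm (hφ : φ ∈ IsManifold.maximalAtlas 𝓘(ℝ, E4) ∞ M)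
    (hD : IsConvexNormal g φ D) (hℓ : 0 < ℓ) (hV : ∀ x ∈ D, ∀ x' ∈ D, V x x' = V x' x)
    (hW : IsHadamardForm g φ D T ℓ V Gp W) {u : E4} (hu : u ∈ φ '' D) :
    (∀ i, pd i (fun y => pull φ W y u) u = pd i (pull φ W u) u) ∧
      ∀ i j, pd i (pd j fun y => pull φ W y u) u = pd i (pd j (pull φ W u)) u := by
  have hN := isNormal hφ hD
  have rW : Reg (φ '' D) 2 (pull φ W) :=
    (hW.smooth.reg_pull hφ hD.subset_source).of_le two_le_infty
  have cl := rW.contDiffAt_left hN.isOpen hu hu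
  have cr := rW.contDiffAt_right hN.isOpen hu hu
  obtain ⟨v, hv⟩ := exists_spacelike g hφ (image_subset_target hD.subset_source hu)
  have hs : IsOpen {y | y ∈ φ '' D ∧ 0 < halfSqDist (g.coord φ) (φ '' D) y u} := by
    have hc : ContinuousOn (fun y => halfSqDist (g.coord φ) (φ '' D) y u) (φ '' D) := fun y hy =>
      (hN.reg_halfSqDist.contDiffAt_left hN.isOpen hy hu).continuousAt.continuousWithinAt
    exact hc.isOpen_inter_preimage hN.isOpen isOpen_Ioi
  have h0 : ∀ y ∈ {y | y ∈ φ '' D ∧ 0 < halfSqDist (g.coord φ) (φ '' D) y u},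
      pull φ W y u - pull φ W u y = 0 := by
    rintro _ ⟨⟨x', hx', rfl⟩, h⟩
    obtain ⟨x, hx, rfl⟩ := hu
    rw [pull_apply W (hD.subset_source hx') (hD.subset_source hx),
      pull_apply W (hD.subset_source hx) (hD.subset_source hx'),
      hW.symm_of_spacelike hφ hD hℓ hV hx' hx h, sub_self]
  obtain ⟨h1, h2⟩ := jet_eq_zero_of_mem_closure hs (hN.mem_closure_spacelike hu hv)
    (cl.sub cr) h0
  refine ⟨fun i => sub_eq_zero.1 ?_, fun i j => sub_eq_zero.1 ?_⟩
  · rw [← h1 i, ← pd_sub (cl.differentiableAt (by simp)) (cr.differentiableAt (by simp))]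
  · rw [← h2 i j, ← pd_pd_sub cl cr]

end Pull

/-! ### The covariant Taylor expansion and the coincidence limits -/

section Limits

variable {M : Type*} [TopologicalSpace M] [ChartedSpace E4 M]
variable {g : LorentzMetric M} {φ : OpenPartialHomeomorph M E4} {D : Set M} {x : M}

theorem gradUp_eq (hD : IsConvexNormal g φ D) (hx : x ∈ D) {x' : M} (hx' : x' ∈ D) (a : Fin 4) :
    gradUp g φ D x x' a = gradSq (g.coord φ) (φ '' D) a (φ x) (φ x') := by
  have hΩ := φ.isOpen_image_of_subset_source hD.isOpen hD.subset_source
  refine Finset.sum_congr rfl fun b _ => congrArg _ ?_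
  rw [covD_eq_iterCov_pull _ _ _ _ (hD.subset_source hx'), iterCov_one]
  exact pd_congr (Filter.eventually_of_mem (hΩ.mem_nhds ⟨x, hx, rfl⟩) fun y hy =>
    pull_worldFn hD.subset_source y hy _ ⟨x', hx', rfl⟩) b

variable [IsManifold 𝓘(ℝ, E4) ∞ M]

/-- By `norm_isTheta`, the remainder `O(|∇Σ|³)` may be measured by the coordinate distance instead.
-/
theorem isCovTaylor_iff (hφ : φ ∈ IsManifold.maximalAtlas 𝓘(ℝ, E4) ∞ M)
    (hD : IsConvexNormal g φ D) (hx : x ∈ D) {W : M → M → ℂ}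
    {w : ℂ × (Fin 4 → ℂ) × Matrix (Fin 4) (Fin 4) ℂ} :
    IsCovTaylor g φ D W x w ↔ w.2.2.IsSymm ∧
      (fun y => pull φ W (φ x) y - quadPoly (w.1, w.2.1, fun i j => w.2.2 i j)
        fun i => gradSq (g.coord φ) (φ '' D) i (φ x) y) =O[𝓝 (φ x)] fun y => ‖y - φ x‖ ^ 3 := by
  have hN := isNormal hφ hD
  have hu : φ x ∈ φ '' D := ⟨x, hx, rfl⟩
  refine and_congr_right fun _ => ?_
  rw [← (norm_isTheta (fun i => ((hN.reg_gradSq i).contDiffAt_right hN.isOpen hu hu).of_le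
    three_le_infty) (fun i => hN.gradSq_diag hu i)
    fun i b => hN.pd_gradSq hu i b).isBigO_congr_right,
    ← φ.map_nhds_eq (hD.subset_source hx), Asymptotics.isBigO_map]
  have hev := hD.isOpen.mem_nhds hx
  refine Asymptotics.isBigO_congr ?_ ?_
  · filter_upwards [hev] with x' hx'
    simp only [Function.comp_apply, pull_apply W (hD.subset_source hx) (hD.subset_source hx'),
      quadPoly, gradUp_eq hD hx hx', Complex.real_smul]
    push_cast
    congr 2
    · congr 1
      exact Finset.sum_congr rfl fun i _ => mul_comm _ _
    · congr 1
      exact Finset.sum_congr rfl fun i _ => Finset.sum_congr rfl fun j _ => by ring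
  · filter_upwards [hev] with x' hx'
    have : gradUp g φ D x x' = fun i => gradSq (g.coord φ) (φ '' D) i (φ x) (φ x') :=
      funext fun i => gradUp_eq hD hx hx' i
    rw [Function.comp_apply, this]

/-- `sub_quadPoly_isBigO` provides one expansion. For any other, subtraction eliminates `W` and
leaves a quadratic polynomial in `Σ^a` of third order, which is zero. The coefficients involve
derivatives at the second point `x'`. -/
theorem isCovTaylor_iff_eq (hφ : φ ∈ IsManifold.maximalAtlas 𝓘(ℝ, E4) ∞ M)
    (hD : IsConvexNormal g φ D) (hx : x ∈ D) {W : M → M → ℂ} (hW : IsCOn D ⊤ W)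
    {w : ℂ × (Fin 4 → ℂ) × Matrix (Fin 4) (Fin 4) ℂ} :
    IsCovTaylor g φ D W x w ↔ w = (pull φ W (φ x) (φ x), (fun i => -pd i (pull φ W (φ x)) (φ x)),
      Matrix.of fun i j => pd i (pd j (pull φ W (φ x))) (φ x)
        - ∑ k, christoffel (g.coord φ) k i j (φ x) • pd k (pull φ W (φ x)) (φ x)) := by
  have hN := isNormal hφ hD
  have hu : φ x ∈ φ '' D := ⟨x, hx, rfl⟩
  have hq := fun i => ((hN.reg_gradSq i).contDiffAt_right hN.isOpen hu hu).of_le three_le_infty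
  have hq0 := fun i => hN.gradSq_diag hu i
  have hq1 := fun i b => hN.pd_gradSq hu i b
  have hWr := ((hW.reg_pull hφ hD.subset_source).contDiffAt_right hN.isOpen hu hu).of_le
    three_le_infty
  have h := sub_quadPoly_isBigO hq hq0 hq1 (Γ := fun k i j => christoffel (g.coord φ) k i j (φ x))
    (fun i b c => hN.pd_pd_gradSq hu i b c) hWr
  rw [isCovTaylor_iff hφ hD hx]
  have hsymm : ∀ i j, pd i (pd j (pull φ W (φ x))) (φ x)
        - ∑ k, christoffel (g.coord φ) k i j (φ x) • pd k (pull φ W (φ x)) (φ x) =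
      pd j (pd i (pull φ W (φ x))) (φ x)
        - ∑ k, christoffel (g.coord φ) k j i (φ x) • pd k (pull φ W (φ x)) (φ x) := by
    intro i j
    rw [pd_comm (hWr.of_le (by norm_num)) i j]
    simp only [hN.christoffel_symm hu _ i j]
  constructor
  · rintro ⟨h1, h2⟩
    have h3 := h2.sub h
    simp only [sub_sub_sub_cancel_left, quadPoly_sub] at h3
    have h4 := quadPoly_eq_zero_of_isBigO hq hq0 hq1 (fun i j => ?_) h3
    · obtain ⟨w0, w1, w2⟩ := w
      rw [sub_eq_zero] at h4
      simp only [Prod.mk.injEq] at h4 ⊢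
      exact ⟨h4.1.symm, h4.2.1.symm, h4.2.2.symm⟩
    · exact congrArg₂ (· - ·) (hsymm i j) (h1.apply j i)
  · rintro rfl
    exact ⟨Matrix.IsSymm.ext fun i j => hsymm j i, h⟩

theorem sum_coord_mfderiv (hφ : φ ∈ IsManifold.maximalAtlas 𝓘(ℝ, E4) ∞ M) (hx : x ∈ φ.source)
    {v : TangentSpace 𝓘(ℝ, E4) x} {w : E4} (hw : mfderiv 𝓘(ℝ, E4) 𝓘(ℝ, E4) φ x v = w) :
    ∑ i, ∑ j, g.coord φ (φ x) i j * w i * w j = g.val x v v := by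
  refine (g.coord_form φ (φ x) _ _).trans ?_
  subst hw
  have h1 : (mfderiv 𝓘(ℝ, E4) 𝓘(ℝ, E4) φ.symm (φ x) (mfderiv 𝓘(ℝ, E4) 𝓘(ℝ, E4) φ x v) : E4) = v :=
    congrArg (fun L => L v) ((mdifferentiable_of_mem_maximalAtlas hφ).symm_comp_deriv hx)
  -- The two sides live in the tangent spaces at `φ.symm (φ x)` and at `x`; generalizing the base
  -- point allows the equality to be substituted.
  have h2 : ∀ (y : M) (v' : E4), y = x → v' = v →
      g.val y (v' : TangentSpace 𝓘(ℝ, E4) y) v' = g.val x v v := by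
    rintro y v' rfl rfl
    rfl
  exact h2 _ _ (φ.left_inv hx) h1

/-- A trajectory enters only through the filter it pushes forward to the chart;
`IsNormal.eventually_lower_bound` turns its non-null tangent into the bound `κ r² ≤ |Σ|`. -/
theorem hasCoincidenceLimit_of_tendsto {F : Type*} [NormedAddCommGroup F] [NormedSpace ℝ F]
    (hφ : φ ∈ IsManifold.maximalAtlas 𝓘(ℝ, E4) ∞ M) (hD : IsConvexNormal g φ D) (hx : x ∈ D)
    {f : M → M → F} {h : E4 → F} {L : F} (hf : ∀ x' ∈ D, f x x' = h (φ x'))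
    (hlim : ∀ l ≤ 𝓝 (φ x), (∀ᶠ u' in l, u' ≠ φ x) →
      ∀ κ > 0, (∀ᶠ u' in l, κ * ‖u' - φ x‖ ^ 2 ≤ |halfSqDist (g.coord φ) (φ '' D) (φ x) u'|) →
        Tendsto h l (𝓝 L)) :
    HasCoincidenceLimit g f x L := by
  rintro γ rfl hγ hv
  have hN := isNormal hφ hD
  have hxs := hD.subset_source hx
  set w : E4 := mfderiv 𝓘(ℝ, E4) 𝓘(ℝ, E4) φ (γ 0)
    (mfderivWithin 𝓘(ℝ, ℝ) 𝓘(ℝ, E4) γ (Ici 0) 0 (1 : ℝ)) with hw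
  obtain ⟨L, hL, hLw⟩ : ∃ L : ℝ →L[ℝ] E4, HasFDerivWithinAt (φ ∘ γ) L (Ici 0) 0 ∧ L 1 = w :=
    ⟨_, (((mdifferentiable_of_mem_maximalAtlas hφ).mdifferentiableAt
      hxs).hasMFDerivAt.comp_hasMFDerivWithinAt 0 hγ.hasMFDerivWithinAt).hasFDerivWithinAt, rfl⟩
  have hc : HasDerivWithinAt (φ ∘ γ) w (Ici 0) 0 := hLw ▸ hL.hasDerivWithinAt
  rw [← sum_coord_mfderiv hφ hxs hw.symm] at hv
  obtain ⟨κ, hκ, he⟩ := hN.eventually_lower_bound ⟨γ 0, hx, rfl⟩ hc rfl hv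
  have hγ0 : Tendsto γ (𝓝[>] 0) (𝓝 (γ 0)) :=
    hγ.continuousWithinAt.tendsto.mono_left (nhdsWithin_mono _ Ioi_subset_Ici_self)
  have ht : Tendsto (φ ∘ γ) (𝓝[>] 0) (𝓝 (φ (γ 0))) := (φ.continuousAt hxs).tendsto.comp hγ0
  have := hlim (map (φ ∘ γ) (𝓝[>] 0)) ht (eventually_map.2 (he.mono fun s hs => hs.2)) κ hκ
    (eventually_map.2 (he.mono fun s hs => hs.1))
  refine (tendsto_map'_iff.1 this).congr' ?_
  filter_upwards [hγ0 (hD.isOpen.mem_nhds hx)] with s hs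
  exact (hf (γ s) hs).symm

end Limits

/-! ### The approximate singular part -/

section Approximation

variable {M : Type*} [TopologicalSpace M] [ChartedSpace E4 M] [IsManifold 𝓘(ℝ, E4) ∞ M]
variable {g : LorentzMetric M} {o : TimeOrientation g} {φ : OpenPartialHomeomorph M E4} {D : Set M}
variable {T : M → ℝ} {St : M → M → ℝ}

/-- Near a pair of points at non-null separation, the singular parts built from the world function
and from its approximation are evaluated on the same branch of the logarithm. -/
theorem eventually_same_branch (hT : IsTimeFunction g o T)
    (hφ : φ ∈ IsManifold.maximalAtlas 𝓘(ℝ, E4) ∞ M) (hD : IsConvexNormal g φ D) {u u' : E4}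
    (hu : u ∈ φ '' D) (hu' : u' ∈ φ '' D) (hS : halfSqDist (g.coord φ) (φ '' D) u u' ≠ 0)
    (hc : ContinuousAt (fun y => pull φ St y u') u)
    (hlt : |pull φ St u u' - halfSqDist (g.coord φ) (φ '' D) u u'| <
      |halfSqDist (g.coord φ) (φ '' D) u u'|) :
    ∀ᶠ y in 𝓝 u, ∀ S ∈ ({worldFn g φ D, St} : Set (M → M → ℝ)), pull φ S y u' ≠ 0 ∧
      (pull φ S y u' < 0 → T (φ.symm y) ≠ T (φ.symm u')) ∧
      argSign T S (φ.symm y) (φ.symm u') =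
        argSign T (worldFn g φ D) (φ.symm u) (φ.symm u') := by
  have hN := isNormal hφ hD
  have hw := pull_worldFn (g := g) (φ := φ) hD.subset_source
  have hcσ : ContinuousAt (fun y => halfSqDist (g.coord φ) (φ '' D) y u') u :=
    (hN.reg_halfSqDist.contDiffAt_left hN.isOpen hu hu').continuousAt
  have hmem := hN.isOpen.mem_nhds hu
  rw [← hw u hu u' hu'] at hS hlt
  have hwc : ∀ᶠ y in 𝓝 u, pull φ (worldFn g φ D) y u' = halfSqDist (g.coord φ) (φ '' D) y u' := by
    filter_upwards [hmem] with y hy using hw y hy u' hu'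
  have hcw : ContinuousAt (fun y => pull φ (worldFn g φ D) y u') u := hcσ.congr_of_eventuallyEq hwc
  rcases lt_or_gt_of_ne hS with h | h
  · have hSt : pull φ St u u' < 0 := by
      rw [abs_of_neg h, abs_lt] at hlt
      linarith [hlt.2]
    have hTc : ContinuousAt (fun y => T (φ.symm y)) u := hT.1.continuousAt.comp
      (φ.continuousAt_symm (image_subset_target hD.subset_source hu))
    have hTne : T (φ.symm u) ≠ T (φ.symm u') :=
      time_ne_of_timelike hT hφ hD hu hu' (by rwa [← hw u hu u' hu'])
    -- Since the two times differ, continuity of `T` fixes their order, and with it the sign of the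
    -- imaginary part, for all `y` near `u`.
    have hTe : ∀ᶠ y in 𝓝 u, (T (φ.symm u') < T (φ.symm y) ↔ T (φ.symm u') < T (φ.symm u)) := by
      rcases lt_or_gt_of_ne hTne with ht | ht
      · filter_upwards [hTc.eventually_lt_const ht] with y hy
        exact iff_of_false hy.not_gt ht.not_gt
      · filter_upwards [hTc.eventually_const_lt ht] with y hy
        exact iff_of_true hy ht
    have key : ∀ S : M → M → ℝ, pull φ S u u' < 0 → ContinuousAt (fun y => pull φ S y u') u →
        ∀ᶠ y in 𝓝 u, pull φ S y u' ≠ 0 ∧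
          (pull φ S y u' < 0 → T (φ.symm y) ≠ T (φ.symm u')) ∧
          argSign T S (φ.symm y) (φ.symm u') =
            argSign T (worldFn g φ D) (φ.symm u) (φ.symm u') := by
      intro S h1 h2
      filter_upwards [h2.eventually_lt_const h1, hTe, hTc.eventually_ne hTne] with y h3 h4 h5
      refine ⟨h3.ne, fun _ => h5, ?_⟩
      rw [argSign, argSign, if_neg (show ¬ 0 < S (φ.symm y) (φ.symm u') from h3.not_gt),
        if_neg (show ¬ 0 < worldFn g φ D (φ.symm u) (φ.symm u') from h.not_gt)]
      simp only [h4]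
    filter_upwards [key _ h hcw, key _ hSt hc] with y h1 h2
    rintro S (rfl | rfl)
    exacts [h1, h2]
  · have hSt : 0 < pull φ St u u' := by
      rw [abs_of_pos h, abs_lt] at hlt
      linarith [hlt.1]
    have key : ∀ S : M → M → ℝ, 0 < pull φ S u u' → ContinuousAt (fun y => pull φ S y u') u →
        ∀ᶠ y in 𝓝 u, pull φ S y u' ≠ 0 ∧
          (pull φ S y u' < 0 → T (φ.symm y) ≠ T (φ.symm u')) ∧
          argSign T S (φ.symm y) (φ.symm u') =
            argSign T (worldFn g φ D) (φ.symm u) (φ.symm u') := by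
      intro S h1 h2
      filter_upwards [h2.eventually_const_lt h1] with y h3
      refine ⟨h3.ne', fun h4 => absurd h4 h3.not_gt, ?_⟩
      rw [argSign, argSign, if_pos (show 0 < S (φ.symm y) (φ.symm u') from h3),
        if_pos (show 0 < worldFn g φ D (φ.symm u) (φ.symm u') from h)]
    filter_upwards [key _ h hcw, key _ hSt hc] with y h1 h2
    rintro S (rfl | rfl)
    exacts [h1, h2]

theorem argSign_isBigO_one {X : Type*} (T : X → ℝ) (S : X → X → ℝ) (l : Filter E4) (a b : E4 → X) :
    (fun u' => argSign T S (a u') (b u')) =O[l] fun _ => (1 : ℝ) := by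
  refine Asymptotics.IsBigO.of_bound 1 (Eventually.of_forall fun u' => ?_)
  unfold argSign
  split_ifs <;> simp

variable {ℓ : ℝ} {V Ut Vt : M → M → ℝ} {Gp W Wt : M → M → ℂ}

/-- The limits of `G⁺ - H̃` and of its second covariant derivatives are those of `W`. -/
theorem tendsto_approx (hT : IsTimeFunction g o T)
    (hφ : φ ∈ IsManifold.maximalAtlas 𝓘(ℝ, E4) ∞ M) (hD : IsConvexNormal g φ D) (hℓ : 0 < ℓ)
    (hV : IsCOn D ⊤ V) (hW : IsHadamardForm g φ D T ℓ V Gp W)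
    (hSt : IsApprox g φ D 6 (worldFn g φ D) St) (hUt : IsApprox g φ D 4 (hadamardU g φ D) Ut)
    (hVt : IsApprox g φ D 2 V Vt) (hVt3 : IsCOn D 3 Vt)
    (hWt : ∀ y y', Wt y y' = Gp y y' - hadamardH T ℓ St Ut Vt y y')
    {a : E4} (ha : a ∈ φ '' D) {l : Filter E4} (hl : l ≤ 𝓝 a) (hne : ∀ᶠ u' in l, u' ≠ a)
    {κ : ℝ} (hκ : 0 < κ)
    (hlow : ∀ᶠ u' in l, κ * ‖u' - a‖ ^ 2 ≤ |halfSqDist (g.coord φ) (φ '' D) a u'|) :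
    Tendsto (pull φ Wt a) l (𝓝 (pull φ W a a)) ∧ ∀ i j,
      Tendsto (fun u' => iterCov (g.coord φ) (fun y => pull φ Wt y u') 2 ![i, j] a) l
        (𝓝 (iterCov (g.coord φ) (fun y => pull φ W y a) 2 ![i, j] a)) := by
  have hN := isNormal hφ hD
  have hΩ := hN.isOpen
  have hDs := hD.subset_source
  have hw := pull_worldFn (g := g) (φ := φ) hDs
  have rW : Reg (φ '' D) 2 (pull φ W) := (hW.smooth.reg_pull hφ hDs).of_le two_le_infty
  -- The regularity of `U`, a square root, is taken from the approximation hypothesis, which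
  -- includes it.
  have rU : Reg (φ '' D) 2 (pull φ (hadamardU g φ D)) :=
    (hUt.left.reg_pull hφ hDs).of_le (by norm_num)
  have rV := hV.reg_pull hφ hDs
  have rSt : Reg (φ '' D) 2 (pull φ St) := (hSt.right.reg_pull hφ hDs).of_le (by norm_num)
  have rVt3 : Reg (φ '' D) 3 (pull φ Vt) := hVt3.reg_pull hφ hDs
  have fS : Flat (φ '' D) 6 fun u u' => pull φ St u u' - halfSqDist (g.coord φ) (φ '' D) u u' :=
    (hSt.flat hφ hD).congr hΩ fun u hu u' hu' => by rw [hw u hu u' hu']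
  have fV := hVt.flat hφ hD
  have fV3 : Reg (φ '' D) 3 fun u u' => pull φ Vt u u' - pull φ V u u' :=
    rVt3.sub (rV.of_le three_le_infty)
  have nR := negligible_sub hΩ ha hl hne hκ hlow (hN.jetO_halfSqDist ha hl) fS rU
    (hUt.flat hφ hD) (rV.of_le two_le_infty) fV fV3 (Real.log (ℓ ^ 2))
  -- The imaginary parts of the two logarithms. The sign is evaluated at `a`, since it is locally
  -- constant in the first argument and so is not differentiated.
  have nE : Negligible l a fun u u' => -1 * (pull φ Vt u u' - pull φ V u u')
      * argSign T (worldFn g φ D) (φ.symm a) (φ.symm u') :=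
    ⟨_, tendsto_norm_sub hl, ((fV.jetO_of_reg hΩ fV3 ha hl).const_mul (-1)).mul_right
      (argSign_isBigO_one T _ l _ _)⟩
  refine tendsto_iterCov_two hΩ ha hl rW nR nE (c₁ := 1 / (8 * (Real.pi : ℂ) ^ 2))
    (c₂ := 1 / (8 * (Real.pi : ℂ) ^ 2) * (Real.pi * Complex.I)) ?_
  filter_upwards [hlow, hne, eventually_sub_le hΩ ha hl fS hκ, hl (hΩ.mem_nhds ha)]
    with u' h1 h2 h3 hu'
  have hpos : 0 < κ * ‖u' - a‖ ^ 2 := by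
    have : 0 < ‖u' - a‖ := norm_pos_iff.2 (sub_ne_zero.2 h2)
    positivity
  have hS0 : halfSqDist (g.coord φ) (φ '' D) a u' ≠ 0 := abs_pos.1 (hpos.trans_le h1)
  -- The final inequality is `|St - Σ| ≤ κ/2 r² < κ r² ≤ |Σ|`, so `St` and `Σ` have the same sign.
  filter_upwards [hΩ.mem_nhds ha, eventually_same_branch hT hφ hD ha hu' hS0
    (rSt.contDiffAt_left hΩ ha hu').continuousAt (by linarith)] with y hy hb
  obtain ⟨b1, b2, b3⟩ := hb _ (mem_insert _ _)
  obtain ⟨d1, d2, d3⟩ := hb St (mem_insert_of_mem _ rfl)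
  have hm : ∀ u ∈ φ '' D, φ.symm u ∈ D := by
    rintro _ ⟨z, hz, rfl⟩
    rwa [φ.left_inv (hDs hz)]
  have e1 := hW.eq_sub (φ.symm y) (hm y hy) (φ.symm u') (hm u' hu') b1
  rw [hadamardH_eq T hℓ _ _ _ b1 b2, b3, ← sub_eq_zero] at e1
  have e2 := hWt (φ.symm y) (φ.symm u')
  rw [hadamardH_eq T hℓ _ _ _ d1 d2, d3, ← sub_eq_zero] at e2
  have hwy := hw y hy u' hu'
  rw [← hwy]
  simp only [pull, Complex.real_smul] at *
  push_cast at *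
  linear_combination e2 - e1

end Approximation

end Hadamard

end
-- The Taylor coefficients as coincidence limits
open Hadamard in
theorem mainTheorem2 {M : Type*} [TopologicalSpace M] [ChartedSpace E4 M]
    [IsManifold 𝓘(ℝ, E4) ∞ M]
    (g : LorentzMetric M) (o : TimeOrientation g) (T : M → ℝ) (hT : IsTimeFunction g o T)
    (φ : OpenPartialHomeomorph M E4) (hφ : φ ∈ IsManifold.maximalAtlas 𝓘(ℝ, E4) ∞ M)
    (D : Set M) (hD : IsConvexNormal g φ D)
    (m ξ ℓ : ℝ) (hℓ : 0 < ℓ)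
    (V : M → M → ℝ) (hV : IsHadamardV g φ D m ξ V)
    (Gp W : M → M → ℂ) (hW : IsHadamardForm g φ D T ℓ V Gp W)
    (nS nU nV : ℕ) (hnS : 6 ≤ nS) (hnU : 4 ≤ nU) (hnV : 2 ≤ nV)
    (St Ut Vt : M → M → ℝ)
    (hSt : IsApprox g φ D nS (worldFn g φ D) St)
    (hUt : IsApprox g φ D nU (hadamardU g φ D) Ut)
    (hVt : IsApprox g φ D nV V Vt) (hVt3 : IsCOn D 3 Vt)
    (Wt : M → M → ℂ) (hWt : ∀ y y', Wt y y' = Gp y y' - hadamardH T ℓ St Ut Vt y y')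
    (x : M) (hx : x ∈ D) :
    (∃! w, IsCovTaylor g φ D W x w) ∧
    ∀ w, IsCovTaylor g φ D W x w →
      HasCoincidenceLimit g Wt x w.1 ∧
      ∀ a b, HasCoincidenceLimit g (covD g φ 2 ![a, b] Wt) x (w.2.2 a b) := by
  have hu : φ x ∈ φ '' D := ⟨x, hx, rfl⟩
  have hxs := hD.subset_source hx
  have hiff := fun w => isCovTaylor_iff_eq hφ hD hx hW.smooth (w := w)
  refine ⟨⟨_, (hiff _).2 rfl, fun w hw => (hiff w).1 hw⟩, fun w hw => ?_⟩
  obtain rfl := (hiff w).1 hw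
  have hlim := fun l hl hne κ hκ hlow => tendsto_approx (l := l) (κ := κ) hT hφ hD hℓ hV.1 hW
    (hSt.of_le hnS) (hUt.of_le hnU) (hVt.of_le hnV) hVt3 hWt hu hl hne hκ hlow
  refine ⟨hasCoincidenceLimit_of_tendsto hφ hD hx
    (fun x' hx' => (pull_apply Wt hxs (hD.subset_source hx')).symm)
    fun l hl hne κ hκ hlow => (hlim l hl hne κ hκ hlow).1, fun a b => ?_⟩
  refine hasCoincidenceLimit_of_tendsto hφ hD hx
    (h := fun u' => iterCov (g.coord φ) (fun y => pull φ Wt y u') 2 ![a, b] (φ x))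
    (fun x' hx' => covD_eq_iterCov_pull 2 ![a, b] Wt x (hD.subset_source hx'))
    fun l hl hne κ hκ hlow => ?_
  have h := (hlim l hl hne κ hκ hlow).2 a b
  -- The limit obtained differentiates `W` at its first argument, the Taylor coefficient at its
  -- second; equality of the 2-jets identifies them.
  obtain ⟨j1, j2⟩ := hW.jet_symm hφ hD hℓ hV.2.1 hu
  rw [iterCov_two] at h
  simp only [j1, j2] at h
  exact h
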